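/- **Lemma (Euler–Lagrange equations).** Identify functions on $\mathbb T^3=\mathbb R^3/\mathbb Z^3$ with $\mathbb Z^3$-periodic functions on $\mathbb R^3$, let $G_h(z)=(4\pi h)^{-3/2}e^{-|z|^2/(4h)}$ for $z\in\mathbb R^3$, $h>0$, and $(G_h\ast f)(x)=\int_{\mathbb R^3}G_h(z)f(x-z)\,dz$. For every $h>0$ let $u^0=u^{0,h},u^1=u^{1,h},\dots:\mathbb T^3\to\mathbb S^1\subset\mathbb R^2$ be measurable maps generated by the thresholding scheme with step size $h$, that is, for every $n\ge1$ and almost every $x$ with $(G_h\ast u^{n-1})(x)\neq0$, $$u^n(x)=\frac{(G_h\ast u^{n-1})(x)}{|(G_h\ast u^{n-1})(x)|}$$ (the choice of $u^n(x)\in\mathbb S^1$ is arbitrary where $G_h\ast u^{n-1}$ vanishes). Assume that the initial data (which may be independent of $h$) satisfy, with a constant $C$ and for all sufficiently small $h>0$, $$E_h(u^0):=\frac1h\int_{\mathbb T^3}\bigl(1-u^0\cdot G_h\ast u^0\bigr)\,dx\le C\,|\log h| .$$ Let $u^h(x,t)=u^n(x)$ for $t\in[nh,(n+1)h)$, $n\ge0$,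 and $u^h(x,t)=u^0(x)$ for $t<0$; for $\tau\ne0$ let $\partial_t^{\tau}v(t)=\frac{v(t)-v(t-\tau)}{\tau}$. Let $0<T<\infty$, write $\iint dx\,dt=\int_0^T\int_{\mathbb T^3}dx\,dt$, and let $o(1)$ denote a quantity that tends to $0$ as $h\downarrow0$ with $T$, the test function and the family of initial data fixed. (i) For every smooth vector field $\xi:\mathbb T^3\times[0,T]\to\mathbb R^3$, $$2\iint G_{h/2}\ast\partial_t^hu^h\cdot(\xi\cdot\nabla)\,G_{h/2}\ast u^h\,dx\,dt=\frac1h\iint(\nabla\cdot\xi)\bigl(1-u^h\cdot G_h\ast u^h\bigr)\,dx\,dt-2\sum_{i,j=1}^3\iint\partial_i\xi_j\;\partial_iG_{h/2}\ast u^h\cdot\partial_jG_{h/2}\ast u^h\,dx\,dt+o(1).$$ (ii) For every smooth function $\zeta:\mathbb T^3\times[0,T]\to\mathbb R$ and all $i,j\in\{1,2\}$, both for the backward quotient $\tau=h$ and for the forward quotient $\tau=-h$, $$\iint\bigl(u^h_j\,\partial_t^{\tau}G_h\ast u^h_i-u^h_i\,\partial_t^{\tau}G_h\ast u^h_j\bigr)\zeta+\bigl(u^h_j\nabla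 G_h\ast u^h_i-u^h_i\nabla G_h\ast u^h_j\bigr)\cdot\nabla\zeta\,dx\,dt=o(1).$$ -/

import Mathlib

open scoped Topology ContDiff
open MeasureTheory Filter

namespace FilamentThresholding

noncomputable section

/-- The physical space `ℝ³`; functions on the torus `𝕋³ = ℝ³ / ℤ³` are treated as `ℤ³`-periodic
functions on it. -/
abbrev Space : Type := EuclideanSpace ℝ (Fin 3)

/-- The target plane `ℝ²`, which contains the unit circle `𝕊¹`. -/
abbrev Plane : Type := EuclideanSpace ℝ (Fin 2)

/-- `ℤ³`-periodicity, i.e. `f` is (the lift of) a function on `𝕋³`. -/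
def PeriodicZ3 {F : Type*} (f : Space → F) : Prop :=
  ∀ (k : Fin 3) (x : Space), f (x + EuclideanSpace.single k 1) = f x

/-- The fundamental cell `[0,1)³`; the integral over `𝕋³` is the integral over it. -/
def cell : Set Space := {x | ∀ k : Fin 3, x k ∈ Set.Ico (0 : ℝ) 1}

/-- The space-time integral `∫_0^T ∫_{𝕋³} f dx dt`. -/
def spaceTimeIntegral (T : ℝ) (f : ℝ → Space → ℝ) : ℝ :=
  ∫ t in (0 : ℝ)..T, ∫ x in cell, f t x

/-- The heat kernel `G_h(z) = (4πh)^{-3/2} exp(-|z|²/(4h))` on `ℝ³`. -/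
def heatKernel (h : ℝ) (z : Space) : ℝ :=
  1 / (4 * Real.pi * h) ^ ((3 : ℝ) / 2) * Real.exp (-‖z‖ ^ 2 / (4 * h))

/-- The convolution `(G_h ∗ f)(x) = ∫_{ℝ³} G_h(z) f(x - z) dz`. -/
def heatConv {F : Type*} [NormedAddCommGroup F] [NormedSpace ℝ F]
    (h : ℝ) (f : Space → F) : Space → F :=
  convolution (heatKernel h) f (ContinuousLinearMap.lsmul ℝ ℝ) volume

/-- The partial derivative `∂_k f`. -/
def pderiv {F : Type*} [NormedAddCommGroup F] [NormedSpace ℝ F]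
    (k : Fin 3) (f : Space → F) (x : Space) : F :=
  fderiv ℝ f x (EuclideanSpace.single k 1)

/-- The divergence `∇ · X` of a vector field. -/
def divergence (X : Space → Space) (x : Space) : ℝ :=
  ∑ k : Fin 3, pderiv k X x k

/-- The thresholding energy `E_h(u) = (1/h) ∫_{𝕋³} (1 - u · G_h ∗ u) dx`. -/
def energy (h : ℝ) (u : Space → Plane) : ℝ :=
  1 / h * ∫ x in cell, (1 - inner ℝ (u x) (heatConv h u x))

/-- `u 0, u 1, …` is a sequence of measurable maps `𝕋³ → 𝕊¹` produced by the thresholding scheme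
with time step `h`: wherever `v = G_h ∗ u n` does not vanish, `u (n + 1) = v / |v|`. (Where `v`
vanishes the projection is not defined, and any value in `𝕊¹` is admitted there.) As usual for
measurable maps, the pointwise conditions are required almost everywhere. -/
structure IsThresholdingScheme (h : ℝ) (u : ℕ → Space → Plane) : Prop where
  periodic : ∀ n, PeriodicZ3 (u n)
  measurable : ∀ n, AEStronglyMeasurable (u n) volume
  unit : ∀ n, ∀ᵐ x : Space, ‖u n x‖ = 1
  step : ∀ n, ∀ᵐ x : Space, heatConv h (u n) x ≠ 0 →
    u (n + 1) x = (‖heatConv h (u n) x‖)⁻¹ • heatConv h (u n) x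

/-- The piecewise constant interpolation, `u^h(t) = u n` for `t ∈ [n h, (n + 1) h)`. For `t < 0`
the value is `u 0` (the floor of a negative number is the natural number `0`). -/
def interpolation (h : ℝ) (u : ℕ → Space → Plane) (t : ℝ) (x : Space) : Plane :=
  u ⌊t / h⌋₊ x

/-- The difference quotient `∂_t^τ v (t) = (v(t) - v(t - τ)) / τ`: the backward quotient for
`τ = h > 0`, and `(v(t + h) - v(t)) / h` for `τ = -h`. -/
def diffQuot {F : Type*} [AddCommGroup F] [Module ℝ F]
    (τ : ℝ) (v : ℝ → Space → F) (t : ℝ) (x : Space) : F :=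
  τ⁻¹ • (v t x - v (t - τ) x)

/-- Smooth functions on `𝕋³ × [0,T]` (smooth up to the times `0` and `T`). -/
def IsSmoothOnTorus {F : Type*} [NormedAddCommGroup F] [NormedSpace ℝ F]
    (T : ℝ) (f : ℝ → Space → F) : Prop :=
  ContDiffOn ℝ ∞ (fun p : ℝ × Space => f p.1 p.2) (Set.Icc 0 T ×ˢ Set.univ) ∧
    ∀ t ∈ Set.Icc 0 T, PeriodicZ3 (f t)

/-- `2 ∬ G_{h/2} ∗ ∂_t^h w · (ξ · ∇) G_{h/2} ∗ w dx dt`. -/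
def innerLHS (T h : ℝ) (w : ℝ → Space → Plane) (ξ : ℝ → Space → Space) : ℝ :=
  2 * spaceTimeIntegral T fun t x =>
    inner ℝ (heatConv (h / 2) (diffQuot h w t) x)
      (∑ k : Fin 3, ξ t x k • pderiv k (heatConv (h / 2) (w t)) x)

/-- `(1/h) ∬ (∇ · ξ) (1 - w · G_h ∗ w) dx dt
  - 2 ∑_{i,j} ∬ ∂_i ξ_j ∂_i G_{h/2} ∗ w · ∂_j G_{h/2} ∗ w dx dt`. -/
def innerRHS (T h : ℝ) (w : ℝ → Space → Plane) (ξ : ℝ → Space → Space) : ℝ :=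
  1 / h * spaceTimeIntegral T (fun t x =>
      divergence (ξ t) x * (1 - inner ℝ (w t x) (heatConv h (w t) x))) -
    2 * ∑ i : Fin 3, ∑ j : Fin 3, spaceTimeIntegral T (fun t x =>
      pderiv i (ξ t) x j *
        inner ℝ (pderiv i (heatConv (h / 2) (w t)) x) (pderiv j (heatConv (h / 2) (w t)) x))

/-- `∬ (w_j ∂_t^τ G_h ∗ w_i - w_i ∂_t^τ G_h ∗ w_j) ζ
  + (w_j ∇ G_h ∗ w_i - w_i ∇ G_h ∗ w_j) · ∇ζ dx dt`. -/
def outerForm (T h τ : ℝ) (w : ℝ → Space → Plane) (ζ : ℝ → Space → ℝ) (i j : Fin 2) : ℝ :=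
  let g : Fin 2 → ℝ → Space → ℝ := fun m t => heatConv h fun y => w t y m
  spaceTimeIntegral T fun t x =>
    (w t x j * diffQuot τ (g i) t x - w t x i * diffQuot τ (g j) t x) * ζ t x +
      ∑ k : Fin 3, (w t x j * pderiv k (g i t) x - w t x i * pderiv k (g j t) x) *
        pderiv k (ζ t) x

end

end FilamentThresholding

open FilamentThresholding

namespace FilamentThresholding
noncomputable section

/-! Everything is controlled by the `defect` q(x) = ∫ G_h(z)|u(x-z)-u(x)|² dz. For a unit map it
equals 2(1 - u·G_h∗u), so its integral over the torus is 2h E_h(u). A thresholding step picks, at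
each point, a unit vector maximising its product with G_h∗v, where v is the previous map. Hence the
energy decreases, and its decrease D bounds h⁻¹∫|G_{h/2}∗(u-v)|² (`IsStep.dissipation`). The energy
therefore stays below C|log h| at every step, and any error of the form "positive power of h times
energy", or D times a mildly negative power of h, is harmless after summation in time.

Outer variations. Since u is parallel to G_h∗v, the old map drops out of the antisymmetric product.
Exchanging x and x-z turns the rest into 1/(2h) ∬ G_h(z)(ζ(x)-ζ(x-z)) u∧u(x-z), and the gradient
term cancels exactly the first-order Taylor part of ζ (`abs_outer_core_le`). What remains is at most
a constant times ∫√q. The forward quotient uses the step relation of the next map and leaves one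
further term, of order q/√h, because a step moves u by at most a multiple of √q
(`norm_step_sub_le`).

Inner variations. The function f|G_h∗v| = f u·G_h∗v is periodic and Lipschitz, so its partial
derivatives integrate to zero; this is the Euler–Lagrange equation (`IsStep.transport_eq_zero`),
obtained without differentiating u. It allows u to be replaced by u - v in the functional
`transport`. With u - v, that functional is minus the time-derivative term up to a commutator
controlled by the dissipation (`transport_add_eq_dbl_commKernel`). With u, Taylor expansion gives
the divergence term plus quadratic forms with kernel ∂_i∂_jG_h (`abs_transport_self_sub_le`), and
these become the stress terms by writing ∂_i∂_jG_h = ∂_iG_{h/2}∗∂_jG_{h/2}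
(`abs_dbl_hessKernel_sub_le`).

Put s = h^{1/4}. The fixed-time errors are D/s² plus s times the energy plus one. Multiplied by the
time step s⁴ and summed, D telescopes and the total is O(s(E_h(u⁰)+1)), which tends to zero
(`abs_intervalIntegral_le_of_energy`). The initial interval, where no earlier map exists, is paid
for by its length h. -/

/-! ### The heat kernel: mass and comparison of scales. -/

lemma heatKernel_pos {h : ℝ} (hh : 0 < h) (z : Space) : 0 < heatKernel h z := by
  unfold heatKernel; positivity

lemma heatKernel_neg (h : ℝ) (z : Space) : heatKernel h (-z) = heatKernel h z := by
  simp [heatKernel]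

lemma continuous_heatKernel (h : ℝ) : Continuous (heatKernel h) := by
  unfold heatKernel; fun_prop

lemma integral_exp_neg_sq {b : ℝ} (hb : 0 < b) :
    ∫ z : Space, Real.exp (-b * ‖z‖ ^ 2) = (Real.pi / b) ^ ((3 : ℝ) / 2) := by
  simpa using GaussianFourier.integral_rexp_neg_mul_sq_norm (V := Space) hb

lemma integrable_exp_neg_sq {b : ℝ} (hb : 0 < b) :
    Integrable (fun z : Space => Real.exp (-b * ‖z‖ ^ 2)) := by
  refine Integrable.of_integral_ne_zero ?_
  rw [integral_exp_neg_sq hb]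
  positivity

lemma heatKernel_eq_exp (h : ℝ) (z : Space) :
    heatKernel h z = 1 / (4 * Real.pi * h) ^ ((3 : ℝ) / 2) *
      Real.exp (-(1 / (4 * h)) * ‖z‖ ^ 2) := by
  unfold heatKernel; congr 2; ring

lemma integrable_heatKernel {h : ℝ} (hh : 0 < h) : Integrable (heatKernel h) := by
  simp_rw [funext (heatKernel_eq_exp h)]
  exact (integrable_exp_neg_sq (by positivity)).const_mul _

lemma integral_heatKernel {h : ℝ} (hh : 0 < h) : ∫ z, heatKernel h z = 1 := by
  simp_rw [heatKernel_eq_exp h]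
  rw [integral_const_mul, integral_exp_neg_sq (by positivity)]
  have : Real.pi / (1 / (4 * h)) = 4 * Real.pi * h := by field_simp
  rw [this]
  have : 0 < (4 * Real.pi * h) ^ ((3 : ℝ) / 2) := by positivity
  field_simp

lemma four_rpow_three_halves : (4 : ℝ) ^ ((3 : ℝ) / 2) = 8 := by
  rw [show (4 : ℝ) = 2 ^ (2 : ℝ) by norm_num, ← Real.rpow_mul (by norm_num)]
  norm_num

lemma two_rpow_three_halves_le : (2 : ℝ) ^ ((3 : ℝ) / 2) ≤ 3 := by
  have h := Real.rpow_nonneg (show (0 : ℝ) ≤ 2 by norm_num) ((3 : ℝ) / 2)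
  have h2 : ((2 : ℝ) ^ ((3 : ℝ) / 2)) ^ 2 = 8 := by
    rw [← four_rpow_three_halves, ← Real.rpow_natCast, ← Real.rpow_mul (by norm_num),
      show (4 : ℝ) = 2 ^ (2 : ℝ) by norm_num, ← Real.rpow_mul (by norm_num)]
    norm_num
  nlinarith

lemma heatKernel_prefactor {h : ℝ} (hh : 0 < h) :
    1 / (4 * Real.pi * h) ^ ((3 : ℝ) / 2) ≤ 3 * (1 / (4 * Real.pi * (2 * h)) ^ ((3 : ℝ) / 2)) := by
  have : 4 * Real.pi * (2 * h) = 2 * (4 * Real.pi * h) := by ring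
  rw [this, Real.mul_rpow (x := 2) (y := 4 * Real.pi * h) (by norm_num) (by positivity)]
  have h1 : 0 < (4 * Real.pi * h) ^ ((3 : ℝ) / 2) := by positivity
  have h2 : 0 < (2 : ℝ) ^ ((3 : ℝ) / 2) := by positivity
  have := two_rpow_three_halves_le
  rw [← mul_div_assoc, div_le_div_iff₀ h1 (by positivity)]
  nlinarith

/-- Comparison of the kernel at scale `h` with the kernel at scale `2h`. -/
lemma heatKernel_half_le {h : ℝ} (hh : 0 < h) (z : Space) :
    heatKernel (h / 2) z ≤ 3 * heatKernel h z := by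
  have h1 := heatKernel_prefactor (half_pos hh)
  rw [mul_div_cancel₀ h (two_ne_zero)] at h1
  unfold heatKernel
  rw [← mul_assoc]
  refine mul_le_mul h1 (Real.exp_le_exp.2 ?_) (Real.exp_pos _).le (by positivity)
  have : -‖z‖ ^ 2 / (4 * (h / 2)) = 2 * (-‖z‖ ^ 2 / (4 * h)) := by field_simp
  rw [this]
  have : -‖z‖ ^ 2 / (4 * h) ≤ 0 := div_nonpos_of_nonpos_of_nonneg (by nlinarith [sq_nonneg ‖z‖]) (by positivity)
  linarith

/-! ### Polynomial weights absorbed by the Gaussian. -/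

/-- The dimensionless weight `1 + |z|²/h`. -/
def weight (h : ℝ) (z : Space) : ℝ := 1 + ‖z‖ ^ 2 / h

lemma one_le_weight {h : ℝ} (hh : 0 < h) (z : Space) : 1 ≤ weight h z := by
  unfold weight; have : 0 ≤ ‖z‖ ^ 2 / h := by positivity
  linarith

lemma continuous_weight (h : ℝ) : Continuous (weight h) := by
  unfold weight; fun_prop

lemma norm_sq_le_weight {h : ℝ} (hh : 0 < h) (z : Space) : ‖z‖ ^ 2 ≤ h * weight h z := by
  unfold weight; field_simp; linarith

lemma norm_le_weight {h : ℝ} (hh : 0 < h) (z : Space) : ‖z‖ ≤ √h * weight h z := by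
  have h1 := Real.sq_sqrt hh.le
  have h2 := Real.sqrt_pos.2 hh
  have h3 : √h * weight h z = √h + ‖z‖ ^ 2 / √h := by
    unfold weight; rw [mul_add, mul_one]; congr 1
    rw [eq_div_iff h2.ne']; field_simp; rw [h1]; ring
  rw [h3]
  have : ‖z‖ = √h * (‖z‖ / √h) := by field_simp
  have h4 : √h + ‖z‖ ^ 2 / √h = √h * (1 + (‖z‖ / √h) ^ 2) := by field_simp
  rw [h4, this]
  have h5 : √h * (‖z‖ / √h) / √h = ‖z‖ / √h := by field_simp
  rw [h5]
  gcongr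
  nlinarith [sq_nonneg (‖z‖ / √h - 1)]

/-- The constant in `weight_pow_mul_heatKernel_le`. -/
def weightConst : ℝ := 3 * (40320 * 8 ^ 8 * Real.exp (1 / 8))

lemma weightConst_pos : 0 < weightConst := by unfold weightConst; positivity

/-- Half of the Gaussian exponent is spent on the weight w: exp(w/8) = e^{1/8} exp(|z|²/(8h)) leaves
exactly the exponent of G_{2h}, and 40320 = 8!. Eight powers are what the interpolation w² ≤ l +
w⁸/l³ consumes later. -/
lemma weight_pow_mul_heatKernel_le {h : ℝ} (hh : 0 < h) (z : Space) :
    weight h z ^ 8 * heatKernel h z ≤ weightConst * heatKernel (2 * h) z := by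
  have h0 := one_le_weight hh z
  have h1 : (weight h z / 8) ^ 8 / 40320 ≤ Real.exp (weight h z / 8) := by
    simpa [Nat.factorial] using Real.pow_div_factorial_le_exp (weight h z / 8) (by linarith) 8
  have h2 : weight h z ^ 8 ≤ 40320 * 8 ^ 8 * Real.exp (weight h z / 8) := by
    rw [div_pow, div_div, div_le_iff₀ (by positivity)] at h1
    linarith
  have h3 : Real.exp (weight h z / 8) * Real.exp (-‖z‖ ^ 2 / (4 * h)) =
      Real.exp (1 / 8) * Real.exp (-‖z‖ ^ 2 / (4 * (2 * h))) := by
    rw [← Real.exp_add, ← Real.exp_add]; congr 1; unfold weight; field_simp; ring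
  unfold heatKernel weightConst
  calc weight h z ^ 8 * (1 / (4 * Real.pi * h) ^ ((3 : ℝ) / 2) * Real.exp (-‖z‖ ^ 2 / (4 * h)))
      ≤ (40320 * 8 ^ 8 * Real.exp (weight h z / 8)) *
        ((3 * (1 / (4 * Real.pi * (2 * h)) ^ ((3 : ℝ) / 2))) * Real.exp (-‖z‖ ^ 2 / (4 * h))) := by
        gcongr
        exact heatKernel_prefactor hh
    _ = 3 * (40320 * 8 ^ 8) * (1 / (4 * Real.pi * (2 * h)) ^ ((3 : ℝ) / 2)) *
        (Real.exp (weight h z / 8) * Real.exp (-‖z‖ ^ 2 / (4 * h))) := by ring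
    _ = _ := by rw [h3]; ring

lemma integrable_weight_pow_mul_heatKernel {h : ℝ} (hh : 0 < h) {n : ℕ} (hn : n ≤ 8) :
    Integrable (fun z => weight h z ^ n * heatKernel h z) := by
  refine ((integrable_heatKernel (show 0 < 2 * h by positivity)).const_mul weightConst).mono'
    (((continuous_weight h).pow n).mul (continuous_heatKernel h)).aestronglyMeasurable
    (Eventually.of_forall fun z => ?_)
  have h0 := one_le_weight hh z
  have h1 := heatKernel_pos hh z
  rw [Real.norm_of_nonneg (by positivity)]
  refine le_trans ?_ (weight_pow_mul_heatKernel_le hh z)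
  gcongr

lemma integral_weight_pow_mul_heatKernel_le {h : ℝ} (hh : 0 < h) {n : ℕ} (hn : n ≤ 8) :
    ∫ z, weight h z ^ n * heatKernel h z ≤ weightConst := by
  have h2 : (0 : ℝ) < 2 * h := by positivity
  calc ∫ z, weight h z ^ n * heatKernel h z ≤ ∫ z, weightConst * heatKernel (2 * h) z := by
        refine integral_mono (integrable_weight_pow_mul_heatKernel hh hn)
          ((integrable_heatKernel h2).const_mul _) fun z => ?_
        refine le_trans ?_ (weight_pow_mul_heatKernel_le hh z)
        have h0 := one_le_weight hh z
        have h1 := heatKernel_pos hh z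
        gcongr
    _ = weightConst := by rw [integral_const_mul, integral_heatKernel h2, mul_one]

/-- A kernel dominated by a Gaussian with a weight is integrable. -/
lemma integrable_of_le_weight {F : Type*} [NormedAddCommGroup F] {h c : ℝ} (hh : 0 < h) {k : Space → F}
    (hk : AEStronglyMeasurable k volume) {n : ℕ} (hn : n ≤ 8)
    (hkc : ∀ z, ‖k z‖ ≤ c * (weight h z ^ n * heatKernel h z)) : Integrable k :=
  ((integrable_weight_pow_mul_heatKernel hh hn).const_mul c).mono' hk (Eventually.of_forall hkc)

/-! ### First and second derivatives of the kernel, moments, semigroup identities. -/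

/-- The partial derivative of the heat kernel. -/
def gradKernel (h : ℝ) (k : Fin 3) (z : Space) : ℝ := -(z k / (2 * h)) * heatKernel h z

/-- The second partial derivatives of the heat kernel. -/
def hessKernel (h : ℝ) (i j : Fin 3) (z : Space) : ℝ :=
  (z i * z j / (4 * h ^ 2) - if i = j then 1 / (2 * h) else 0) * heatKernel h z

lemma continuous_gradKernel (h : ℝ) (k : Fin 3) : Continuous (gradKernel h k) := by
  have := continuous_heatKernel h
  unfold gradKernel; fun_prop

lemma gradKernel_neg (h : ℝ) (k : Fin 3) (z : Space) : gradKernel h k (-z) = -gradKernel h k z := by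
  simp [gradKernel, heatKernel_neg, neg_div]

lemma hasFDerivAt_heatKernel {h : ℝ} (z : Space) :
    HasFDerivAt (heatKernel h) ((-(1 / (2 * h)) * heatKernel h z) • innerSL ℝ z) z := by
  have h1 : HasFDerivAt (fun z : Space => ‖z‖ ^ 2) (2 • innerSL ℝ z) z :=
    (hasStrictFDerivAt_norm_sq z).hasFDerivAt
  have h2 := ((h1.const_mul (-(1 / (4 * h)))).exp).const_mul (1 / (4 * Real.pi * h) ^ ((3 : ℝ) / 2))
  rw [funext (heatKernel_eq_exp h)]
  refine h2.congr_fderiv ?_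
  ext y
  simp
  ring

lemma norm_coord_le (z : Space) (k : Fin 3) : |z k| ≤ ‖z‖ := by
  simpa using PiLp.norm_apply_le z k

lemma abs_gradKernel_le {h : ℝ} (hh : 0 < h) (k : Fin 3) (z : Space) :
    |gradKernel h k z| ≤ 1 / √h * (weight h z * heatKernel h z) := by
  have h1 := heatKernel_pos hh z
  have h2 := norm_coord_le z k
  have h3 := norm_le_weight hh z
  have h4 := Real.sqrt_pos.2 hh
  have h5 := one_le_weight hh z
  unfold gradKernel
  rw [abs_mul, abs_neg, abs_div, abs_of_pos h1, abs_of_pos (show 0 < 2 * h by positivity), ← mul_assoc]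
  gcongr
  rw [div_mul_eq_mul_div, one_mul, div_le_div_iff₀ (by positivity) h4]
  have h6 := Real.mul_self_sqrt hh.le
  calc |z k| * √h ≤ (√h * weight h z) * √h := by gcongr; linarith
    _ = h * weight h z := by rw [mul_right_comm, h6]
    _ ≤ weight h z * (2 * h) := by nlinarith

lemma integrable_gradKernel {h : ℝ} (hh : 0 < h) (k : Fin 3) : Integrable (gradKernel h k) :=
  integrable_of_le_weight hh (continuous_gradKernel h k).aestronglyMeasurable (n := 1) (by norm_num)
    (fun z => by simpa using abs_gradKernel_le hh k z)

lemma integral_gradKernel (h : ℝ) (k : Fin 3) : ∫ z, gradKernel h k z = 0 := by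
  have h1 : ∫ z, gradKernel h k z = ∫ z, gradKernel h k (-z) := (integral_neg_eq_self _ _).symm
  simp_rw [gradKernel_neg, integral_neg] at h1
  linarith

lemma integrable_coord_mul_coord_heatKernel {h : ℝ} (hh : 0 < h) (i j : Fin 3) :
    Integrable (fun z : Space => z i * z j * heatKernel h z) := by
  have := continuous_heatKernel h
  refine integrable_of_le_weight hh (c := h) (n := 1)
    (by fun_prop) (by norm_num) fun z => ?_
  have h1 := heatKernel_pos hh z
  rw [pow_one, Real.norm_eq_abs, abs_mul, abs_mul, abs_of_pos h1, ← mul_assoc]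
  refine mul_le_mul_of_nonneg_right ?_ h1.le
  refine le_trans ?_ (norm_sq_le_weight hh z)
  rw [pow_two]
  exact mul_le_mul (norm_coord_le _ _) (norm_coord_le _ _) (abs_nonneg _) (norm_nonneg _)

/-- As ∂_j G_h = -z_j G_h/(2h), one integration by parts of z_i against ∂_j G_h reduces second
moments to the total mass. -/
lemma integral_coord_mul_coord_heatKernel {h : ℝ} (hh : 0 < h) (i j : Fin 3) :
    ∫ z : Space, z i * z j * heatKernel h z = if i = j then 2 * h else 0 := by
  have h1 : ∀ z : Space, fderiv ℝ (heatKernel h) z (EuclideanSpace.single j 1) =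
      -(1 / (2 * h)) * (z j * heatKernel h z) := fun z => by
    rw [(hasFDerivAt_heatKernel z).fderiv]
    simp [EuclideanSpace.inner_single_right]; ring
  have h2 : ∀ z : Space, fderiv ℝ (fun z : Space => z i) z (EuclideanSpace.single j 1) =
      if i = j then 1 else 0 := fun z => by
    have : HasFDerivAt (fun z : Space => z i) (EuclideanSpace.proj i : Space →L[ℝ] ℝ) z :=
      (EuclideanSpace.proj i : Space →L[ℝ] ℝ).hasFDerivAt
    rw [this.fderiv]
    simp
  have hi := integrable_coord_mul_coord_heatKernel hh i j
  have hg := integrable_heatKernel hh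
  have h3 := integral_mul_fderiv_eq_neg_fderiv_mul_of_integrable (𝕜 := ℝ) (μ := (volume : Measure Space))
    (f := fun z : Space => z i) (g := heatKernel h) (v := EuclideanSpace.single j 1) ?_ ?_ ?_ ?_ ?_
  · simp_rw [h1, h2] at h3
    have h4 : ∀ z : Space, z i * (-(1 / (2 * h)) * (z j * heatKernel h z)) =
      -(1 / (2 * h)) * (z i * z j * heatKernel h z) := fun z => by ring
    simp_rw [h4, integral_const_mul, integral_heatKernel hh] at h3
    split_ifs at h3 ⊢ with hij
    · field_simp at h3; linarith
    · field_simp at h3; linarith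
  · simp_rw [h2]; exact hg.const_mul _
  · simp_rw [h1]; refine (hi.const_mul (-(1 / (2 * h)))).congr (Eventually.of_forall fun z => ?_)
    simp; ring
  · have := (integrable_gradKernel hh i).const_mul (-(2 * h))
    refine this.congr (Eventually.of_forall fun z => ?_)
    simp [gradKernel]; field_simp
  · exact fun z _ => (EuclideanSpace.proj i : Space →L[ℝ] ℝ).differentiableAt
  · exact fun z _ => (hasFDerivAt_heatKernel z).differentiableAt

lemma integrable_hessKernel {h : ℝ} (hh : 0 < h) (i j : Fin 3) : Integrable (hessKernel h i j) := by
  have h1 := ((integrable_coord_mul_coord_heatKernel hh i j).const_mul (1 / (4 * h ^ 2))).sub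
    ((integrable_heatKernel hh).const_mul (if i = j then 1 / (2 * h) else 0))
  refine h1.congr (Eventually.of_forall fun z => ?_)
  simp only [hessKernel, Pi.sub_apply]; ring

/-- The second moment 2h matches the diagonal correction exactly. Mean zero removes the constant
part of u(x)·u(x-z), so that only increments of u enter. -/
lemma integral_hessKernel {h : ℝ} (hh : 0 < h) (i j : Fin 3) : ∫ z, hessKernel h i j z = 0 := by
  have h1 : ∀ z, hessKernel h i j z = (1 / (4 * h ^ 2)) * (z i * z j * heatKernel h z) -
      (if i = j then 1 / (2 * h) else 0) * heatKernel h z := fun z => by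
    simp only [hessKernel]; ring
  simp_rw [h1]
  rw [integral_sub ((integrable_coord_mul_coord_heatKernel hh i j).const_mul _)
    ((integrable_heatKernel hh).const_mul _), integral_const_mul, integral_const_mul,
    integral_heatKernel hh, integral_coord_mul_coord_heatKernel hh]
  split_ifs
  · field_simp; norm_num
  · simp

lemma prefactor_scale {h : ℝ} (hh : 0 < h) {c : ℝ} (hc : 0 < c) :
    (4 * Real.pi * (c * h)) ^ ((3 : ℝ) / 2) = c ^ ((3 : ℝ) / 2) * (4 * Real.pi * h) ^ ((3 : ℝ) / 2) := by
  rw [← Real.mul_rpow hc.le (by positivity)]; congr 1; ring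

/-- Completing the square in a product of two heat kernels. -/
lemma heatKernel_mul_heatKernel {h : ℝ} (hh : 0 < h) (x y : Space) :
    heatKernel (h / 2) (y + (1 / 2 : ℝ) • x) * heatKernel (h / 2) (x - (y + (1 / 2 : ℝ) • x)) =
      heatKernel h x * heatKernel (h / 4) y := by
  have h1 : ‖y + (1 / 2 : ℝ) • x‖ ^ 2 + ‖x - (y + (1 / 2 : ℝ) • x)‖ ^ 2 =
      ‖x‖ ^ 2 / 2 + 2 * ‖y‖ ^ 2 := by
    have : x - (y + (1 / 2 : ℝ) • x) = (1 / 2 : ℝ) • x - y := by module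
    rw [this, norm_add_sq_real, norm_sub_sq_real, norm_smul, real_inner_comm]
    norm_num; ring
  have h2 : 4 * Real.pi * (h / 2) = 4 * Real.pi * (1 / 2 * h) := by ring
  have h3 : 4 * Real.pi * (h / 4) = 4 * Real.pi * (1 / 4 * h) := by ring
  have h4 : ((1 / 2 : ℝ)) ^ ((3 : ℝ) / 2) * (1 / 2 : ℝ) ^ ((3 : ℝ) / 2) = (1 / 4) ^ ((3 : ℝ) / 2) := by
    rw [← Real.mul_rpow (by norm_num) (by norm_num)]; norm_num
  unfold heatKernel
  rw [h2, h3, prefactor_scale hh (by norm_num), prefactor_scale hh (by norm_num), ← h4]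
  have h5 : ∀ a b c d : ℝ, a * b * (c * d) = a * c * (b * d) := fun _ _ _ _ => by ring
  rw [h5, h5 _ _ _ (Real.exp (-‖y‖ ^ 2 / (4 * (h / 4)))), ← Real.exp_add, ← Real.exp_add]
  congr 1
  · field_simp
  · congr 1
    have : -‖y + (1 / 2 : ℝ) • x‖ ^ 2 / (4 * (h / 2)) + -‖x - (y + (1 / 2 : ℝ) • x)‖ ^ 2 / (4 * (h / 2)) =
      -(‖y + (1 / 2 : ℝ) • x‖ ^ 2 + ‖x - (y + (1 / 2 : ℝ) • x)‖ ^ 2) / (2 * h) := by field_simp; ring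
    rw [this, h1]; field_simp; ring

/-- The semigroup property `G_{h/2} ∗ G_{h/2} = G_h`. -/
lemma integral_heatKernel_mul_heatKernel {h : ℝ} (hh : 0 < h) (x : Space) :
    ∫ y, heatKernel (h / 2) y * heatKernel (h / 2) (x - y) = heatKernel h x := by
  rw [← integral_add_right_eq_self _ ((1 / 2 : ℝ) • x)]
  simp_rw [heatKernel_mul_heatKernel hh x]
  rw [integral_const_mul, integral_heatKernel (by positivity), mul_one]

/-- Centred at x/2, the two Gaussians factor as G_h(x) G_{h/4}(y). The polynomial prefactor becomes
x_i x_j/4 - y_i y_j plus terms odd in y, so only the mass and the second moments of G_{h/4} survive.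
-/
lemma integral_gradKernel_mul_gradKernel {h : ℝ} (hh : 0 < h) (i j : Fin 3) (x : Space) :
    ∫ y, gradKernel (h / 2) i y * gradKernel (h / 2) j (x - y) = hessKernel h i j x := by
  rw [← integral_add_right_eq_self _ ((1 / 2 : ℝ) • x)]
  have h4 : 0 < h / 4 := by positivity
  have h1 : ∀ y : Space, gradKernel (h / 2) i (y + (1 / 2 : ℝ) • x) *
      gradKernel (h / 2) j (x - (y + (1 / 2 : ℝ) • x)) =
      1 / h ^ 2 * heatKernel h x * (x i * x j / 4 * heatKernel (h / 4) y
        + (x j / 2 * (-(2 * (h / 4)) * gradKernel (h / 4) i y)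
          - x i / 2 * (-(2 * (h / 4)) * gradKernel (h / 4) j y))
        - y i * y j * heatKernel (h / 4) y) := fun y => by
    have := heatKernel_mul_heatKernel hh x y
    unfold gradKernel
    have e : ∀ a b c d : ℝ, a * b * (c * d) = a * c * (b * d) := fun _ _ _ _ => by ring
    rw [e, this]
    simp
    field_simp
    ring
  simp_rw [h1]
  have i1 := (integrable_heatKernel h4).const_mul (x i * x j / 4)
  have i2 := ((integrable_gradKernel h4 i).const_mul (-(2 * (h / 4)))).const_mul (x j / 2)
  have i3 := ((integrable_gradKernel h4 j).const_mul (-(2 * (h / 4)))).const_mul (x i / 2)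
  have i23 : Integrable fun y : Space => x j / 2 * (-(2 * (h / 4)) * gradKernel (h / 4) i y) -
      x i / 2 * (-(2 * (h / 4)) * gradKernel (h / 4) j y) := i2.sub i3
  have i123 : Integrable fun y : Space => x i * x j / 4 * heatKernel (h / 4) y +
      (x j / 2 * (-(2 * (h / 4)) * gradKernel (h / 4) i y) -
      x i / 2 * (-(2 * (h / 4)) * gradKernel (h / 4) j y)) := i1.add i23
  rw [integral_const_mul, integral_sub i123
    (integrable_coord_mul_coord_heatKernel h4 i j), integral_add i1 i23, integral_sub i2 i3]
  simp_rw [integral_const_mul, integral_heatKernel h4, integral_gradKernel,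
    integral_coord_mul_coord_heatKernel h4]
  unfold hessKernel
  split_ifs <;> field_simp <;> ring

/-! ### The torus: fundamental cell, translation invariance, vanishing integrals of derivatives. -/

/-- The standard basis of `Space`. -/
abbrev stdBasis : Module.Basis (Fin 3) ℝ Space := (EuclideanSpace.basisFun (Fin 3) ℝ).toBasis

lemma cell_eq_fundamentalDomain : cell = ZSpan.fundamentalDomain stdBasis := by
  ext x
  simp [cell, ZSpan.mem_fundamentalDomain]

lemma volume_cell : volume cell = 1 := by
  rw [cell_eq_fundamentalDomain, measure_congr (ZSpan.fundamentalDomain_ae_parallelepiped stdBasis volume)]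
  simpa using (EuclideanSpace.basisFun (Fin 3) ℝ).volume_parallelepiped

instance : IsProbabilityMeasure ((volume : Measure Space).restrict cell) :=
  ⟨by simp [volume_cell]⟩

namespace PeriodicZ3

variable {F : Type*} {f : Space → F}

lemma add_of_mem_span (hf : PeriodicZ3 f) {v : Space}
    (hv : v ∈ Submodule.span ℤ (Set.range stdBasis)) (x : Space) : f (x + v) = f x := by
  induction hv using Submodule.span_induction generalizing x with
  | mem v hv =>
    obtain ⟨k, rfl⟩ := hv
    simpa using hf k x
  | zero => simp
  | add v w _ _ hv hw => rw [← add_assoc, hw, hv]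
  | smul n v _ hv =>
    have hneg : ∀ x, f (x - v) = f x := fun x => by rw [← hv (x - v), sub_add_cancel]
    induction n using Int.induction_on generalizing x with
    | zero => simp
    | succ n ih => rw [add_smul, one_smul, ← add_assoc, hv, ih]
    | pred n ih => rw [sub_smul, one_smul, ← add_sub_assoc, hneg, ih]

/-- The value of a periodic function is attained in the bounded cell. -/
lemma exists_norm_le (hf : PeriodicZ3 f) (x : Space) :
    ∃ y ∈ Metric.closedBall (0 : Space) 3, f x = f y := by
  refine ⟨ZSpan.fract stdBasis x, ?_, ?_⟩
  · have h := ZSpan.norm_fract_le stdBasis x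
    simpa using h
  · have : x = ZSpan.fract stdBasis x + (ZSpan.floor stdBasis x : Space) := by
      rw [ZSpan.fract_apply, sub_add_cancel]
    conv_lhs => rw [this]
    exact hf.add_of_mem_span (ZSpan.floor stdBasis x).2 _

open scoped Pointwise in
/-- Translation invariance of the integral over the torus. -/
lemma setIntegral_add_right [NormedAddCommGroup F] [NormedSpace ℝ F]
    (hf : PeriodicZ3 f) (v : Space) : ∫ x in cell, f (x + v) = ∫ x in cell, f x := by
  have h0 : IsAddFundamentalDomain (Submodule.span ℤ (Set.range stdBasis)) cell
      (volume : Measure Space) := by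
    rw [cell_eq_fundamentalDomain]; exact ZSpan.isAddFundamentalDomain _ _
  have : VAddInvariantMeasure (Submodule.span ℤ (Set.range stdBasis)) Space volume :=
    inferInstanceAs (VAddInvariantMeasure
      (Submodule.span ℤ (Set.range stdBasis)).toAddSubgroup Space volume)
  have hc : VAddCommClass Space (Submodule.span ℤ (Set.range stdBasis)) Space :=
    ⟨fun a b c => by
      change a + ((b : Space) + c) = (b : Space) + (a + c)
      abel⟩
  have h1 : IsAddFundamentalDomain (Submodule.span ℤ (Set.range stdBasis)) (v +ᵥ cell)
      (volume : Measure Space) := h0.vadd_of_comm v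
  have h2 : ∫ x in cell, f x = ∫ x in v +ᵥ cell, f x :=
    h0.setIntegral_eq h1 fun g x => by
      change f ((g : Space) + x) = f x
      rw [add_comm]; exact hf.add_of_mem_span g.2 x
  rw [h2]
  have h3 : MeasurePreserving (fun x : Space => x + v) volume volume :=
    measurePreserving_add_right volume v
  have h4 : MeasurableEmbedding (fun x : Space => x + v) := measurableEmbedding_addRight v
  have h5 : v +ᵥ cell = (fun x : Space => x + v) '' cell := by
    ext x; simp only [Set.mem_vadd_set, Set.mem_image, vadd_eq_add, add_comm]
  rw [h5, h3.setIntegral_image_emb h4]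

lemma comp_sub (hf : PeriodicZ3 f) (z : Space) : PeriodicZ3 fun x => f (x - z) := fun k x => by
  dsimp only; rw [add_sub_right_comm]; exact hf k _

lemma comp {H : Type*} (hf : PeriodicZ3 f) (φ : F → H) : PeriodicZ3 fun x => φ (f x) := fun k x => by
  dsimp only; rw [hf k x]

lemma comp₂ {H E : Type*} {g : Space → H} (hf : PeriodicZ3 f) (hg : PeriodicZ3 g) (φ : F → H → E) :
    PeriodicZ3 fun x => φ (f x) (g x) := fun k x => by dsimp only; rw [hf k x, hg k x]

/-- The integral of a partial derivative over the torus vanishes. -/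
lemma integral_lineDeriv_eq_zero {f : Space → ℝ} (hf : PeriodicZ3 f) {C : NNReal}
    (hl : LipschitzWith C f) {f' : Space → ℝ} {v : Space}
    (hd : ∀ᵐ x : Space, HasLineDerivAt ℝ f (f' x) x v) : ∫ x in cell, f' x = 0 := by
  have hm : AEStronglyMeasurable f' (volume.restrict cell) := by
    refine ((measurable_lineDeriv (𝕜 := ℝ) (v := v) hl.continuous).aestronglyMeasurable.congr ?_).restrict
    filter_upwards [hd] with x hx using hx.lineDeriv
  have hi : Integrable f (volume.restrict cell) := by
    have hb : ∃ M, ∀ x, ‖f x‖ ≤ M := by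
      obtain ⟨M, hM⟩ := (isCompact_closedBall (0 : Space) 3).exists_bound_of_continuousOn
        hl.continuous.continuousOn
      refine ⟨M, fun x => ?_⟩
      obtain ⟨y, hy, h⟩ := hf.exists_norm_le x
      rw [h]; exact hM y hy
    obtain ⟨M, hM⟩ := hb
    exact Integrable.of_bound hl.continuous.aestronglyMeasurable M (Eventually.of_forall hM)
  -- The map t ↦ ∫ f(x + tv) is constant by translation invariance. Differentiation under the
  -- integral has the Lipschitz constant as majorant and needs the derivative only almost
  -- everywhere.
  have key := hasDerivAt_integral_of_dominated_loc_of_lip (𝕜 := ℝ) (μ := volume.restrict cell)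
    (F := fun (t : ℝ) x => f (x + t • v)) (x₀ := 0) (F' := f') (s := Set.univ)
    (bound := fun _ => C * ‖v‖) Filter.univ_mem
    (Eventually.of_forall fun t => (hl.continuous.comp (by fun_prop)).aestronglyMeasurable)
    (by simpa using hi) hm
    (Eventually.of_forall fun x => by
      rw [lipschitzOnWith_univ]
      refine LipschitzWith.of_dist_le_mul fun s t => ?_
      refine (hl.dist_le_mul _ _).trans ?_
      rw [Real.coe_nnabs, abs_of_nonneg (by positivity), dist_add_left, dist_eq_norm, ← sub_smul, norm_smul,
        Real.dist_eq, Real.norm_eq_abs]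
      apply le_of_eq; ring)
    (integrable_const _)
    (by
      refine ae_restrict_of_ae ?_
      filter_upwards [hd] with x hx using hx)
  have h2 := key.2
  simp_rw [hf.setIntegral_add_right] at h2
  exact h2.unique (hasDerivAt_const _ _)

end PeriodicZ3

/-! ### Double integrals over base point and displacement. -/

/-- Integrands `F x z` on `𝕋³ × ℝ³` that are dominated by an integrable function of `z`. -/
structure IsDominated (F : Space → Space → ℝ) : Prop where
  meas : AEStronglyMeasurable (fun p : Space × Space => F p.1 p.2) (volume.prod volume)
  per : ∀ z, PeriodicZ3 fun x => F x z
  dom : ∃ κ : Space → ℝ, Integrable κ ∧ ∀ x z, |F x z| ≤ κ z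

namespace IsDominated

variable {F H : Space → Space → ℝ}

lemma integrable_prod (hF : IsDominated F) :
    Integrable (Function.uncurry F) ((volume.restrict cell).prod volume) := by
  obtain ⟨κ, hκ, h⟩ := hF.dom
  have h1 : Integrable (fun p : Space × Space => κ p.2) ((volume.restrict cell).prod volume) :=
    hκ.comp_snd _
  refine h1.mono' ?_ (Eventually.of_forall fun p => h p.1 p.2)
  exact hF.meas.mono_ac (Measure.absolutelyContinuous_of_le Measure.restrict_le_self |>.prod
    Measure.AbsolutelyContinuous.rfl)

lemma comp_swap (hF : IsDominated F) : IsDominated fun x z => F (x - z) (-z) where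
  meas := by
    have h1 : MeasurePreserving (fun p : Space × Space => (p.1 - p.2, p.2))
      (volume.prod volume) (volume.prod volume) := measurePreserving_sub_prod volume volume
    have h2 : MeasurePreserving (fun p : Space × Space => (p.1, -p.2))
      (volume.prod volume) (volume.prod volume) :=
      (MeasurePreserving.id _).prod (Measure.measurePreserving_neg volume)
    exact (hF.meas.comp_measurePreserving h2).comp_measurePreserving h1
  per z := (hF.per (-z)).comp_sub z
  dom := by
    obtain ⟨κ, hκ, h⟩ := hF.dom
    exact ⟨fun z => κ (-z), hκ.comp_neg, fun x z => h _ _⟩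

/-- Exchange of the two variables `x` and `y = x - z` in a double integral. -/
lemma integral_swap (hF : IsDominated F) :
    ∫ x in cell, ∫ z, F x z = ∫ x in cell, ∫ z, F (x - z) (-z) := by
  rw [integral_integral_swap hF.integrable_prod, integral_integral_swap hF.comp_swap.integrable_prod]
  -- After Fubini the translation by z is invisible on the torus; only the reflection of z is left.
  have h1 : ∀ z, ∫ x in cell, F (x - z) (-z) = ∫ x in cell, F x (-z) := fun z => by
    simpa [sub_eq_add_neg] using (hF.per (-z)).setIntegral_add_right (-z)
  simp_rw [h1]
  exact (integral_neg_eq_self (fun z => ∫ x in cell, F x z) volume).symm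

lemma add (hF : IsDominated F) (hH : IsDominated H) : IsDominated fun x z => F x z + H x z where
  meas := hF.meas.add hH.meas
  per z := (hF.per z).comp₂ (hH.per z) (· + ·)
  dom := by
    obtain ⟨κ, hκ, h⟩ := hF.dom
    obtain ⟨κ', hκ', h'⟩ := hH.dom
    exact ⟨fun z => κ z + κ' z, hκ.add hκ', fun x z =>
      (abs_add_le _ _).trans (add_le_add (h x z) (h' x z))⟩

end IsDominated

/-! ### Convolutions with bounded periodic functions and their derivatives. -/

set_option linter.unusedSectionVars false

variable {F : Type*} [NormedAddCommGroup F] [NormedSpace ℝ F]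

/-- Convolution of a scalar kernel with a function. -/
def kconv (K : Space → ℝ) (f : Space → F) (x : Space) : F := ∫ z, K z • f (x - z)

lemma heatConv_eq_kconv (h : ℝ) (f : Space → F) : heatConv h f = kconv (heatKernel h) f := rfl

lemma kconv_eq_integral_sub (K : Space → ℝ) (f : Space → F) (x : Space) :
    kconv K f x = ∫ y, K (x - y) • f y := by
  unfold kconv
  rw [← integral_sub_left_eq_self _ _ x]
  simp

/-- Bounded measurable functions on the torus. -/
structure PerBdd (f : Space → F) : Prop where
  per : PeriodicZ3 f
  meas : AEStronglyMeasurable f volume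
  bdd : ∃ M, ∀ x, ‖f x‖ ≤ M

lemma aestronglyMeasurable_comp_sub_left {f : Space → F} (hf : AEStronglyMeasurable f volume)
    (x : Space) : AEStronglyMeasurable (fun z => f (x - z)) volume :=
  hf.comp_quasiMeasurePreserving (quasiMeasurePreserving_sub_left_of_right_invariant volume x)

lemma aestronglyMeasurable_uncurry_sub {f : Space → F} (hf : AEStronglyMeasurable f volume) :
    AEStronglyMeasurable (fun p : Space × Space => f (p.1 - p.2)) (volume.prod volume) :=
  hf.comp_quasiMeasurePreserving (quasiMeasurePreserving_sub_of_right_invariant volume volume)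

namespace PerBdd

variable {f g : Space → F}

lemma integrable_cell (hf : PerBdd f) : Integrable f (volume.restrict cell) := by
  obtain ⟨M, hM⟩ := hf.bdd
  exact Integrable.of_bound hf.meas.restrict M (Eventually.of_forall hM)

lemma integrable_kconv (hf : PerBdd f) {K : Space → ℝ} (hK : Integrable K) (x : Space) :
    Integrable fun z => K z • f (x - z) := by
  obtain ⟨M, hM⟩ := hf.bdd
  exact hK.smul_bdd M (aestronglyMeasurable_comp_sub_left hf.meas x)
    (Eventually.of_forall fun z => hM _)

lemma norm_kconv_le {M : ℝ} (hM : ∀ x, ‖f x‖ ≤ M) {K : Space → ℝ}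
    (hK : Integrable K) (x : Space) : ‖kconv K f x‖ ≤ (∫ z, |K z|) * M := by
  rw [← integral_mul_const]
  refine norm_integral_le_of_norm_le (hK.abs.mul_const M) (Eventually.of_forall fun z => ?_)
  rw [norm_smul, Real.norm_eq_abs]
  gcongr
  exact hM _

lemma kconv (hf : PerBdd f) {K : Space → ℝ} (hK : Integrable K) : PerBdd (kconv K f) where
  per k x := by
    simp only [FilamentThresholding.kconv]
    congr 1; ext z; rw [add_sub_right_comm, hf.per]
  meas := by
    have h : AEStronglyMeasurable (fun p : Space × Space => K p.2 • f (p.1 - p.2))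
        (volume.prod volume) := hK.1.comp_snd.smul (aestronglyMeasurable_uncurry_sub hf.meas)
    exact h.integral_prod_right'
  bdd := by
    obtain ⟨M, hM⟩ := hf.bdd
    exact ⟨_, fun x => norm_kconv_le hM hK x⟩

lemma heatConv (hf : PerBdd f) {h : ℝ} (hh : 0 < h) : PerBdd (heatConv h f) :=
  hf.kconv (integrable_heatKernel hh)

lemma sub (hf : PerBdd f) (hg : PerBdd g) : PerBdd (fun x => f x - g x) where
  per := hf.per.comp₂ hg.per (· - ·)
  meas := hf.meas.sub hg.meas
  bdd := by
    obtain ⟨M, hM⟩ := hf.bdd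
    obtain ⟨N, hN⟩ := hg.bdd
    exact ⟨M + N, fun x => (norm_sub_le _ _).trans (add_le_add (hM x) (hN x))⟩

lemma smul {a : Space → ℝ} (ha : PerBdd a) (hf : PerBdd f) : PerBdd (fun x => a x • f x) where
  per := ha.per.comp₂ hf.per (· • ·)
  meas := ha.meas.smul hf.meas
  bdd := by
    obtain ⟨M, hM⟩ := ha.bdd
    obtain ⟨N, hN⟩ := hf.bdd
    refine ⟨M * N, fun x => ?_⟩
    rw [norm_smul]
    exact mul_le_mul (hM x) (hN x) (norm_nonneg _) ((norm_nonneg _).trans (hM x))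

lemma mul {a b : Space → ℝ} (ha : PerBdd a) (hb : PerBdd b) : PerBdd (fun x => a x * b x) :=
  ha.smul hb

lemma inner {f g : Space → Plane} (hf : PerBdd f) (hg : PerBdd g) :
    PerBdd (fun x => inner ℝ (f x) (g x)) where
  per := hf.per.comp₂ hg.per (fun a b => Inner.inner ℝ a b)
  meas := hf.meas.inner hg.meas
  bdd := by
    obtain ⟨M, hM⟩ := hf.bdd
    obtain ⟨N, hN⟩ := hg.bdd
    refine ⟨M * N, fun x => (norm_inner_le_norm _ _).trans ?_⟩
    exact mul_le_mul (hM x) (hN x) (norm_nonneg _) ((norm_nonneg _).trans (hM x))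

lemma const (c : F) : PerBdd (fun _ : Space => c) :=
  ⟨fun _ _ => rfl, aestronglyMeasurable_const, ‖c‖, fun _ => le_rfl⟩

lemma clm_comp {E : Type*} [NormedAddCommGroup E] [NormedSpace ℝ E] (hf : PerBdd f) (L : F →L[ℝ] E) :
    PerBdd (fun x => L (f x)) where
  per := hf.per.comp L
  meas := L.continuous.comp_aestronglyMeasurable hf.meas
  bdd := by
    obtain ⟨M, hM⟩ := hf.bdd
    exact ⟨‖L‖ * M, fun x => (L.le_opNorm _).trans (by gcongr; exact hM x)⟩

lemma coord {n : ℕ} {f : Space → EuclideanSpace ℝ (Fin n)} (hf : PerBdd f) (i : Fin n) :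
    PerBdd (fun x => f x i) := hf.clm_comp (EuclideanSpace.proj i)

end PerBdd

lemma kconv_clm_comp {E : Type*} [NormedAddCommGroup E] [NormedSpace ℝ E] [CompleteSpace F]
    [CompleteSpace E] {f : Space → F}
    (hf : PerBdd f) {K : Space → ℝ} (hK : Integrable K) (L : F →L[ℝ] E) (x : Space) :
    kconv K (fun y => L (f y)) x = L (kconv K f x) := by
  unfold kconv
  rw [← L.integral_comp_comm (hf.integrable_kconv hK x)]
  simp

lemma kconv_sub {f g : Space → F} (hf : PerBdd f) (hg : PerBdd g) {K : Space → ℝ}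
    (hK : Integrable K) (x : Space) :
    kconv K (fun y => f y - g y) x = kconv K f x - kconv K g x := by
  unfold kconv
  rw [← integral_sub (hf.integrable_kconv hK x) (hg.integrable_kconv hK x)]
  simp [smul_sub]

lemma kconv_const_smul (c : ℝ) (f : Space → F) (K : Space → ℝ) (x : Space) :
    kconv K (fun y => c • f y) x = c • kconv K f x := by
  unfold kconv
  rw [← integral_smul]
  simp_rw [smul_comm c]

/-- Convolving twice is convolving with the convolution of the kernels. -/
lemma kconv_kconv [CompleteSpace F] {f : Space → F} (hf : PerBdd f) {K L : Space → ℝ} (hK : Integrable K)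
    (hL : Integrable L) (x : Space) :
    kconv K (kconv L f) x = kconv (fun z => ∫ y, K y * L (z - y)) f x := by
  obtain ⟨M, hM⟩ := hf.bdd
  have h1 : Integrable (fun p : Space × Space => (K p.2 * L (p.1 - p.2)) • f (x - p.1))
      (volume.prod volume) := by
    have := hK.convolution_integrand (ContinuousLinearMap.mul ℝ ℝ) hL
    refine this.smul_bdd M ?_ (Eventually.of_forall fun z => hM _)
    exact (aestronglyMeasurable_comp_sub_left hf.meas x).comp_fst
  have h2 := integral_integral_swap (f := fun z y => (K y * L (z - y)) • f (x - z)) h1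
  unfold kconv
  simp_rw [integral_smul_const] at h2
  rw [h2]
  congr 1; ext y
  rw [← integral_smul, ← integral_sub_right_eq_self _ y]
  congr 1; ext z
  rw [sub_sub_sub_cancel_right, smul_smul]

lemma heatConv_heatConv_half [CompleteSpace F] {f : Space → F} (hf : PerBdd f) {h : ℝ} (hh : 0 < h)
    (x : Space) : heatConv (h / 2) (heatConv (h / 2) f) x = heatConv h f x := by
  simp_rw [heatConv_eq_kconv]
  have h2 := integrable_heatKernel (half_pos hh)
  rw [kconv_kconv hf h2 h2]
  simp_rw [integral_heatKernel_mul_heatKernel hh]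

lemma kconv_gradKernel_gradKernel [CompleteSpace F] {f : Space → F} (hf : PerBdd f) {h : ℝ} (hh : 0 < h)
    (i j : Fin 3) (x : Space) :
    kconv (gradKernel (h / 2) i) (kconv (gradKernel (h / 2) j) f) x = kconv (hessKernel h i j) f x := by
  have h2 := half_pos hh
  rw [kconv_kconv hf (integrable_gradKernel h2 i) (integrable_gradKernel h2 j)]
  simp_rw [integral_gradKernel_mul_gradKernel hh]

/-- Supplies a majorant uniform over a unit ball of base points for differentiating the convolution
under the integral. Doubling the time pays for |y|² ≤ 2|x|² + 2. -/
lemma heatKernel_le_of_near {h : ℝ} (hh : 0 < h) {x y : Space} (hxy : ‖x - y‖ ≤ 1) :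
    heatKernel h x ≤ 3 * Real.exp (1 / (4 * h)) * heatKernel (2 * h) y := by
  have h1 : ‖y‖ ^ 2 ≤ 2 * ‖x‖ ^ 2 + 2 := by
    have : ‖y‖ ≤ ‖x‖ + ‖x - y‖ := by
      have := norm_sub_le x (x - y); rwa [sub_sub_cancel] at this
    nlinarith [norm_nonneg x, norm_nonneg y, norm_nonneg (x - y), sq_nonneg (‖x‖ - 1)]
  have h2 : Real.exp (-‖x‖ ^ 2 / (4 * h)) ≤ Real.exp (1 / (4 * h)) * Real.exp (-‖y‖ ^ 2 / (4 * (2 * h))) := by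
    rw [← Real.exp_add, Real.exp_le_exp]
    rw [show 1 / (4 * h) + -‖y‖ ^ 2 / (4 * (2 * h)) = (1 - ‖y‖ ^ 2 / 2) / (4 * h) by field_simp; ring]
    gcongr
    linarith
  unfold heatKernel
  calc _ ≤ (3 * (1 / (4 * Real.pi * (2 * h)) ^ ((3 : ℝ) / 2))) *
        (Real.exp (1 / (4 * h)) * Real.exp (-‖y‖ ^ 2 / (4 * (2 * h)))) :=
        mul_le_mul (heatKernel_prefactor hh) h2 (Real.exp_pos _).le (by positivity)
    _ = _ := by ring

lemma norm_fderiv_heatKernel_le {h : ℝ} (hh : 0 < h) (z : Space) :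
    ‖fderiv ℝ (heatKernel h) z‖ ≤ 1 / √h * weightConst * heatKernel (2 * h) z := by
  have h0 := heatKernel_pos hh z
  have h1 := one_le_weight hh z
  have h2 := Real.sqrt_pos.2 hh
  rw [(hasFDerivAt_heatKernel z).fderiv, norm_smul, innerSL_apply_norm, norm_mul, norm_neg,
    Real.norm_of_nonneg (by positivity), Real.norm_of_nonneg h0.le]
  calc 1 / (2 * h) * heatKernel h z * ‖z‖ ≤ 1 / h * heatKernel h z * (√h * weight h z) := by
        gcongr
        · linarith
        · exact norm_le_weight hh z
    _ = 1 / √h * (weight h z ^ 1 * heatKernel h z) := by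
        have := Real.mul_self_sqrt hh.le
        field_simp; rw [pow_two, this]
    _ ≤ 1 / √h * (weight h z ^ 8 * heatKernel h z) := by
        gcongr
        norm_num
    _ ≤ _ := by
        rw [mul_assoc]
        exact mul_le_mul_of_nonneg_left (weight_pow_mul_heatKernel_le hh z) (by positivity)

lemma continuous_fderiv_heatKernel (h : ℝ) : Continuous (fderiv ℝ (heatKernel h)) := by
  have h1 : fderiv ℝ (heatKernel h) = fun z => (-(1 / (2 * h)) * heatKernel h z) • innerSL ℝ z :=
    funext fun z => (hasFDerivAt_heatKernel z).fderiv
  have := continuous_heatKernel h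
  rw [h1]; fun_prop

lemma integrable_fderiv_heatKernel {h : ℝ} (hh : 0 < h) : Integrable (fderiv ℝ (heatKernel h)) :=
  ((integrable_heatKernel (show 0 < 2 * h by positivity)).const_mul _).mono'
    (continuous_fderiv_heatKernel h).aestronglyMeasurable
    (Eventually.of_forall (norm_fderiv_heatKernel_le hh))

lemma hasFDerivAt_heatConv [CompleteSpace F] {f : Space → F} (hf : PerBdd f) {h : ℝ} (hh : 0 < h)
    (x : Space) : HasFDerivAt (heatConv h f)
      (∫ y, (fderiv ℝ (heatKernel h) (x - y)).smulRight (f y)) x := by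
  obtain ⟨M, hM⟩ := hf.bdd
  have h2 : 0 < 2 * h := by positivity
  have h4 : 0 < 2 * (2 * h) := by positivity
  have h1 : heatConv h f = fun x => ∫ y, heatKernel h (x - y) • f y :=
    funext fun x => by rw [heatConv_eq_kconv, kconv_eq_integral_sub]
  have hs := Real.sqrt_pos.2 hh
  have hw := weightConst_pos
  rw [h1]
  refine hasFDerivAt_integral_of_dominated_of_fderiv_le (𝕜 := ℝ)
    (F' := fun x y => (fderiv ℝ (heatKernel h) (x - y)).smulRight (f y))
    (bound := fun y => 1 / √h * weightConst *
      (3 * Real.exp (1 / (4 * (2 * h))) * heatKernel (2 * (2 * h)) (x - y)) * M)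
    (Metric.ball_mem_nhds x one_pos)
    (Eventually.of_forall fun x' => ?_) ?_ ?_ (Eventually.of_forall fun y x' hx' => ?_) ?_
    (Eventually.of_forall fun y x' _ => ?_)
  · exact ((continuous_heatKernel h).comp (by fun_prop)).aestronglyMeasurable.smul hf.meas
  · exact ((integrable_heatKernel hh).comp_sub_left x).smul_bdd M hf.meas
      (Eventually.of_forall hM)
  · exact (((ContinuousLinearMap.smulRightL ℝ Space F).aestronglyMeasurable_comp₂
      ((continuous_fderiv_heatKernel h).comp (by fun_prop)).aestronglyMeasurable hf.meas))
  · rw [ContinuousLinearMap.norm_smulRight_apply]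
    refine mul_le_mul ((norm_fderiv_heatKernel_le hh _).trans ?_) (hM y) (norm_nonneg _) ?_
    · gcongr
      refine heatKernel_le_of_near h2 ?_
      rw [sub_sub_sub_cancel_right]
      exact (mem_ball_iff_norm.1 hx').le
    · have := heatKernel_pos h4 (x - y)
      positivity
  · exact ((((integrable_heatKernel h4).comp_sub_left x).const_mul _).const_mul _).mul_const M
  · have h5 : HasFDerivAt (fun x' : Space => heatKernel h (x' - y)) (fderiv ℝ (heatKernel h) (x' - y)) x' := by
      have := (hasFDerivAt_heatKernel (h := h) (x' - y)).differentiableAt.hasFDerivAt.comp x'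
        ((hasFDerivAt_id x').sub_const y)
      exact this.congr_fderiv (by ext; simp)
    exact h5.smul_const (f y)

lemma gradKernel_eq_fderiv (h : ℝ) (k : Fin 3) (z : Space) :
    gradKernel h k z = fderiv ℝ (heatKernel h) z (EuclideanSpace.single k 1) := by
  rw [(hasFDerivAt_heatKernel z).fderiv]
  simp [EuclideanSpace.inner_single_right, gradKernel]; ring

lemma integrable_smulRight_fderiv_heatKernel {f : Space → F} (hf : PerBdd f) {h : ℝ} (hh : 0 < h)
    (x : Space) : Integrable fun y => (fderiv ℝ (heatKernel h) (x - y)).smulRight (f y) := by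
  obtain ⟨M, hM⟩ := hf.bdd
  refine (((integrable_fderiv_heatKernel hh).comp_sub_left x).norm.mul_const M).mono'
    ((ContinuousLinearMap.smulRightL ℝ Space F).aestronglyMeasurable_comp₂
      ((continuous_fderiv_heatKernel h).comp (by fun_prop)).aestronglyMeasurable hf.meas)
      (Eventually.of_forall fun y => ?_)
  rw [ContinuousLinearMap.norm_smulRight_apply]
  gcongr
  exact hM y

lemma pderiv_heatConv [CompleteSpace F] {f : Space → F} (hf : PerBdd f) {h : ℝ} (hh : 0 < h) (k : Fin 3)
    (x : Space) : pderiv k (heatConv h f) x = kconv (gradKernel h k) f x := by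
  unfold pderiv
  rw [(hasFDerivAt_heatConv hf hh x).fderiv,
    ContinuousLinearMap.integral_apply (integrable_smulRight_fderiv_heatKernel hf hh x),
    kconv_eq_integral_sub]
  simp_rw [gradKernel_eq_fderiv]
  rfl

lemma lipschitzWith_heatConv [CompleteSpace F] {f : Space → F} (hf : PerBdd f) {h : ℝ} (hh : 0 < h) :
    ∃ C, LipschitzWith C (heatConv h f) := by
  obtain ⟨M, hM⟩ := hf.bdd
  refine ⟨Real.toNNReal ((∫ z, ‖fderiv ℝ (heatKernel h) z‖) * M), 
    lipschitzWith_of_nnnorm_fderiv_le (𝕜 := ℝ)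
    (fun x => (hasFDerivAt_heatConv hf hh x).differentiableAt) fun x => ?_⟩
  rw [← norm_toNNReal]
  refine Real.toNNReal_le_toNNReal ?_
  rw [(hasFDerivAt_heatConv hf hh x).fderiv, ← integral_sub_left_eq_self (fun z => ‖fderiv ℝ (heatKernel h) z‖) volume x,
    ← integral_mul_const]
  refine norm_integral_le_of_norm_le
    (((integrable_fderiv_heatKernel hh).comp_sub_left x).norm.mul_const M) (Eventually.of_forall fun y => ?_)
  rw [ContinuousLinearMap.norm_smulRight_apply]
  gcongr
  exact hM y

/-! ### Bounded functions of two points and the calculus of `dbl`. -/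

/-- Bounded measurable functions of a point `x` of the torus and a displacement `z`. -/
structure BddPair (B : Space → Space → F) : Prop where
  meas : AEStronglyMeasurable (fun p : Space × Space => B p.1 p.2) (volume.prod volume)
  per : ∀ z, PeriodicZ3 fun x => B x z
  bdd : ∃ M, ∀ x z, ‖B x z‖ ≤ M

namespace PerBdd

variable {f : Space → F}

lemma pair_fst (hf : PerBdd f) : BddPair fun x _ => f x :=
  ⟨hf.meas.comp_fst, fun _ => hf.per, let ⟨M, hM⟩ := hf.bdd; ⟨M, fun x _ => hM x⟩⟩

lemma pair_sub (hf : PerBdd f) : BddPair fun x z => f (x - z) :=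
  ⟨aestronglyMeasurable_uncurry_sub hf.meas, fun z => hf.per.comp_sub z,
    let ⟨M, hM⟩ := hf.bdd; ⟨M, fun x z => hM (x - z)⟩⟩

end PerBdd

namespace BddPair

lemma sub {A B : Space → Space → F} (hA : BddPair A) (hB : BddPair B) :
    BddPair fun x z => A x z - B x z where
  meas := hA.meas.sub hB.meas
  per z := (hA.per z).comp₂ (hB.per z) (· - ·)
  bdd := by
    obtain ⟨M, hM⟩ := hA.bdd
    obtain ⟨N, hN⟩ := hB.bdd
    exact ⟨M + N, fun x z => (norm_sub_le _ _).trans (add_le_add (hM x z) (hN x z))⟩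

lemma mul {A B : Space → Space → ℝ} (hA : BddPair A) (hB : BddPair B) :
    BddPair fun x z => A x z * B x z where
  meas := hA.meas.mul hB.meas
  per z := (hA.per z).comp₂ (hB.per z) (· * ·)
  bdd := by
    obtain ⟨M, hM⟩ := hA.bdd
    obtain ⟨N, hN⟩ := hB.bdd
    refine ⟨M * N, fun x z => ?_⟩
    rw [norm_mul]
    exact mul_le_mul (hM x z) (hN x z) (norm_nonneg _) ((norm_nonneg _).trans (hM x z))

lemma inner {A B : Space → Space → Plane} (hA : BddPair A) (hB : BddPair B) :
    BddPair fun x z => inner ℝ (A x z) (B x z) where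
  meas := hA.meas.inner hB.meas
  per z := (hA.per z).comp₂ (hB.per z) (fun a b => Inner.inner ℝ a b)
  bdd := by
    obtain ⟨M, hM⟩ := hA.bdd
    obtain ⟨N, hN⟩ := hB.bdd
    refine ⟨M * N, fun x z => (norm_inner_le_norm _ _).trans ?_⟩
    exact mul_le_mul (hM x z) (hN x z) (norm_nonneg _) ((norm_nonneg _).trans (hM x z))

lemma dominated {B : Space → Space → ℝ} (hB : BddPair B) {K : Space → ℝ} (hK : Integrable K) :
    IsDominated fun x z => K z * B x z where
  meas := hK.1.comp_snd.mul hB.meas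
  per z := (hB.per z).comp (K z * ·)
  dom := by
    obtain ⟨M, hM⟩ := hB.bdd
    refine ⟨fun z => |K z| * M, hK.abs.mul_const M, fun x z => ?_⟩
    rw [abs_mul]
    exact mul_le_mul_of_nonneg_left (hM x z) (abs_nonneg _)

end BddPair

/-- The double integral over `𝕋³ × ℝ³`. -/
def dbl (H : Space → Space → ℝ) : ℝ := ∫ x in cell, ∫ z, H x z

lemma dbl_swap {H : Space → Space → ℝ} (hH : IsDominated H) :
    dbl H = dbl fun x z => H (x - z) (-z) := hH.integral_swap

lemma dbl_eq_prod {H : Space → Space → ℝ} (hH : IsDominated H) :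
    dbl H = ∫ p, H p.1 p.2 ∂((volume.restrict cell).prod volume) :=
  (integral_prod _ hH.integrable_prod).symm

namespace IsDominated

variable {H L : Space → Space → ℝ}

lemma const_mul (hH : IsDominated H) (c : ℝ) : IsDominated fun x z => c * H x z where
  meas := hH.meas.const_mul c
  per z := (hH.per z).comp (c * ·)
  dom := by
    obtain ⟨κ, hκ, h⟩ := hH.dom
    refine ⟨fun z => |c| * κ z, hκ.const_mul _, fun x z => ?_⟩
    rw [abs_mul]
    exact mul_le_mul_of_nonneg_left (h x z) (abs_nonneg _)

lemma sub (hH : IsDominated H) (hL : IsDominated L) : IsDominated fun x z => H x z - L x z := by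
  simpa [sub_eq_add_neg] using hH.add (hL.const_mul (-1))

lemma sum {ι : Type*} {s : Finset ι} {H : ι → Space → Space → ℝ} (hH : ∀ i ∈ s, IsDominated (H i)) :
    IsDominated fun x z => ∑ i ∈ s, H i x z := by
  classical
  induction s using Finset.induction_on with
  | empty =>
    exact ⟨by simpa using aestronglyMeasurable_const, fun _ _ _ => by simp,
      fun _ => 0, integrable_zero _ _ _, by simp⟩
  | insert i s hi ih =>
    simp only [Finset.sum_insert hi]
    exact (hH i (Finset.mem_insert_self i s)).add (ih fun j hj => hH j (Finset.mem_insert_of_mem hj))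

lemma dbl_add (hH : IsDominated H) (hL : IsDominated L) :
    dbl (fun x z => H x z + L x z) = dbl H + dbl L := by
  rw [dbl_eq_prod hH, dbl_eq_prod hL, dbl_eq_prod (hH.add hL)]
  exact integral_add hH.integrable_prod hL.integrable_prod

lemma dbl_sub (hH : IsDominated H) (hL : IsDominated L) :
    dbl (fun x z => H x z - L x z) = dbl H - dbl L := by
  rw [dbl_eq_prod hH, dbl_eq_prod hL, dbl_eq_prod (hH.sub hL)]
  exact integral_sub hH.integrable_prod hL.integrable_prod

lemma dbl_sum {ι : Type*} {s : Finset ι} {H : ι → Space → Space → ℝ} (hH : ∀ i ∈ s, IsDominated (H i)) :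
    dbl (fun x z => ∑ i ∈ s, H i x z) = ∑ i ∈ s, dbl (H i) := by
  rw [dbl_eq_prod (sum hH)]
  refine (integral_finsetSum _ fun i hi => (hH i hi).integrable_prod).trans ?_
  exact Finset.sum_congr rfl fun i hi => (dbl_eq_prod (hH i hi)).symm

end IsDominated

lemma dbl_const_mul (c : ℝ) (H : Space → Space → ℝ) : dbl (fun x z => c * H x z) = c * dbl H := by
  simp [dbl, integral_const_mul]

lemma abs_dbl_le {H : Space → Space → ℝ} {b : Space → ℝ} (hb : Integrable b (volume.restrict cell))
    (h : ∀ x, |∫ z, H x z| ≤ b x) : |dbl H| ≤ ∫ x in cell, b x := by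
  rw [← Real.norm_eq_abs]
  exact norm_integral_le_of_norm_le hb (Eventually.of_forall h)

lemma integral_mul_inner_kconv {K : Space → ℝ} (hK : Integrable K) (f : Space → ℝ) (a : Space → Plane)
    {b : Space → Plane} (hb : PerBdd b) :
    ∫ x in cell, f x * inner ℝ (a x) (kconv K b x) =
      dbl fun x z => K z * (f x * inner ℝ (a x) (b (x - z))) := by
  unfold dbl kconv
  congr 1; ext x
  rw [← integral_inner (hb.integrable_kconv hK x), ← integral_const_mul]
  congr 1; ext z
  rw [inner_smul_right]; ring

/-! ### Unit maps and the defect. -/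

/-- Measurable maps from the torus into the unit circle. -/
structure UnitMap (u : Space → Plane) : Prop where
  per : PeriodicZ3 u
  meas : AEStronglyMeasurable u volume
  unit : ∀ x, ‖u x‖ = 1

lemma UnitMap.perBdd {u : Space → Plane} (hu : UnitMap u) : PerBdd u :=
  ⟨hu.per, hu.meas, 1, fun x => (hu.unit x).le⟩

/-- The local defect `∫ G_h(z) |u(x) - u(x - z)|² dz` of a unit map. -/
def defect (h : ℝ) (u : Space → Plane) (x : Space) : ℝ := 2 * (1 - inner ℝ (u x) (heatConv h u x))

lemma one_le_weightConst : 1 ≤ weightConst := by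
  unfold weightConst
  have : 1 ≤ Real.exp (1 / 8) := Real.one_le_exp (by norm_num)
  linarith

namespace UnitMap

variable {u : Space → Plane} {h : ℝ}

lemma norm_sub_sq (hu : UnitMap u) (x y : Space) : ‖u y - u x‖ ^ 2 = 2 * (1 - inner ℝ (u x) (u y)) := by
  rw [norm_sub_sq_real, hu.unit, hu.unit, real_inner_comm]; ring

lemma norm_sub_le (hu : UnitMap u) (x y : Space) : ‖u y - u x‖ ≤ 2 := by
  refine (_root_.norm_sub_le _ _).trans ?_
  rw [hu.unit, hu.unit]; norm_num

lemma aestronglyMeasurable_norm_sub (hu : UnitMap u) (x : Space) :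
    AEStronglyMeasurable (fun z => ‖u (x - z) - u x‖) volume :=
  ((aestronglyMeasurable_comp_sub_left hu.meas x).sub aestronglyMeasurable_const).norm

lemma integrable_weight_norm_sub (hu : UnitMap u) (hh : 0 < h) (x : Space) {n : ℕ} (hn : n ≤ 8) (m : ℕ) :
    Integrable fun z => weight h z ^ n * heatKernel h z * ‖u (x - z) - u x‖ ^ m := by
  refine (integrable_weight_pow_mul_heatKernel hh hn).mul_bdd (c := 2 ^ m)
    ((hu.aestronglyMeasurable_norm_sub x).pow m) (Eventually.of_forall fun z => ?_)
  rw [norm_pow, norm_norm]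
  gcongr
  exact hu.norm_sub_le _ _

/-- For unit vectors |a-b|² = 2(1 - a·b), and G_h has mass one. This links the energy density to
increments of u. -/
lemma integral_heatKernel_norm_sub_sq (hu : UnitMap u) (hh : 0 < h) (x : Space) :
    ∫ z, heatKernel h z * ‖u (x - z) - u x‖ ^ 2 = defect h u x := by
  have h1 : ∀ z, heatKernel h z * ‖u (x - z) - u x‖ ^ 2 =
      2 * (heatKernel h z - inner ℝ (u x) (heatKernel h z • u (x - z))) := fun z => by
    rw [hu.norm_sub_sq, inner_smul_right]; ring
  have h2 := hu.perBdd.integrable_kconv (integrable_heatKernel hh) x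
  simp_rw [h1]
  rw [integral_const_mul, integral_sub (integrable_heatKernel hh) (h2.const_inner _),
    integral_heatKernel hh, integral_inner h2]
  rfl

lemma defect_nonneg (hu : UnitMap u) (hh : 0 < h) (x : Space) : 0 ≤ defect h u x := by
  rw [← hu.integral_heatKernel_norm_sub_sq hh x]
  refine integral_nonneg fun z => ?_
  have := heatKernel_pos hh z
  positivity

lemma perBdd_defect (hu : UnitMap u) (hh : 0 < h) : PerBdd (defect h u) :=
  (PerBdd.const 2).mul ((PerBdd.const 1).sub (hu.perBdd.inner (hu.perBdd.heatConv hh)))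

lemma integrable_defect (hu : UnitMap u) (hh : 0 < h) : Integrable (defect h u) (volume.restrict cell) :=
  (hu.perBdd_defect hh).integrable_cell

lemma integral_defect (hh : 0 < h) (u : Space → Plane) :
    ∫ x in cell, defect h u x = 2 * h * energy h u := by
  unfold defect energy
  rw [integral_const_mul]; field_simp

lemma integrable_sqrt_defect (hu : UnitMap u) (hh : 0 < h) :
    Integrable (fun x => √(defect h u x)) (volume.restrict cell) := by
  refine ((integrable_const 1).add (hu.integrable_defect hh)).mono'
    (Real.continuous_sqrt.comp_aestronglyMeasurable (hu.perBdd_defect hh).meas).restrict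
    (Eventually.of_forall fun x => ?_)
  rw [Real.norm_of_nonneg (Real.sqrt_nonneg _), Pi.add_apply]
  have := hu.defect_nonneg hh x
  nlinarith [Real.sq_sqrt this, sq_nonneg (√(defect h u x) - 1)]

/-- Cauchy–Schwarz with respect to G_h dz, the weight going to the factor with bounded moments. It
is carried out as Young's inequality with a free parameter l. -/
lemma integral_weight_norm_sub_le (hu : UnitMap u) (hh : 0 < h) (x : Space) :
    ∫ z, weight h z * heatKernel h z * ‖u (x - z) - u x‖ ≤ weightConst * √(defect h u x) := by
  have hA := one_le_weightConst
  have hq := hu.defect_nonneg hh x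
  have i1 : Integrable fun z => weight h z * heatKernel h z * ‖u (x - z) - u x‖ := by
    simpa using hu.integrable_weight_norm_sub hh x (n := 1) (by norm_num) 1
  have i2 := integrable_weight_pow_mul_heatKernel hh (n := 2) (by norm_num)
  have i3 : Integrable fun z => heatKernel h z * ‖u (x - z) - u x‖ ^ 2 := by
    simpa using hu.integrable_weight_norm_sub hh x (n := 0) (by norm_num) 2
  have key : ∀ l : ℝ, 0 < l → ∫ z, weight h z * heatKernel h z * ‖u (x - z) - u x‖ ≤
      l / 2 * weightConst + 1 / (2 * l) * defect h u x := fun l hl => by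
    calc _ ≤ ∫ z, (l / 2 * (weight h z ^ 2 * heatKernel h z) +
          1 / (2 * l) * (heatKernel h z * ‖u (x - z) - u x‖ ^ 2)) := by
          refine integral_mono i1 ((i2.const_mul _).add (i3.const_mul _)) fun z => ?_
          have hG := heatKernel_pos hh z
          have e : l / 2 * (weight h z ^ 2 * heatKernel h z) +
            1 / (2 * l) * (heatKernel h z * ‖u (x - z) - u x‖ ^ 2) -
            weight h z * heatKernel h z * ‖u (x - z) - u x‖ =
            heatKernel h z / (2 * l) * (l * weight h z - ‖u (x - z) - u x‖) ^ 2 := by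
            field_simp; ring
          have : 0 ≤ heatKernel h z / (2 * l) * (l * weight h z - ‖u (x - z) - u x‖) ^ 2 := by
            positivity
          dsimp only
          linarith
      _ = l / 2 * (∫ z, weight h z ^ 2 * heatKernel h z) + 1 / (2 * l) * defect h u x := by
          rw [integral_add (i2.const_mul _) (i3.const_mul _), integral_const_mul, integral_const_mul,
            hu.integral_heatKernel_norm_sub_sq hh]
      _ ≤ _ := by
          gcongr
          exact integral_weight_pow_mul_heatKernel_le hh (by norm_num)
  rcases hq.eq_or_lt with h0 | h0
  · rw [← h0, Real.sqrt_zero, mul_zero]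
    refine le_of_forall_pos_le_add fun ε hε => ?_
    -- At zero defect the parameter may be taken arbitrarily small.
    refine (key (2 * ε / weightConst) (by positivity)).trans ?_
    rw [← h0]
    field_simp; linarith
  · have hs := Real.sqrt_pos.2 h0
    -- With l = √q both Young terms are multiples of √q; `one_le_weightConst` absorbs the second.
    refine (key _ hs).trans ?_
    have : 1 / (2 * √(defect h u x)) * defect h u x = √(defect h u x) / 2 := by
      have := Real.mul_self_sqrt hq
      field_simp; rw [pow_two, this]
    rw [this]
    nlinarith

/-- Integrals dominated by the increments of a unit map are controlled by its defect. -/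
lemma norm_integral_le_sqrt_defect (hu : UnitMap u) (hh : 0 < h) (x : Space) {Φ : Space → F} {c : ℝ}
    (hc : 0 ≤ c) (hΦ : ∀ z, ‖Φ z‖ ≤ c * (weight h z * heatKernel h z * ‖u (x - z) - u x‖)) :
    ‖∫ z, Φ z‖ ≤ c * weightConst * √(defect h u x) := by
  have i1 : Integrable fun z => weight h z * heatKernel h z * ‖u (x - z) - u x‖ := by
    simpa using hu.integrable_weight_norm_sub hh x (n := 1) (by norm_num) 1
  refine (norm_integral_le_of_norm_le (i1.const_mul c) (Eventually.of_forall hΦ)).trans ?_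
  rw [integral_const_mul, mul_assoc]
  gcongr
  exact hu.integral_weight_norm_sub_le hh x

/-- A square of an increment leaves no room for Cauchy–Schwarz to remove the weight, so the integral
is split: where w² ≤ l the weight costs a factor l, and elsewhere w² ≤ w⁸/l³ together with
|u(x-z)-u(x)|² ≤ 4 leaves a remainder of order l⁻³. -/
lemma integral_weight_norm_sub_sq_le (hu : UnitMap u) (hh : 0 < h) (x : Space) {l : ℝ} (hl : 0 < l) :
    ∫ z, weight h z ^ 2 * heatKernel h z * ‖u (x - z) - u x‖ ^ 2 ≤
      l * defect h u x + 4 * weightConst / l ^ 3 := by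
  have i1 := hu.integrable_weight_norm_sub hh x (n := 2) (by norm_num) 2
  have i2 := integrable_weight_pow_mul_heatKernel hh (n := 8) (by norm_num)
  have i3 : Integrable fun z => heatKernel h z * ‖u (x - z) - u x‖ ^ 2 := by
    simpa using hu.integrable_weight_norm_sub hh x (n := 0) (by norm_num) 2
  calc _ ≤ ∫ z, (l * (heatKernel h z * ‖u (x - z) - u x‖ ^ 2) +
        4 / l ^ 3 * (weight h z ^ 8 * heatKernel h z)) := by
        refine integral_mono i1 ((i3.const_mul _).add (i2.const_mul _)) fun z => ?_
        have hG := heatKernel_pos hh z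
        have hw := one_le_weight hh z
        have hd : ‖u (x - z) - u x‖ ^ 2 ≤ 4 := by
          have := hu.norm_sub_le x (x - z)
          nlinarith [norm_nonneg (u (x - z) - u x)]
        have hd0 : 0 ≤ ‖u (x - z) - u x‖ ^ 2 := by positivity
        have key : weight h z ^ 2 ≤ l + weight h z ^ 8 / l ^ 3 := by
          rcases le_total (weight h z ^ 2) l with h1 | h1
          · have : 0 ≤ weight h z ^ 8 / l ^ 3 := by positivity
            linarith
          · have : l ^ 3 ≤ (weight h z ^ 2) ^ 3 := by gcongr
            have h2 : weight h z ^ 2 ≤ weight h z ^ 8 / l ^ 3 := by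
              rw [le_div_iff₀ (by positivity)]
              calc weight h z ^ 2 * l ^ 3 ≤ weight h z ^ 2 * (weight h z ^ 2) ^ 3 := by gcongr
                _ = weight h z ^ 8 := by ring
            linarith
        calc weight h z ^ 2 * heatKernel h z * ‖u (x - z) - u x‖ ^ 2
            ≤ (l + weight h z ^ 8 / l ^ 3) * heatKernel h z * ‖u (x - z) - u x‖ ^ 2 := by gcongr
          _ = l * (heatKernel h z * ‖u (x - z) - u x‖ ^ 2) +
              weight h z ^ 8 / l ^ 3 * heatKernel h z * ‖u (x - z) - u x‖ ^ 2 := by ring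
          _ ≤ l * (heatKernel h z * ‖u (x - z) - u x‖ ^ 2) +
              weight h z ^ 8 / l ^ 3 * heatKernel h z * 4 := by gcongr
          _ = _ := by ring
    _ = l * defect h u x + 4 / l ^ 3 * ∫ z, weight h z ^ 8 * heatKernel h z := by
        rw [integral_add (i3.const_mul _) (i2.const_mul _), integral_const_mul, integral_const_mul,
            hu.integral_heatKernel_norm_sub_sq hh]
    _ ≤ _ := by
        rw [mul_div_right_comm]
        gcongr
        exact integral_weight_pow_mul_heatKernel_le hh (by norm_num)

lemma norm_integral_le_defect (hu : UnitMap u) (hh : 0 < h) (x : Space) {Φ : Space → F} {c l : ℝ}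
    (hc : 0 ≤ c) (hl : 0 < l)
    (hΦ : ∀ z, ‖Φ z‖ ≤ c * (weight h z ^ 2 * heatKernel h z * ‖u (x - z) - u x‖ ^ 2)) :
    ‖∫ z, Φ z‖ ≤ c * (l * defect h u x + 4 * weightConst / l ^ 3) := by
  have i1 := hu.integrable_weight_norm_sub hh x (n := 2) (by norm_num) 2
  refine (norm_integral_le_of_norm_le (i1.const_mul c) (Eventually.of_forall hΦ)).trans ?_
  rw [integral_const_mul]
  gcongr
  exact hu.integral_weight_norm_sub_sq_le hh x hl

end UnitMap

/-! ### Test functions of class C^{1,1}. -/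

/-- Periodic functions of class `C^{1,1}` with explicit bounds. -/
structure BddC11 (M : ℝ) (f : Space → F) : Prop where
  per : PeriodicZ3 f
  diff : Differentiable ℝ f
  bound : ∀ x, ‖f x‖ ≤ M
  bound_fderiv : ∀ x, ‖fderiv ℝ f x‖ ≤ M
  lip_fderiv : ∀ x y, ‖fderiv ℝ f x - fderiv ℝ f y‖ ≤ M * ‖x - y‖

namespace BddC11

variable {M : ℝ} {f : Space → F}

lemma nonneg (hf : BddC11 M f) : 0 ≤ M := (norm_nonneg _).trans (hf.bound 0)

lemma perBdd (hf : BddC11 M f) : PerBdd f :=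
  ⟨hf.per, hf.diff.continuous.aestronglyMeasurable, M, hf.bound⟩

lemma norm_sub_le (hf : BddC11 M f) (x y : Space) : ‖f x - f y‖ ≤ M * ‖x - y‖ :=
  convex_univ.norm_image_sub_le_of_norm_fderiv_le (𝕜 := ℝ) (fun x _ => hf.diff x)
    (fun x _ => hf.bound_fderiv x) trivial trivial

lemma lipschitzWith (hf : BddC11 M f) : LipschitzWith M.toNNReal f :=
  LipschitzWith.of_dist_le_mul fun x y => by
    rw [dist_eq_norm, dist_eq_norm, Real.coe_toNNReal _ hf.nonneg]; exact hf.norm_sub_le x y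

lemma taylor (hf : BddC11 M f) (x z : Space) : ‖f x - f (x - z) - fderiv ℝ f x z‖ ≤ M * ‖z‖ ^ 2 := by
  have h := (convex_closedBall x ‖z‖).norm_image_sub_le_of_norm_hasFDerivWithin_le' (𝕜 := ℝ) (f := f)
    (f' := fderiv ℝ f) (φ := fderiv ℝ f x) (C := M * ‖z‖) (x := x - z) (y := x)
    (fun y _ => (hf.diff y).hasFDerivAt.hasFDerivWithinAt)
    (fun y hy => (hf.lip_fderiv y x).trans (by
      have := hf.nonneg
      gcongr; exact mem_closedBall_iff_norm.1 hy))
    (by simp) (by simp)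
  simpa [pow_two, mul_assoc] using h

lemma continuous_fderiv (hf : BddC11 M f) : Continuous (fderiv ℝ f) :=
  (LipschitzWith.of_dist_le_mul (K := M.toNNReal) fun x y => by
    rw [dist_eq_norm, dist_eq_norm, Real.coe_toNNReal _ hf.nonneg]; exact hf.lip_fderiv x y).continuous

lemma fderiv_apply (f : Space → F) (x z : Space) : fderiv ℝ f x z = ∑ k : Fin 3, z k • pderiv k f x := by
  unfold pderiv
  conv_lhs => rw [← (EuclideanSpace.basisFun (Fin 3) ℝ).sum_repr z]
  simp

lemma norm_pderiv_le (hf : BddC11 M f) (k : Fin 3) (x : Space) : ‖pderiv k f x‖ ≤ M := by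
  refine ((fderiv ℝ f x).le_opNorm _).trans ?_
  simpa using hf.bound_fderiv x

lemma norm_pderiv_sub_le (hf : BddC11 M f) (k : Fin 3) (x y : Space) :
    ‖pderiv k f x - pderiv k f y‖ ≤ M * ‖x - y‖ := by
  refine le_trans ?_ (hf.lip_fderiv x y)
  simpa [pderiv] using (fderiv ℝ f x - fderiv ℝ f y).le_opNorm (EuclideanSpace.single k 1)

lemma perBdd_pderiv (hf : BddC11 M f) (k : Fin 3) : PerBdd (pderiv k f) where
  per j x := by
    unfold pderiv
    have : f = fun y => f (y + EuclideanSpace.single j 1) := funext fun y => (hf.per j y).symm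
    conv_rhs => rw [this]
    rw [fderiv_comp_add_right]
  meas := (hf.continuous_fderiv.clm_apply continuous_const).aestronglyMeasurable
  bdd := ⟨M, hf.norm_pderiv_le k⟩

lemma integral_pderiv {f : Space → ℝ} (hf : BddC11 M f) (k : Fin 3) : ∫ x in cell, pderiv k f x = 0 :=
  hf.per.integral_lineDeriv_eq_zero hf.lipschitzWith (v := EuclideanSpace.single k 1)
    (Eventually.of_forall fun x => (hf.diff x).hasFDerivAt.hasLineDerivAt _)

end BddC11

/-! ### Outer variations at a fixed time. -/

/-- The antisymmetric product `u_j(x) v_i(y) - u_i(x) v_j(y)` at `y = x - z`. -/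
def wedge (u v : Space → Plane) (i j : Fin 2) (x z : Space) : ℝ :=
  u x j * v (x - z) i - u x i * v (x - z) j

lemma bddPair_wedge {u v : Space → Plane} (hu : PerBdd u) (hv : PerBdd v) (i j : Fin 2) :
    BddPair (wedge u v i j) :=
  ((hu.coord j).pair_fst.mul (hv.coord i).pair_sub).sub ((hu.coord i).pair_fst.mul (hv.coord j).pair_sub)

lemma abs_coord_le (v : Plane) (i : Fin 2) : |v i| ≤ ‖v‖ := by
  simpa using PiLp.norm_apply_le v i

/-- The antisymmetric product of u(x) with itself vanishes, so u(x-z) may be replaced by its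
increment. -/
lemma UnitMap.abs_wedge_le {u : Space → Plane} (hu : UnitMap u) (i j : Fin 2) (x z : Space) :
    |wedge u u i j x z| ≤ 2 * ‖u (x - z) - u x‖ := by
  have h1 : wedge u u i j x z =
      u x j * (u (x - z) - u x) i - u x i * (u (x - z) - u x) j := by
    simp [wedge]; ring
  have h2 : ∀ k l : Fin 2, |u x k * (u (x - z) - u x) l| ≤ ‖u (x - z) - u x‖ := fun k l => by
    rw [abs_mul]
    have h3 := abs_coord_le (u x) k
    rw [hu.unit] at h3
    calc _ ≤ 1 * ‖u (x - z) - u x‖ := by gcongr; exact abs_coord_le _ l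
      _ = _ := one_mul _
  rw [h1]
  refine (abs_sub _ _).trans ?_
  linarith [h2 j i, h2 i j]

lemma integral_wedge {u v : Space → Plane} (hv : PerBdd v) {K : Space → ℝ} (hK : Integrable K)
    (f : Space → ℝ) (i j : Fin 2) :
    ∫ x in cell, (u x j * kconv K (fun y => v y i) x - u x i * kconv K (fun y => v y j) x) * f x =
      dbl fun x z => K z * (wedge u v i j x z * f x) := by
  unfold dbl kconv
  congr 1; ext x
  rw [← integral_const_mul, ← integral_const_mul, ← integral_sub, ← integral_mul_const]
  · congr 1; ext z
    simp only [wedge, smul_eq_mul]; ring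
  · exact ((hv.coord i).integrable_kconv hK x).const_mul _
  · exact ((hv.coord j).integrable_kconv hK x).const_mul _

lemma sum_coord_gradKernel (h : ℝ) (z : Space) (c : Fin 3 → ℝ) :
    ∑ k, gradKernel h k z * c k = -(1 / (2 * h)) * heatKernel h z * ∑ k, z k * c k := by
  rw [Finset.mul_sum]
  refine Finset.sum_congr rfl fun k _ => ?_
  simp only [gradKernel]; ring

section

variable {u v : Space → Plane} {h M : ℝ} {ζ : Space → ℝ}

/-- Because ∂_k G_h = -z_k G_h/(2h), the gradient term is minus the first-order Taylor part of
ζ(x)-ζ(x-z). The remainder is O(|z|²): the weight absorbs |z|²/h, and one increment of u is left to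
produce √q. -/
lemma abs_outer_core_le (hu : UnitMap u) (hh : 0 < h) (hζ : BddC11 M ζ) (i j : Fin 2) :
    |1 / (2 * h) * dbl (fun x z => heatKernel h z * ((ζ x - ζ (x - z)) * wedge u u i j x z)) +
      ∑ k, dbl (fun x z => gradKernel h k z * (wedge u u i j x z * pderiv k ζ x))| ≤
      M * weightConst * ∫ x in cell, √(defect h u x) := by
  have hw := bddPair_wedge hu.perBdd hu.perBdd i j
  have d1 : IsDominated fun x z => heatKernel h z * ((ζ x - ζ (x - z)) * wedge u u i j x z) :=
    ((hζ.perBdd.pair_fst.sub hζ.perBdd.pair_sub).mul hw).dominated (integrable_heatKernel hh)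
  have d2 : ∀ k ∈ Finset.univ, IsDominated fun x z => gradKernel h k z * (wedge u u i j x z * pderiv k ζ x) :=
    fun k _ => (hw.mul (hζ.perBdd_pderiv k).pair_fst).dominated (integrable_gradKernel hh k)
  rw [← dbl_const_mul, ← IsDominated.dbl_sum d2, ← (d1.const_mul _).dbl_add (IsDominated.sum d2),
    ← integral_const_mul]
  refine abs_dbl_le ((hu.integrable_sqrt_defect hh).const_mul _) fun x => ?_
  rw [← Real.norm_eq_abs]
  refine hu.norm_integral_le_sqrt_defect hh x hζ.nonneg fun z => ?_
  have hG := heatKernel_pos hh z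
  have e : ∑ k, gradKernel h k z * (wedge u u i j x z * pderiv k ζ x) =
      -(1 / (2 * h)) * heatKernel h z * wedge u u i j x z * fderiv ℝ ζ x z := by
    have : ∑ k, z k * (wedge u u i j x z * pderiv k ζ x) =
        wedge u u i j x z * ∑ k, z k • pderiv k ζ x := by
      rw [Finset.mul_sum]
      refine Finset.sum_congr rfl fun k _ => ?_
      rw [smul_eq_mul]; ring
    rw [sum_coord_gradKernel, BddC11.fderiv_apply, this]; ring
  rw [e, show 1 / (2 * h) * (heatKernel h z * ((ζ x - ζ (x - z)) * wedge u u i j x z)) +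
      -(1 / (2 * h)) * heatKernel h z * wedge u u i j x z * fderiv ℝ ζ x z =
      1 / (2 * h) * heatKernel h z * wedge u u i j x z * (ζ x - ζ (x - z) - fderiv ℝ ζ x z) by ring,
    norm_mul, norm_mul, Real.norm_of_nonneg (by positivity : 0 ≤ 1 / (2 * h) * heatKernel h z)]
  have hM := hζ.nonneg
  calc _ ≤ 1 / (2 * h) * heatKernel h z * (2 * ‖u (x - z) - u x‖) * (M * (h * weight h z)) := by
        gcongr
        · exact hu.abs_wedge_le i j x z
        · refine (hζ.taylor x z).trans ?_
          gcongr
          exact norm_sq_le_weight hh z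
    _ = _ := by field_simp

/-- Exchanging x and x-z flips the sign of the antisymmetric product; adding the two forms puts the
difference on ζ. -/
lemma dbl_wedge_symm (hu : PerBdd u) (hh : 0 < h) (hζ : BddC11 M ζ) (i j : Fin 2) :
    dbl (fun x z => heatKernel h z * ((ζ x - ζ (x - z)) * wedge u u i j x z)) =
      2 * dbl (fun x z => heatKernel h z * (wedge u u i j x z * ζ x)) := by
  have d1 : IsDominated fun x z => heatKernel h z * (wedge u u i j x z * ζ x) :=
    ((bddPair_wedge hu hu i j).mul hζ.perBdd.pair_fst).dominated (integrable_heatKernel hh)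
  rw [two_mul]
  nth_rewrite 2 [dbl_swap d1]
  rw [← d1.dbl_add d1.comp_swap]
  congr 1; ext x z
  simp only [wedge, heatKernel_neg, sub_neg_eq_add, sub_add_cancel]
  ring

/-- Here the exchange also interchanges the two maps. It brings the new map to the base point, where
the step relation makes it parallel to the heat flow of the old one. -/
lemma dbl_wedge_swap (hu : PerBdd u) (hv : PerBdd v) (hh : 0 < h) (hζ : BddC11 M ζ) (i j : Fin 2) :
    dbl (fun x z => heatKernel h z * (wedge u v i j x z * ζ x)) =
      -dbl (fun x z => heatKernel h z * (wedge v u i j x z * ζ (x - z))) := by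
  have d1 : IsDominated fun x z => heatKernel h z * (wedge u v i j x z * ζ x) :=
    ((bddPair_wedge hu hv i j).mul hζ.perBdd.pair_fst).dominated (integrable_heatKernel hh)
  rw [dbl_swap d1, ← neg_one_mul, ← dbl_const_mul]
  congr 1; ext x z
  simp only [wedge, heatKernel_neg, sub_neg_eq_add, sub_add_cancel]
  ring

/-- The spatial integrand of `outerForm` for given difference quotients `D i`. -/
def outerIntegrand (h : ℝ) (u : Space → Plane) (D : Fin 2 → Space → ℝ) (ζ : Space → ℝ) (i j : Fin 2)
    (x : Space) : ℝ :=
  (u x j * D i x - u x i * D j x) * ζ x +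
    ∑ k : Fin 3, (u x j * pderiv k (heatConv h fun y => u y i) x -
      u x i * pderiv k (heatConv h fun y => u y j) x) * pderiv k ζ x

lemma integral_outerIntegrand (hu : UnitMap u) (hh : 0 < h) (hζ : BddC11 M ζ) (i j : Fin 2)
    {D : Fin 2 → Space → ℝ} (hD : ∀ i, PerBdd (D i)) :
    ∫ x in cell, outerIntegrand h u D ζ i j x =
      (∫ x in cell, (u x j * D i x - u x i * D j x) * ζ x) +
      ∑ k, dbl (fun x z => gradKernel h k z * (wedge u u i j x z * pderiv k ζ x)) := by
  have hc := hu.perBdd.coord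
  have p1 : PerBdd fun x => (u x j * D i x - u x i * D j x) * ζ x :=
    (((hc j).mul (hD i)).sub ((hc i).mul (hD j))).mul hζ.perBdd
  have p2 : ∀ k, PerBdd fun x => (u x j * kconv (gradKernel h k) (fun y => u y i) x -
      u x i * kconv (gradKernel h k) (fun y => u y j) x) * pderiv k ζ x := fun k =>
    (((hc j).mul ((hc i).kconv (integrable_gradKernel hh k))).sub
      ((hc i).mul ((hc j).kconv (integrable_gradKernel hh k)))).mul (hζ.perBdd_pderiv k)
  unfold outerIntegrand
  simp_rw [pderiv_heatConv (hc _) hh]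
  rw [integral_add p1.integrable_cell (integrable_finsetSum _ fun k _ => (p2 k).integrable_cell),
    integral_finsetSum _ fun k _ => (p2 k).integrable_cell]
  congr 1
  exact Finset.sum_congr rfl fun k _ => integral_wedge hu.perBdd (integrable_gradKernel hh k) _ i j

/-- The gradient part alone is bounded by the defect. -/
lemma abs_integral_outerIntegrand_zero_le (hu : UnitMap u) (hh : 0 < h) (hζ : BddC11 M ζ) (i j : Fin 2) :
    |∫ x in cell, outerIntegrand h u (fun _ _ => 0) ζ i j x| ≤
      6 * M / √h * weightConst * ∫ x in cell, √(defect h u x) := by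
  rw [integral_outerIntegrand hu hh hζ i j fun _ => PerBdd.const 0]
  have hs := Real.sqrt_pos.2 hh
  have hM := hζ.nonneg
  have key : ∀ k, |dbl (fun x z => gradKernel h k z * (wedge u u i j x z * pderiv k ζ x))| ≤
      2 * M / √h * weightConst * ∫ x in cell, √(defect h u x) := fun k => by
    rw [← integral_const_mul]
    refine abs_dbl_le ((hu.integrable_sqrt_defect hh).const_mul _) fun x => ?_
    rw [← Real.norm_eq_abs]
    refine hu.norm_integral_le_sqrt_defect hh x (by positivity) fun z => ?_
    have hG := heatKernel_pos hh z
    have hwt := one_le_weight hh z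
    rw [norm_mul, norm_mul]
    calc _ ≤ (1 / √h * (weight h z * heatKernel h z)) * ((2 * ‖u (x - z) - u x‖) * M) := by
          gcongr
          · exact abs_gradKernel_le hh k z
          · exact hu.abs_wedge_le i j x z
          · exact hζ.norm_pderiv_le k x
      _ = _ := by ring
  simp only [mul_zero, sub_zero, zero_mul, integral_zero, zero_add]
  refine (Finset.abs_sum_le_sum_abs _ _).trans ((Finset.sum_le_sum fun k _ => key k).trans ?_)
  simp; apply le_of_eq; ring

lemma heatConv_coord (hu : PerBdd u) (hh : 0 < h) (i : Fin 2) (x : Space) :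
    heatConv h (fun y => u y i) x = heatConv h u x i :=
  kconv_clm_comp hu (integrable_heatKernel hh) (EuclideanSpace.proj i) x

/-- The outer variation with the backward difference quotient, at a fixed time. -/
lemma abs_integral_outerIntegrand_backward_le (hu : UnitMap u) (hv : UnitMap v) (hh : 0 < h)
    (hζ : BddC11 M ζ) (i j : Fin 2)
    (hstep : ∀ x, u x j * heatConv h v x i = u x i * heatConv h v x j) :
    |∫ x in cell, outerIntegrand h u (fun i x => h⁻¹ • (heatConv h (fun y => u y i) x -
      heatConv h (fun y => v y i) x)) ζ i j x| ≤
      M * weightConst * ∫ x in cell, √(defect h u x) := by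
  refine le_trans (le_of_eq ?_) (abs_outer_core_le hu hh hζ i j)
  have hc := hu.perBdd.coord
  rw [integral_outerIntegrand hu hh hζ i j fun i => (PerBdd.const h⁻¹).smul
    (((hc i).heatConv hh).sub ((hv.perBdd.coord i).heatConv hh))]
  congr 2
  rw [dbl_wedge_symm hu.perBdd hh hζ, ← integral_wedge hu.perBdd (integrable_heatKernel hh),
    ← mul_assoc, ← integral_const_mul]
  -- Parallelism of u and G_h ∗ v removes v pointwise from the difference quotient.
  refine integral_congr_ae (Eventually.of_forall fun x => ?_)
  have := hstep x
  rw [← heatConv_coord hv.perBdd hh, ← heatConv_coord hv.perBdd hh] at this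
  simp only [heatConv_eq_kconv, smul_eq_mul] at this ⊢
  field_simp
  linear_combination (-(ζ x)) * this

/-- Split u(x-z) into its increment and u(x). The increment gains √h from ζ and √q from u; the u(x)
part gains a full h, since the linear Taylor term of ζ is odd in z and integrates to zero. -/
lemma integral_mul_heatKernel_sub_le (hu : UnitMap u) (hh : 0 < h) (hζ : BddC11 M ζ) (j : Fin 2)
    (x : Space) : |∫ z, heatKernel h z * ((ζ x - ζ (x - z)) * u (x - z) j)| ≤
      M * weightConst * (√h * √(defect h u x) + h) := by
  have hM := hζ.nonneg
  have hs := Real.sqrt_pos.2 hh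
  have hc := hu.perBdd.coord j
  have hζm : AEStronglyMeasurable (fun z => ζ x - ζ (x - z)) volume :=
    aestronglyMeasurable_const.sub (aestronglyMeasurable_comp_sub_left hζ.perBdd.meas x)
  have hζb : ∀ z, ‖ζ x - ζ (x - z)‖ ≤ 2 * M := fun z => by
    refine (norm_sub_le _ _).trans ?_
    linarith [hζ.bound x, hζ.bound (x - z)]
  have i1 : Integrable fun z => heatKernel h z * ((ζ x - ζ (x - z)) * (u (x - z) j - u x j)) := by
    refine (integrable_heatKernel hh).mul_bdd (c := 2 * M * 2)
      (hζm.mul ((aestronglyMeasurable_comp_sub_left hc.meas x).sub aestronglyMeasurable_const))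
      (Eventually.of_forall fun z => ?_)
    rw [norm_mul]
    gcongr
    · exact hζb z
    · exact (abs_coord_le (u (x - z) - u x) j).trans (hu.norm_sub_le _ _)
  have i2 : Integrable fun z => heatKernel h z * (ζ x - ζ (x - z)) :=
    (integrable_heatKernel hh).mul_bdd (c := 2 * M) hζm (Eventually.of_forall hζb)
  have i3 : ∀ k ∈ Finset.univ, Integrable fun z => gradKernel h k z * (2 * h * pderiv k ζ x) := fun k _ =>
    (integrable_gradKernel hh k).mul_const _
  have e1 : ∫ z, heatKernel h z * ((ζ x - ζ (x - z)) * u (x - z) j) =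
      (∫ z, heatKernel h z * ((ζ x - ζ (x - z)) * (u (x - z) j - u x j))) +
      u x j * ∫ z, heatKernel h z * (ζ x - ζ (x - z)) := by
    rw [← integral_const_mul, ← integral_add i1 (i2.const_mul _)]
    congr 1; ext z; ring
  have e2 : ∫ z, heatKernel h z * (ζ x - ζ (x - z)) =
      ∫ z, heatKernel h z * (ζ x - ζ (x - z) - fderiv ℝ ζ x z) := by
    have : ∀ z, heatKernel h z * (ζ x - ζ (x - z) - fderiv ℝ ζ x z) =
        heatKernel h z * (ζ x - ζ (x - z)) + ∑ k, gradKernel h k z * (2 * h * pderiv k ζ x) := fun z => by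
      rw [sum_coord_gradKernel, BddC11.fderiv_apply]
      have : ∑ k, z k * (2 * h * pderiv k ζ x) = 2 * h * ∑ k, z k • pderiv k ζ x := by
        rw [Finset.mul_sum]
        refine Finset.sum_congr rfl fun k _ => ?_
        rw [smul_eq_mul]; ring
      rw [this]; field_simp; ring
    simp_rw [this]
    rw [integral_add i2 (integrable_finsetSum _ i3), integral_finsetSum _ i3]
    simp [integral_mul_const, integral_gradKernel]
  have b1 : |∫ z, heatKernel h z * ((ζ x - ζ (x - z)) * (u (x - z) j - u x j))| ≤
      M * √h * weightConst * √(defect h u x) := by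
    rw [← Real.norm_eq_abs]
    refine hu.norm_integral_le_sqrt_defect hh x (by positivity) fun z => ?_
    have hG := heatKernel_pos hh z
    have hwt := one_le_weight hh z
    rw [norm_mul, norm_mul, Real.norm_of_nonneg hG.le]
    calc _ ≤ heatKernel h z * (M * (√h * weight h z) * ‖u (x - z) - u x‖) := by
          gcongr
          · refine (hζ.norm_sub_le _ _).trans ?_
            rw [sub_sub_cancel]
            gcongr
            exact norm_le_weight hh z
          · exact abs_coord_le (u (x - z) - u x) j
      _ = _ := by ring
  have b2 : |∫ z, heatKernel h z * (ζ x - ζ (x - z))| ≤ M * h * weightConst := by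
    rw [e2]
    have i4 := (integrable_weight_pow_mul_heatKernel hh (n := 1) (by norm_num)).const_mul (M * h)
    rw [← Real.norm_eq_abs]
    refine (norm_integral_le_of_norm_le i4 (Eventually.of_forall fun z => ?_)).trans ?_
    · have hG := heatKernel_pos hh z
      rw [norm_mul, Real.norm_of_nonneg hG.le, pow_one]
      calc _ ≤ heatKernel h z * (M * (h * weight h z)) := by
            gcongr
            refine (hζ.taylor x z).trans ?_
            gcongr
            exact norm_sq_le_weight hh z
        _ = _ := by ring
    · rw [integral_const_mul]
      gcongr
      exact integral_weight_pow_mul_heatKernel_le hh (by norm_num)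
  rw [e1]
  refine (abs_add_le _ _).trans ?_
  rw [abs_mul]
  have h3 := abs_coord_le (u x) j
  rw [hu.unit] at h3
  have h4 : |u x j| * |∫ z, heatKernel h z * (ζ x - ζ (x - z))| ≤ 1 * (M * h * weightConst) := by
    gcongr
  linarith

lemma norm_sub_heatConv_le (hu : UnitMap u) (hh : 0 < h) (x : Space) :
    ‖u x - heatConv h u x‖ ≤ weightConst * √(defect h u x) := by
  have e : u x - heatConv h u x = -∫ z, heatKernel h z • (u (x - z) - u x) := by
    simp_rw [smul_sub]
    rw [integral_sub (hu.perBdd.integrable_kconv (integrable_heatKernel hh) x)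
      ((integrable_heatKernel hh).smul_const _), integral_smul_const, integral_heatKernel hh, one_smul,
      neg_sub]
    rfl
  rw [e, norm_neg]
  have := hu.norm_integral_le_sqrt_defect hh x (Φ := fun z => heatKernel h z • (u (x - z) - u x))
    zero_le_one fun z => by
      have hG := heatKernel_pos hh z
      rw [norm_smul, Real.norm_of_nonneg hG.le, one_mul]
      gcongr
      have := one_le_weight hh z
      nlinarith
  simpa using this

/-- One step of the scheme moves a unit map by at most its distance to the heat flow. -/
lemma norm_step_sub_le (hu : UnitMap u) (hv : UnitMap v) (hh : 0 < h)
    (hstep : ∀ x, heatConv h u x ≠ 0 → v x = (‖heatConv h u x‖)⁻¹ • heatConv h u x) (x : Space) :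
    ‖v x - u x‖ ≤ 2 * weightConst * √(defect h u x) := by
  have h1 := norm_sub_heatConv_le hu hh x
  -- On the circle, v x is a nearest point to the value of the heat flow, so u x cannot be closer.
  -- At zeros of the flow both distances equal one.
  have h2 : ‖v x - heatConv h u x‖ ≤ ‖u x - heatConv h u x‖ := by
    by_cases h0 : heatConv h u x = 0
    · rw [h0, sub_zero, sub_zero, hu.unit, hv.unit]
    · have hp := norm_pos_iff.2 h0
      have e : v x - heatConv h u x = (1 - ‖heatConv h u x‖) • (‖heatConv h u x‖)⁻¹ • heatConv h u x := by
        rw [hstep x h0, sub_smul, one_smul, smul_smul _ (‖heatConv h u x‖)⁻¹, mul_inv_cancel₀ hp.ne', one_smul]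
      rw [e, norm_smul, norm_smul, norm_inv, norm_norm, inv_mul_cancel₀ hp.ne', mul_one,
        ← hu.unit x]
      exact abs_norm_sub_norm_le _ _
  have h3 : ‖v x - u x‖ ≤ ‖v x - heatConv h u x‖ + ‖u x - heatConv h u x‖ := by
    have := norm_sub_le (v x - heatConv h u x) (u x - heatConv h u x)
    rwa [sub_sub_sub_cancel_right] at this
  linarith

/-- The outer variation with the forward difference quotient, at a fixed time. -/
lemma abs_integral_outerIntegrand_forward_le (hu : UnitMap u) (hv : UnitMap v) (hh : 0 < h)
    (hζ : BddC11 M ζ) (i j : Fin 2)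
    (hstep : ∀ x, heatConv h u x ≠ 0 → v x = (‖heatConv h u x‖)⁻¹ • heatConv h u x) :
    |∫ x in cell, outerIntegrand h u (fun i x => (-h)⁻¹ • (heatConv h (fun y => u y i) x -
      heatConv h (fun y => v y i) x)) ζ i j x| ≤
      5 * M * weightConst ^ 2 * ∫ x in cell, (√(defect h u x) + defect h u x / √h) := by
  have hM := hζ.nonneg
  have hA := one_le_weightConst
  have hs := Real.sqrt_pos.2 hh
  have hc := hu.perBdd.coord
  have hK := integrable_heatKernel hh
  have hur := hu.perBdd
  have hvr := hv.perBdd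
  have hwr : PerBdd fun x => v x - u x := hvr.sub hur
  have hev : ∀ x, v x j * heatConv h u x i = v x i * heatConv h u x j := fun x => by
    by_cases h0 : heatConv h u x = 0
    · rw [h0]; simp
    · rw [hstep x h0]; simp; ring
  have d1 : IsDominated fun x z => heatKernel h z * (wedge v u i j x z * ζ (x - z)) :=
    ((bddPair_wedge hvr hur i j).mul hζ.perBdd.pair_sub).dominated hK
  have d2 : IsDominated fun x z => heatKernel h z * (wedge v u i j x z * ζ x) :=
    ((bddPair_wedge hvr hur i j).mul hζ.perBdd.pair_fst).dominated hK
  have d3 : IsDominated fun x z => heatKernel h z * ((ζ x - ζ (x - z)) * wedge u u i j x z) :=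
    ((hζ.perBdd.pair_fst.sub hζ.perBdd.pair_sub).mul (bddPair_wedge hur hur i j)).dominated hK
  have d4 : IsDominated fun x z => heatKernel h z * ((ζ x - ζ (x - z)) *
      wedge (fun x => v x - u x) u i j x z) :=
    ((hζ.perBdd.pair_fst.sub hζ.perBdd.pair_sub).mul (bddPair_wedge hwr hur i j)).dominated hK
  -- As v is parallel to G_h ∗ u, this vanishing integral can be added for free; it converts ζ(x-z)
  -- into a difference of ζ.
  have z2 : dbl (fun x z => heatKernel h z * (wedge v u i j x z * ζ x)) = 0 := by
    rw [← integral_wedge hur hK]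
    have : ∀ x, v x j * kconv (heatKernel h) (fun y => u y i) x -
        v x i * kconv (heatKernel h) (fun y => u y j) x = 0 := fun x => by
      have := hev x
      rw [← heatConv_coord hur hh, ← heatConv_coord hur hh] at this
      exact sub_eq_zero.2 this
    simp [this]
  have e1 : dbl (fun x z => heatKernel h z * (wedge u v i j x z * ζ x)) =
      dbl (fun x z => heatKernel h z * ((ζ x - ζ (x - z)) * wedge u u i j x z)) +
      dbl (fun x z => heatKernel h z * ((ζ x - ζ (x - z)) * wedge (fun x => v x - u x) u i j x z)) := by
    rw [dbl_wedge_swap hur hvr hh hζ, ← d3.dbl_add d4, eq_comm, ← sub_eq_zero, sub_neg_eq_add, ← z2,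
      ← (d3.add d4).dbl_add d1]
    congr 1; ext x z
    simp only [wedge, PiLp.sub_apply]; ring
  have e2 := dbl_wedge_symm hur hh hζ i j
  -- Half of the coefficient 1/h of the u–u term is cancelled by the subtracted u part of the
  -- quotient. The remaining 1/(2h) is that of the backward case; only the term with v - u is new.
  have e3 : ∫ x in cell, outerIntegrand h u (fun i x => (-h)⁻¹ • (heatConv h (fun y => u y i) x -
      heatConv h (fun y => v y i) x)) ζ i j x =
      (1 / (2 * h) * dbl (fun x z => heatKernel h z * ((ζ x - ζ (x - z)) * wedge u u i j x z)) +
      ∑ k, dbl (fun x z => gradKernel h k z * (wedge u u i j x z * pderiv k ζ x))) +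
      1 / h * dbl (fun x z => heatKernel h z * ((ζ x - ζ (x - z)) *
        wedge (fun x => v x - u x) u i j x z)) := by
    rw [integral_outerIntegrand hu hh hζ i j fun i => (PerBdd.const (-h)⁻¹).smul
      (((hc i).heatConv hh).sub ((hvr.coord i).heatConv hh))]
    have p : ∀ w : Space → Plane, PerBdd w → Integrable (fun x =>
        (u x j * kconv (heatKernel h) (fun y => w y i) x -
        u x i * kconv (heatKernel h) (fun y => w y j) x) * ζ x) (volume.restrict cell) := fun w hw =>
      ((((hc j).mul ((hw.coord i).kconv hK)).sub ((hc i).mul ((hw.coord j).kconv hK))).mul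
        hζ.perBdd).integrable_cell
    have : ∫ x in cell, (u x j * ((-h)⁻¹ • (heatConv h (fun y => u y i) x -
        heatConv h (fun y => v y i) x)) - u x i * ((-h)⁻¹ • (heatConv h (fun y => u y j) x -
        heatConv h (fun y => v y j) x))) * ζ x =
        1 / h * (dbl (fun x z => heatKernel h z * (wedge u v i j x z * ζ x)) -
          dbl (fun x z => heatKernel h z * (wedge u u i j x z * ζ x))) := by
      rw [← integral_wedge hvr hK, ← integral_wedge hur hK, ← integral_sub (p v hvr) (p u hur),
        ← integral_const_mul]
      congr 1; ext x
      simp only [heatConv_eq_kconv, smul_eq_mul]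
      field_simp; ring
    rw [this, e1, e2]
    field_simp; ring
  have b1 := abs_outer_core_le hu hh hζ i j
  have b2 : |dbl (fun x z => heatKernel h z * ((ζ x - ζ (x - z)) *
        wedge (fun x => v x - u x) u i j x z))| ≤
      4 * M * weightConst ^ 2 * ∫ x in cell, (√h * defect h u x + h * √(defect h u x)) := by
    rw [← integral_const_mul]
    refine abs_dbl_le ((((hu.integrable_defect hh).const_mul _).add
      ((hu.integrable_sqrt_defect hh).const_mul _)).const_mul _) fun x => ?_
    have iz : ∀ k, Integrable fun z => heatKernel h z * ((ζ x - ζ (x - z)) * u (x - z) k) := fun k => by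
      obtain ⟨N, hN⟩ := (hc k).bdd
      refine hK.mul_bdd (c := 2 * M * N) ((aestronglyMeasurable_const.sub
        (aestronglyMeasurable_comp_sub_left hζ.perBdd.meas x)).mul
        (aestronglyMeasurable_comp_sub_left (hc k).meas x)) (Eventually.of_forall fun z => ?_)
      rw [norm_mul]
      gcongr
      · refine (norm_sub_le _ _).trans ?_
        linarith [hζ.bound x, hζ.bound (x - z)]
      · exact hN _
    have e : ∫ z, heatKernel h z * ((ζ x - ζ (x - z)) * wedge (fun x => v x - u x) u i j x z) =
        (v x - u x) j * (∫ z, heatKernel h z * ((ζ x - ζ (x - z)) * u (x - z) i)) -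
        (v x - u x) i * ∫ z, heatKernel h z * ((ζ x - ζ (x - z)) * u (x - z) j) := by
      rw [← integral_const_mul, ← integral_const_mul, ← integral_sub ((iz i).const_mul _) ((iz j).const_mul _)]
      congr 1; ext z; simp only [wedge]; ring
    rw [e]
    have hq := hu.defect_nonneg hh x
    have hr := Real.sqrt_nonneg (defect h u x)
    have hrq := Real.mul_self_sqrt hq
    have bw : ∀ k l, |(v x - u x) k * ∫ z, heatKernel h z * ((ζ x - ζ (x - z)) * u (x - z) l)| ≤
        2 * weightConst * √(defect h u x) * (M * weightConst * (√h * √(defect h u x) + h)) := fun k l => by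
      rw [abs_mul]
      gcongr
      · exact (abs_coord_le _ k).trans (norm_step_sub_le hu hv hh hstep x)
      · exact integral_mul_heatKernel_sub_le hu hh hζ l x
    refine (abs_sub _ _).trans ((add_le_add (bw j i) (bw i j)).trans (le_of_eq ?_))
    linear_combination (4 * weightConst ^ 2 * M * √h) * hrq
  rw [e3]
  refine (abs_add_le _ _).trans ?_
  rw [abs_mul, abs_of_pos (show 0 < 1 / h by positivity)]
  have e4 : 1 / h * (4 * M * weightConst ^ 2 * ∫ x in cell, (√h * defect h u x + h * √(defect h u x))) =
      4 * M * weightConst ^ 2 * ∫ x in cell, (√(defect h u x) + defect h u x / √h) := by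
    rw [← mul_assoc, mul_comm (1 / h), mul_assoc, ← integral_const_mul]
    congr 2; ext x
    have := Real.mul_self_sqrt hh.le
    field_simp
    linear_combination defect h u x * this
  have b3 : ∫ x in cell, √(defect h u x) ≤ ∫ x in cell, (√(defect h u x) + defect h u x / √h) := by
    refine integral_mono (hu.integrable_sqrt_defect hh)
      ((hu.integrable_sqrt_defect hh).add ((hu.integrable_defect hh).div_const _)) fun x => ?_
    have := hu.defect_nonneg hh x
    dsimp only
    have : 0 ≤ defect h u x / √h := by positivity
    linarith
  have b4 : 0 ≤ ∫ x in cell, √(defect h u x) := integral_nonneg fun x => Real.sqrt_nonneg _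
  calc _ ≤ M * weightConst * (∫ x in cell, √(defect h u x)) + 1 / h * (4 * M * weightConst ^ 2 *
        ∫ x in cell, (√h * defect h u x + h * √(defect h u x))) := by gcongr
    _ ≤ M * weightConst ^ 2 * (∫ x in cell, (√(defect h u x) + defect h u x / √h)) +
        4 * M * weightConst ^ 2 * ∫ x in cell, (√(defect h u x) + defect h u x / √h) := by
        rw [e4]
        gcongr
        nlinarith
    _ = _ := by ring

end

/-! ### Inner variations: commutators and Taylor expansion of the transport term. -/

lemma abs_gradKernel_half_le {h : ℝ} (hh : 0 < h) (k : Fin 3) (z : Space) :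
    |gradKernel (h / 2) k z| ≤ 3 * (‖z‖ / h * heatKernel h z) := by
  have h1 := heatKernel_pos hh z
  have h2 := heatKernel_pos (half_pos hh) z
  unfold gradKernel
  rw [abs_mul, abs_neg, abs_div, abs_of_pos h2, mul_div_cancel₀ h two_ne_zero, abs_of_pos hh]
  calc |z k| / h * heatKernel (h / 2) z ≤ ‖z‖ / h * (3 * heatKernel h z) := by
        gcongr
        · exact norm_coord_le z k
        · exact heatKernel_half_le hh z
    _ = _ := by ring

lemma abs_gradKernel_half_le_weight {h : ℝ} (hh : 0 < h) (k : Fin 3) (z : Space) :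
    |gradKernel (h / 2) k z| ≤ 3 / √h * (weight h z * heatKernel h z) := by
  have h1 := heatKernel_pos hh z
  have hs := Real.sqrt_pos.2 hh
  refine (abs_gradKernel_half_le hh k z).trans ?_
  calc 3 * (‖z‖ / h * heatKernel h z) ≤ 3 * ((√h * weight h z) / h * heatKernel h z) := by
        gcongr; exact norm_le_weight hh z
    _ = _ := by
        have := Real.mul_self_sqrt hh.le
        field_simp
        rw [pow_two, this, mul_comm]

lemma abs_gradKernel_half_mul_norm_le {h : ℝ} (hh : 0 < h) (k : Fin 3) (z : Space) :
    |gradKernel (h / 2) k z| * ‖z‖ ≤ 3 * (weight h z * heatKernel h z) := by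
  have h1 := heatKernel_pos hh z
  calc |gradKernel (h / 2) k z| * ‖z‖ ≤ 3 * (‖z‖ / h * heatKernel h z) * ‖z‖ := by
        gcongr; exact abs_gradKernel_half_le hh k z
    _ = 3 * (‖z‖ ^ 2 / h * heatKernel h z) := by ring
    _ ≤ 3 * (weight h z * heatKernel h z) := by
        gcongr
        rw [div_le_iff₀ hh, mul_comm]
        exact norm_sq_le_weight hh z

/-- Integration by parts against the heat kernel. -/
lemma integral_heatKernel_mul_pderiv {h M : ℝ} (hh : 0 < h) {f : Space → ℝ} (hf : BddC11 M f) (k : Fin 3)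
    (x : Space) : ∫ z, heatKernel h z * pderiv k f (x - z) =
      ∫ z, gradKernel h k z * (f (x - z) - f x) := by
  have hM := hf.nonneg
  have hg : ∀ z, HasFDerivAt (fun z => f (x - z) - f x) (-fderiv ℝ f (x - z)) z := fun z => by
    have := ((hf.diff (x - z)).hasFDerivAt.comp z ((hasFDerivAt_id z).const_sub x)).sub_const (f x)
    exact this.congr_fderiv (by ext; simp)
  have e1 : ∀ z, fderiv ℝ (fun z => f (x - z) - f x) z (EuclideanSpace.single k 1) =
      -pderiv k f (x - z) := fun z => by rw [(hg z).fderiv]; rfl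
  have hm : AEStronglyMeasurable (fun z => f (x - z) - f x) volume :=
    (aestronglyMeasurable_comp_sub_left hf.perBdd.meas x).sub aestronglyMeasurable_const
  have hb : ∀ z, ‖f (x - z) - f x‖ ≤ 2 * M := fun z => by
    refine (norm_sub_le _ _).trans ?_
    linarith [hf.bound x, hf.bound (x - z)]
  have key := integral_mul_fderiv_eq_neg_fderiv_mul_of_integrable (𝕜 := ℝ) (μ := (volume : Measure Space))
    (f := heatKernel h) (g := fun z => f (x - z) - f x) (v := EuclideanSpace.single k 1) ?_ ?_ ?_
    (fun z _ => (hasFDerivAt_heatKernel z).differentiableAt) (fun z _ => (hg z).differentiableAt)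
  · simp_rw [e1, ← gradKernel_eq_fderiv, mul_neg, integral_neg] at key
    linarith
  · simp_rw [← gradKernel_eq_fderiv]
    exact (integrable_gradKernel hh k).mul_bdd (c := 2 * M) hm (Eventually.of_forall hb)
  · simp_rw [e1, mul_neg]
    exact ((hf.perBdd_pderiv k).integrable_kconv (integrable_heatKernel hh) x).neg
  · exact (integrable_heatKernel hh).mul_bdd (c := 2 * M) hm (Eventually.of_forall hb)

/-- The kernel of the commutator of `G_h ∗` with `f ∂_k`. -/
def commKernel (h : ℝ) (k : Fin 3) (f : Space → ℝ) (x z : Space) : ℝ :=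
  heatKernel h z * pderiv k f (x - z) - gradKernel h k z * (f (x - z) - f x)

section

variable {u φ : Space → Plane} {h M : ℝ} {f : Space → ℝ}

lemma BddC11.integrable_gradKernel_mul_sub (hf : BddC11 M f) (hh : 0 < h) (k : Fin 3) (x : Space) :
    Integrable fun z => gradKernel h k z * (f (x - z) - f x) := by
  refine (integrable_gradKernel hh k).mul_bdd (c := 2 * M)
    ((aestronglyMeasurable_comp_sub_left hf.perBdd.meas x).sub aestronglyMeasurable_const)
    (Eventually.of_forall fun z => (_root_.norm_sub_le _ _).trans ?_)
  linarith [hf.bound x, hf.bound (x - z)]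

lemma integrable_commKernel (hh : 0 < h) (hf : BddC11 M f) (k : Fin 3) (x : Space) :
    Integrable (commKernel h k f x) :=
  ((hf.perBdd_pderiv k).integrable_kconv (integrable_heatKernel hh) x).sub
    (hf.integrable_gradKernel_mul_sub hh k x)

/-- Both halves compute ∂_k(G_h ∗ f). Having mean zero in z, the kernel sees only the increment of
whatever it is applied to. -/
lemma integral_commKernel (hh : 0 < h) (hf : BddC11 M f) (k : Fin 3) (x : Space) :
    ∫ z, commKernel h k f x z = 0 := by
  have h1 : Integrable fun z => heatKernel h z * pderiv k f (x - z) :=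
    (hf.perBdd_pderiv k).integrable_kconv (integrable_heatKernel hh) x
  unfold commKernel
  rw [integral_sub h1 (hf.integrable_gradKernel_mul_sub hh k x), integral_heatKernel_mul_pderiv hh hf,
    sub_self]

/-- The factor |z|/h of the gradient kernel meets |f(x-z)-f(x)| ≤ M|z|, so no negative power of h
survives outside the weight. -/
lemma abs_commKernel_le (hh : 0 < h) (hf : BddC11 M f) (k : Fin 3) (x z : Space) :
    |commKernel (h / 2) k f x z| ≤ 6 * M * (weight h z * heatKernel h z) := by
  have hM := hf.nonneg
  have hG := heatKernel_pos hh z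
  have hG2 := heatKernel_pos (half_pos hh) z
  have hw := one_le_weight hh z
  have b1 : |heatKernel (h / 2) z * pderiv k f (x - z)| ≤ 3 * M * (weight h z * heatKernel h z) := by
    rw [abs_mul, abs_of_pos hG2]
    calc _ ≤ (3 * heatKernel h z) * M := by
          gcongr
          · exact heatKernel_half_le hh z
          · exact hf.norm_pderiv_le k _
      _ = 3 * M * (1 * heatKernel h z) := by ring
      _ ≤ _ := by gcongr
  have b2 : |gradKernel (h / 2) k z * (f (x - z) - f x)| ≤ 3 * M * (weight h z * heatKernel h z) := by
    rw [abs_mul]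
    calc _ ≤ |gradKernel (h / 2) k z| * (M * ‖z‖) := by
          gcongr
          have := hf.norm_sub_le (x - z) x
          rwa [sub_sub_cancel_left, norm_neg] at this
      _ = M * (|gradKernel (h / 2) k z| * ‖z‖) := by ring
      _ ≤ M * (3 * (weight h z * heatKernel h z)) := by
          exact mul_le_mul_of_nonneg_left (abs_gradKernel_half_mul_norm_le hh k z) hM
      _ = _ := by ring
  refine (abs_sub _ _).trans ?_
  linarith

lemma abs_dbl_commKernel_le (hu : UnitMap u) (hφ : PerBdd φ) (hh : 0 < h) (hf : BddC11 M f) (k : Fin 3) :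
    |dbl fun x z => commKernel (h / 2) k f x z * inner ℝ (φ x) (u (x - z))| ≤
      6 * M * weightConst * ∫ x in cell, ‖φ x‖ * √(defect h u x) := by
  have hM := hf.nonneg
  have hA := weightConst_pos
  have h2 := half_pos hh
  rw [← integral_const_mul]
  have i0 : Integrable (fun x => ‖φ x‖ * √(defect h u x)) (volume.restrict cell) := by
    obtain ⟨N, hN⟩ := hφ.bdd
    exact (hu.integrable_sqrt_defect hh).bdd_mul (c := N) hφ.meas.norm.restrict
      (Eventually.of_forall fun x => by simpa using hN x)
  refine abs_dbl_le (i0.const_mul _) fun x => ?_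
  have hκ := integrable_commKernel h2 hf k x
  have i1 : Integrable fun z => commKernel (h / 2) k f x z • u (x - z) :=
    hκ.smul_bdd 1 (aestronglyMeasurable_comp_sub_left hu.meas x)
      (Eventually.of_forall fun z => (hu.unit _).le)
  have e : ∫ z, commKernel (h / 2) k f x z * inner ℝ (φ x) (u (x - z)) =
      inner ℝ (φ x) (∫ z, commKernel (h / 2) k f x z • (u (x - z) - u x)) := by
    simp_rw [smul_sub]
    rw [integral_sub i1 (hκ.smul_const _), integral_smul_const, integral_commKernel h2 hf, zero_smul,
      sub_zero, ← integral_inner i1]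
    simp_rw [inner_smul_right]
  have b := hu.norm_integral_le_sqrt_defect hh x
    (Φ := fun z => commKernel (h / 2) k f x z • (u (x - z) - u x)) (c := 6 * M) (by positivity)
    fun z => by
      rw [norm_smul, ← mul_assoc]
      gcongr
      exact abs_commKernel_le hh hf k x z
  rw [e]
  refine (abs_real_inner_le_norm _ _).trans ?_
  calc _ ≤ ‖φ x‖ * (6 * M * weightConst * √(defect h u x)) := by gcongr
    _ = _ := by ring

/-- The weak form of `-∫ (f ∂_k u) · G_h ∗ b`. -/
def transport (h : ℝ) (u : Space → Plane) (k : Fin 3) (f : Space → ℝ) (b : Space → Plane) : ℝ :=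
  (∫ x in cell, pderiv k f x * inner ℝ (u x) (heatConv h b x)) +
    ∫ x in cell, f x * inner ℝ (u x) (pderiv k (heatConv h b) x)

lemma transport_eq_dbl {b : Space → Plane} (hb : PerBdd b) (hh : 0 < h) (k : Fin 3) : transport h u k f b =
      dbl (fun x z => heatKernel h z * (pderiv k f x * inner ℝ (u x) (b (x - z)))) +
      dbl (fun x z => gradKernel h k z * (f x * inner ℝ (u x) (b (x - z)))) := by
  unfold transport
  simp_rw [pderiv_heatConv hb hh, heatConv_eq_kconv]
  rw [integral_mul_inner_kconv (integrable_heatKernel hh) _ _ hb,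
    integral_mul_inner_kconv (integrable_gradKernel hh k) _ _ hb]

lemma transport_sub (hu : PerBdd u) {a b : Space → Plane} (ha : PerBdd a) (hb : PerBdd b) (hh : 0 < h)
    (hf : BddC11 M f) (k : Fin 3) : transport h u k f (fun x => a x - b x) =
      transport h u k f a - transport h u k f b := by
  have d1 : ∀ b, PerBdd b →
      IsDominated fun x z => heatKernel h z * (pderiv k f x * inner ℝ (u x) (b (x - z))) := fun b hb =>
    ((hf.perBdd_pderiv k).pair_fst.mul (hu.pair_fst.inner hb.pair_sub)).dominated (integrable_heatKernel hh)
  have d2 : ∀ b, PerBdd b →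
      IsDominated fun x z => gradKernel h k z * (f x * inner ℝ (u x) (b (x - z))) := fun b hb =>
    (hf.perBdd.pair_fst.mul (hu.pair_fst.inner hb.pair_sub)).dominated (integrable_gradKernel hh k)
  rw [transport_eq_dbl (ha.sub hb) hh, transport_eq_dbl ha hh, transport_eq_dbl hb hh]
  have e1 := (d1 a ha).dbl_sub (d1 b hb)
  have e2 := (d2 a ha).dbl_sub (d2 b hb)
  simp_rw [inner_sub_right, mul_sub]
  rw [e1, e2]; ring

/-- Write G_h as G_{h/2} applied twice and move the outer copy onto u by exchanging x and x-z.
Oddness of the gradient kernel gives its term the opposite sign, so the added integral subtracts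
f(x) from f(x-z) and a commutator remains. -/
lemma transport_add_eq_dbl_commKernel (hu : PerBdd u) {w : Space → Plane} (hw : PerBdd w) (hh : 0 < h)
    (hf : BddC11 M f) (k : Fin 3) :
    transport h u k f w +
      ∫ x in cell, f x * inner ℝ (heatConv (h / 2) w x) (pderiv k (heatConv (h / 2) u) x) =
      dbl fun x z => commKernel (h / 2) k f x z * inner ℝ (heatConv (h / 2) w x) (u (x - z)) := by
  have h2 := half_pos hh
  have hφ := hw.heatConv h2
  have e0 : transport h u k f w = transport (h / 2) u k f (heatConv (h / 2) w) := by
    have : heatConv h w = heatConv (h / 2) (heatConv (h / 2) w) :=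
      funext fun x => (heatConv_heatConv_half hw hh x).symm
    unfold transport; rw [this]
  have d1 : IsDominated fun x z => heatKernel (h / 2) z *
      (pderiv k f x * inner ℝ (u x) (heatConv (h / 2) w (x - z))) :=
    ((hf.perBdd_pderiv k).pair_fst.mul (hu.pair_fst.inner hφ.pair_sub)).dominated (integrable_heatKernel h2)
  have d2 : IsDominated fun x z => gradKernel (h / 2) k z *
      (f x * inner ℝ (u x) (heatConv (h / 2) w (x - z))) :=
    (hf.perBdd.pair_fst.mul (hu.pair_fst.inner hφ.pair_sub)).dominated (integrable_gradKernel h2 k)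
  have d3 : IsDominated fun x z => gradKernel (h / 2) k z *
      (f x * inner ℝ (heatConv (h / 2) w x) (u (x - z))) :=
    (hf.perBdd.pair_fst.mul (hφ.pair_fst.inner hu.pair_sub)).dominated (integrable_gradKernel h2 k)
  rw [e0, transport_eq_dbl hφ h2]
  simp_rw [pderiv_heatConv hu h2]
  rw [integral_mul_inner_kconv (integrable_gradKernel h2 k) _ _ hu, dbl_swap d1, dbl_swap d2,
    ← d1.comp_swap.dbl_add d2.comp_swap, ← (d1.comp_swap.add d2.comp_swap).dbl_add d3]
  congr 1; ext x z
  simp only [commKernel, heatKernel_neg, gradKernel_neg, sub_neg_eq_add, sub_add_cancel,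
    real_inner_comm (u (x - z))]
  ring

lemma UnitMap.bddPair_norm_sq (hu : UnitMap u) : BddPair fun x z => ‖u (x - z) - u x‖ ^ 2 := by
  have := hu.perBdd.pair_sub.sub hu.perBdd.pair_fst
  simpa only [real_inner_self_eq_norm_sq] using this.inner this

/-- For unit maps u(x)·u(x-z) = 1 - ½|u(x-z)-u(x)|², and the 1 drops out because the gradient kernel
has mean zero. Its oddness then antisymmetrises f, with another factor ½. -/
lemma dbl_gradKernel_inner (hu : UnitMap u) (hh : 0 < h) (hf : BddC11 M f) (k : Fin 3) :
    dbl (fun x z => gradKernel h k z * (f x * inner ℝ (u x) (u (x - z)))) =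
      -(1 / 4) * dbl (fun x z => gradKernel h k z * ((f x - f (x - z)) * ‖u (x - z) - u x‖ ^ 2)) := by
  have hK := integrable_gradKernel hh k
  have d1 : IsDominated fun x z => gradKernel h k z * (f x * ‖u (x - z) - u x‖ ^ 2) :=
    (hf.perBdd.pair_fst.mul hu.bddPair_norm_sq).dominated hK
  have d2 : IsDominated fun x z => gradKernel h k z * (f x * 1) :=
    (hf.perBdd.pair_fst.mul (PerBdd.const 1).pair_fst).dominated hK
  have e1 : dbl (fun x z => gradKernel h k z * (f x * 1)) = 0 := by
    simp [dbl, integral_mul_const, integral_gradKernel]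
  have e2 : dbl (fun x z => gradKernel h k z * (f x * inner ℝ (u x) (u (x - z)))) =
      -(1 / 2) * dbl (fun x z => gradKernel h k z * (f x * ‖u (x - z) - u x‖ ^ 2)) := by
    have e3 := (d1.const_mul (-(1 / 2))).dbl_add d2
    rw [e1, add_zero, dbl_const_mul] at e3
    rw [← e3]
    congr 1; ext x z
    rw [hu.norm_sub_sq]; ring
  have e3 : dbl (fun x z => gradKernel h k z * (f x * ‖u (x - z) - u x‖ ^ 2)) +
      dbl (fun x z => gradKernel h k z * (f x * ‖u (x - z) - u x‖ ^ 2)) =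
      dbl (fun x z => gradKernel h k z * ((f x - f (x - z)) * ‖u (x - z) - u x‖ ^ 2)) := by
    nth_rewrite 2 [dbl_swap d1]
    rw [← d1.dbl_add d1.comp_swap]
    congr 1; ext x z
    simp only [gradKernel_neg, sub_neg_eq_add, sub_add_cancel, norm_sub_rev (u x)]; ring
  rw [e2, ← e3]; ring

lemma UnitMap.dbl_heatKernel_norm_sq (hu : UnitMap u) (hh : 0 < h) (a : Space → ℝ) :
    dbl (fun x z => heatKernel h z * (a x * ‖u (x - z) - u x‖ ^ 2)) = ∫ x in cell, a x * defect h u x := by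
  unfold dbl
  congr 1; ext x
  rw [← hu.integral_heatKernel_norm_sub_sq hh, ← integral_const_mul]
  congr 1; ext z; ring

/-- The upper bound for the local error terms. -/
def errorDensity (l h : ℝ) (u : Space → Plane) (x : Space) : ℝ :=
  l * defect h u x + 4 * weightConst / l ^ 3

lemma integrable_errorDensity (hu : UnitMap u) (hh : 0 < h) (l : ℝ) :
    Integrable (errorDensity l h u) (volume.restrict cell) :=
  ((hu.integrable_defect hh).const_mul l).add (integrable_const _)

/-- To first order f(x)-f(x-z) is Df(x)z, and z_i ∂_kG_h = -2h ∂_i∂_kG_h - δ_{ik}G_h. The δ part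
contributes +¼ of the divergence integral, while u·G_h∗u = 1 - q/2 contributes -½, hence the net -¼.
The Taylor remainder yields the factor √h. -/
lemma abs_transport_self_sub_le (hu : UnitMap u) (hh : 0 < h) (hf : BddC11 M f) (k : Fin 3) {l : ℝ}
    (hl : 0 < l) :
    |transport h u k f u - (-(1 / 4) * (∫ x in cell, pderiv k f x * defect h u x) +
      h / 2 * ∑ i, dbl fun x z => hessKernel h i k z * (pderiv i f x * ‖u (x - z) - u x‖ ^ 2))| ≤
      1 / 4 * (M * √h) * ∫ x in cell, errorDensity l h u x := by
  have hM := hf.nonneg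
  have hs := Real.sqrt_pos.2 hh
  have hK := integrable_heatKernel hh
  have hd := hu.bddPair_norm_sq
  have e1 : ∫ x in cell, pderiv k f x * inner ℝ (u x) (heatConv h u x) =
      -(1 / 2) * ∫ x in cell, pderiv k f x * defect h u x := by
    have i1 := (hf.perBdd_pderiv k).integrable_cell
    have i2 := ((hf.perBdd_pderiv k).mul (hu.perBdd_defect hh)).integrable_cell
    -- The 1 in u·G_h∗u = 1 - q/2 only contributes ∫ ∂_k f = 0.
    rw [← integral_const_mul, ← add_zero (∫ x in cell, -(1 / 2) * _), ← hf.integral_pderiv k,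
      ← integral_add (i2.const_mul _) i1]
    congr 1; ext x
    simp only [defect]; ring
  have d1 : ∀ i ∈ Finset.univ, IsDominated fun x z =>
      hessKernel h i k z * (pderiv i f x * ‖u (x - z) - u x‖ ^ 2) := fun i _ =>
    ((hf.perBdd_pderiv i).pair_fst.mul hd).dominated (integrable_hessKernel hh i k)
  have d2 : IsDominated fun x z => heatKernel h z * (pderiv k f x * ‖u (x - z) - u x‖ ^ 2) :=
    ((hf.perBdd_pderiv k).pair_fst.mul hd).dominated hK
  have d3 : IsDominated fun x z => gradKernel h k z * ((f x - f (x - z)) * ‖u (x - z) - u x‖ ^ 2) :=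
    ((hf.perBdd.pair_fst.sub hf.perBdd.pair_sub).mul hd).dominated (integrable_gradKernel hh k)
  have e2 : transport h u k f u - (-(1 / 4) * (∫ x in cell, pderiv k f x * defect h u x) +
      h / 2 * ∑ i, dbl fun x z => hessKernel h i k z * (pderiv i f x * ‖u (x - z) - u x‖ ^ 2)) =
      -(1 / 4) * dbl (fun x z => gradKernel h k z * ((f x - f (x - z)) * ‖u (x - z) - u x‖ ^ 2) +
        (2 * h * ∑ i, hessKernel h i k z * (pderiv i f x * ‖u (x - z) - u x‖ ^ 2) +
        heatKernel h z * (pderiv k f x * ‖u (x - z) - u x‖ ^ 2))) := by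
    have e3 : transport h u k f u = (∫ x in cell, pderiv k f x * inner ℝ (u x) (heatConv h u x)) +
        dbl (fun x z => gradKernel h k z * (f x * inner ℝ (u x) (u (x - z)))) := by
      unfold transport
      simp_rw [pderiv_heatConv hu.perBdd hh]
      rw [integral_mul_inner_kconv (integrable_gradKernel hh k) _ _ hu.perBdd]
    rw [d3.dbl_add (((IsDominated.sum d1).const_mul _).add d2), ((IsDominated.sum d1).const_mul _).dbl_add d2,
      dbl_const_mul, IsDominated.dbl_sum d1, hu.dbl_heatKernel_norm_sq hh, e3, e1, dbl_gradKernel_inner hu hh hf]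
    ring
  rw [e2, abs_mul, abs_neg, abs_of_pos (show (0 : ℝ) < 1 / 4 by norm_num), mul_assoc]
  gcongr
  rw [← integral_const_mul]
  refine abs_dbl_le ((integrable_errorDensity hu hh l).const_mul _) fun x => ?_
  rw [← Real.norm_eq_abs]
  refine hu.norm_integral_le_defect hh x (by positivity) hl fun z => ?_
  have hG := heatKernel_pos hh z
  have hw := one_le_weight hh z
  have e4 : 2 * h * ∑ i, hessKernel h i k z * (pderiv i f x * ‖u (x - z) - u x‖ ^ 2) +
        heatKernel h z * (pderiv k f x * ‖u (x - z) - u x‖ ^ 2) =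
        -(gradKernel h k z * fderiv ℝ f x z * ‖u (x - z) - u x‖ ^ 2) := by
    have e5 : heatKernel h z * (pderiv k f x * ‖u (x - z) - u x‖ ^ 2) =
        ∑ i, (if i = k then heatKernel h z * (pderiv i f x * ‖u (x - z) - u x‖ ^ 2) else 0) := by simp
    rw [e5, BddC11.fderiv_apply, Finset.mul_sum, Finset.mul_sum, Finset.sum_mul, ← Finset.sum_add_distrib,
      ← Finset.sum_neg_distrib]
    refine Finset.sum_congr rfl fun i _ => ?_
    simp only [hessKernel, gradKernel, smul_eq_mul]
    split_ifs
    · field_simp; ring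
    · field_simp; ring
  rw [e4, show gradKernel h k z * ((f x - f (x - z)) * ‖u (x - z) - u x‖ ^ 2) +
    -(gradKernel h k z * fderiv ℝ f x z * ‖u (x - z) - u x‖ ^ 2) =
    gradKernel h k z * (f x - f (x - z) - fderiv ℝ f x z) * ‖u (x - z) - u x‖ ^ 2 by ring, norm_mul, norm_mul,
    norm_pow, norm_norm]
  calc _ ≤ (1 / √h * (weight h z * heatKernel h z)) * (M * (h * weight h z)) * ‖u (x - z) - u x‖ ^ 2 := by
        gcongr
        · exact abs_gradKernel_le hh k z
        · refine (hf.taylor x z).trans ?_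
          gcongr
          exact norm_sq_le_weight hh z
    _ = _ := by
        have := Real.mul_self_sqrt hh.le
        field_simp
        linear_combination (-(M * ‖u (x - z) - u x‖ ^ 2)) * this

end

/-! ### Inner variations: stress terms and the estimate at a fixed time. -/

section

variable {u v : Space → Plane} {h M l : ℝ} {f : Space → ℝ}

lemma kconv_gradKernel_eq (hu : UnitMap u) (hh : 0 < h) (k : Fin 3) (x : Space) :
    kconv (gradKernel h k) u x = ∫ z, gradKernel h k z • (u (x - z) - u x) := by
  simp_rw [smul_sub]
  rw [integral_sub (hu.perBdd.integrable_kconv (integrable_gradKernel hh k) x)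
    ((integrable_gradKernel hh k).smul_const _), integral_smul_const, integral_gradKernel, zero_smul, sub_zero]
  rfl

lemma norm_kconv_gradKernel_half_le (hu : UnitMap u) (hh : 0 < h) (k : Fin 3) (x : Space) :
    ‖kconv (gradKernel (h / 2) k) u x‖ ≤ 3 / √h * weightConst * √(defect h u x) := by
  rw [kconv_gradKernel_eq hu (half_pos hh)]
  refine hu.norm_integral_le_sqrt_defect hh x (by positivity) fun z => ?_
  rw [norm_smul, ← mul_assoc]
  gcongr
  exact abs_gradKernel_half_le_weight hh k z

/-- Discrete counterpart of u·∂_k u = 0 for |u| = 1: the product equals -½∫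
∂_kG_{h/2}(z)|u(x-z)-u(x)|² dz, quadratic rather than linear in the increments. -/
lemma abs_inner_kconv_gradKernel_half_le (hu : UnitMap u) (hh : 0 < h) (k : Fin 3) (x : Space) (hl : 0 < l) :
    |inner ℝ (kconv (gradKernel (h / 2) k) u x) (u x)| ≤ 3 / 2 / √h * errorDensity l h u x := by
  have h2 := half_pos hh
  have e : inner ℝ (kconv (gradKernel (h / 2) k) u x) (u x) =
      ∫ z, -(1 / 2) * (gradKernel (h / 2) k z * ‖u (x - z) - u x‖ ^ 2) := by
    have h1 : ∀ z, -(1 / 2) * (gradKernel (h / 2) k z * ‖u (x - z) - u x‖ ^ 2) =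
        inner ℝ (u x) (gradKernel (h / 2) k z • u (x - z)) - gradKernel (h / 2) k z := fun z => by
      rw [hu.norm_sub_sq, inner_smul_right]; ring
    have i1 := hu.perBdd.integrable_kconv (integrable_gradKernel h2 k) x
    simp_rw [h1]
    rw [integral_sub (i1.const_inner _) (integrable_gradKernel h2 k), integral_gradKernel, sub_zero,
      integral_inner i1, real_inner_comm]
    rfl
  rw [e, ← Real.norm_eq_abs]
  refine hu.norm_integral_le_defect hh x (by positivity) hl fun z => ?_
  have hG := heatKernel_pos hh z
  have hw := one_le_weight hh z
  rw [norm_mul, norm_mul, norm_pow, norm_norm]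
  calc _ = 1 / 2 * (|gradKernel (h / 2) k z| * ‖u (x - z) - u x‖ ^ 2) := by norm_num
    _ ≤ 1 / 2 * ((3 / √h * (weight h z ^ 1 * heatKernel h z)) * ‖u (x - z) - u x‖ ^ 2) := by
        gcongr
        rw [pow_one]
        exact abs_gradKernel_half_le_weight hh k z
    _ ≤ 1 / 2 * ((3 / √h * (weight h z ^ 2 * heatKernel h z)) * ‖u (x - z) - u x‖ ^ 2) := by
        gcongr
        norm_num
    _ = _ := by ring

lemma defect_le_errorDensity (hu : UnitMap u) (hh : 0 < h) (hl : 1 ≤ l) (x : Space) :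
    defect h u x ≤ errorDensity l h u x := by
  have hq := hu.defect_nonneg hh x
  have := weightConst_pos
  have : 0 ≤ 4 * weightConst / l ^ 3 := by positivity
  unfold errorDensity
  nlinarith

/-- The quadratic form with kernel `∂_i ∂_j G_h` is the Dirichlet-type form of `G_{h/2} ∗ u` up to a small
error. -/
lemma abs_dbl_hessKernel_sub_le (hu : UnitMap u) (hh : 0 < h) (hf : PerBdd f) (hb : ∀ x, |f x| ≤ M)
    (hlip : ∀ x y, |f x - f y| ≤ M * ‖x - y‖) (i j : Fin 3) (hl : 1 ≤ l) :
    |dbl (fun x z => hessKernel h i j z * (f x * ‖u (x - z) - u x‖ ^ 2)) -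
      2 * ∫ x in cell, f x * inner ℝ (pderiv i (heatConv (h / 2) u) x) (pderiv j (heatConv (h / 2) u) x)| ≤
      28 * M * weightConst ^ 2 / √h * ∫ x in cell, errorDensity l h u x := by
  have hM : 0 ≤ M := (abs_nonneg _).trans (hb 0)
  have hs := Real.sqrt_pos.2 hh
  have hA := one_le_weightConst
  have h2 := half_pos hh
  have hK := integrable_hessKernel hh i j
  have hg := integrable_gradKernel h2
  have hur := hu.perBdd
  have hp : PerBdd (kconv (gradKernel (h / 2) j) u) := hur.kconv (hg j)
  have d1 : IsDominated fun x z => hessKernel h i j z * (f x * inner ℝ (u x) (u (x - z))) :=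
    (hf.pair_fst.mul (hur.pair_fst.inner hur.pair_sub)).dominated hK
  have d2 : IsDominated fun x z => hessKernel h i j z * (f x * 1) :=
    (hf.pair_fst.mul (PerBdd.const 1).pair_fst).dominated hK
  have d3 : IsDominated fun x z => gradKernel (h / 2) i z *
      (f x * inner ℝ (u x) (kconv (gradKernel (h / 2) j) u (x - z))) :=
    (hf.pair_fst.mul (hur.pair_fst.inner hp.pair_sub)).dominated (hg i)
  have d4 : IsDominated fun x z => gradKernel (h / 2) i z *
      (f x * inner ℝ (kconv (gradKernel (h / 2) j) u x) (u (x - z))) :=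
    (hf.pair_fst.mul (hp.pair_fst.inner hur.pair_sub)).dominated (hg i)
  have z2 : dbl (fun x z => hessKernel h i j z * (f x * 1)) = 0 := by
    simp [dbl, integral_mul_const, integral_hessKernel hh]
  have e1 : dbl (fun x z => hessKernel h i j z * (f x * ‖u (x - z) - u x‖ ^ 2)) =
      -2 * dbl (fun x z => hessKernel h i j z * (f x * inner ℝ (u x) (u (x - z)))) := by
    have h1 := (d2.const_mul 2).dbl_sub (d1.const_mul 2)
    rw [dbl_const_mul, dbl_const_mul, z2, mul_zero, zero_sub, ← neg_mul] at h1
    rw [← h1]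
    congr 1; ext x z
    rw [hu.norm_sub_sq]; ring
  have e2 : dbl (fun x z => hessKernel h i j z * (f x * inner ℝ (u x) (u (x - z)))) =
      dbl (fun x z => gradKernel (h / 2) i z *
        (f x * inner ℝ (u x) (kconv (gradKernel (h / 2) j) u (x - z)))) := by
    rw [← integral_mul_inner_kconv hK f u hur, ← integral_mul_inner_kconv (hg i) f u hp]
    simp_rw [kconv_gradKernel_gradKernel hur hh]
  have e3 : ∫ x in cell, f x * inner ℝ (pderiv i (heatConv (h / 2) u) x) (pderiv j (heatConv (h / 2) u) x) =
      dbl (fun x z => gradKernel (h / 2) i z *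
        (f x * inner ℝ (kconv (gradKernel (h / 2) j) u x) (u (x - z)))) := by
    rw [← integral_mul_inner_kconv (hg i) f _ hur]
    simp_rw [pderiv_heatConv hur h2, real_inner_comm]
  -- Moving ∂_iG_{h/2} ∗ to the other factor past f leaves a commutator with f(x-z) - f(x), which
  -- compensates the singular factor of the gradient kernel.
  have e4 : dbl (fun x z => hessKernel h i j z * (f x * ‖u (x - z) - u x‖ ^ 2)) -
      2 * (∫ x in cell, f x * inner ℝ (pderiv i (heatConv (h / 2) u) x) (pderiv j (heatConv (h / 2) u) x)) =
      2 * dbl (fun x z => gradKernel (h / 2) i z * (f (x - z) - f x) *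
        inner ℝ (kconv (gradKernel (h / 2) j) u x) (u (x - z))) := by
    rw [e1, e2, e3, dbl_swap d3]
    have h1 := (d3.comp_swap.const_mul (-1)).dbl_sub d4
    rw [dbl_const_mul] at h1
    rw [neg_mul, ← mul_neg, ← mul_sub, ← neg_one_mul (dbl _), ← h1]
    congr 2; ext x z
    simp only [gradKernel_neg, sub_neg_eq_add, sub_add_cancel, real_inner_comm (u (x - z))]
    ring
  rw [e4, abs_mul, abs_of_pos (show (0 : ℝ) < 2 by norm_num)]
  have key : |dbl (fun x z => gradKernel (h / 2) i z * (f (x - z) - f x) *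
        inner ℝ (kconv (gradKernel (h / 2) j) u x) (u (x - z)))| ≤
        14 * M * weightConst ^ 2 / √h * ∫ x in cell, errorDensity l h u x := by
    rw [← integral_const_mul]
    refine abs_dbl_le ((integrable_errorDensity hu hh l).const_mul _) fun x => ?_
    have hk : Integrable fun z => gradKernel (h / 2) i z * (f (x - z) - f x) := by
      refine (hg i).mul_bdd (c := 2 * M)
        ((aestronglyMeasurable_comp_sub_left hf.meas x).sub aestronglyMeasurable_const)
        (Eventually.of_forall fun z => (norm_sub_le _ _).trans ?_)
      have := hb x
      have := hb (x - z)
      simp only [Real.norm_eq_abs]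
      linarith
    have bk : ∀ z, |gradKernel (h / 2) i z * (f (x - z) - f x)| ≤ 3 * M * (weight h z * heatKernel h z) :=
      fun z => by
        rw [abs_mul]
        calc _ ≤ |gradKernel (h / 2) i z| * (M * ‖z‖) := by
              gcongr
              have := hlip (x - z) x
              rwa [sub_sub_cancel_left, norm_neg] at this
          _ = M * (|gradKernel (h / 2) i z| * ‖z‖) := by ring
          _ ≤ M * (3 * (weight h z * heatKernel h z)) :=
              mul_le_mul_of_nonneg_left (abs_gradKernel_half_mul_norm_le hh i z) hM
          _ = _ := by ring
    have i1 : Integrable fun z => (gradKernel (h / 2) i z * (f (x - z) - f x)) • u (x - z) :=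
      hk.smul_bdd 1 (aestronglyMeasurable_comp_sub_left hu.meas x)
        (Eventually.of_forall fun z => (hu.unit _).le)
    set p := kconv (gradKernel (h / 2) j) u x with hpdef
    -- The increment of u supplies a second √q besides the one in p. The u(x) part enters only
    -- through p·u(x), quadratically small by the unit constraint.
    have e : ∫ z, gradKernel (h / 2) i z * (f (x - z) - f x) * inner ℝ p (u (x - z)) =
        inner ℝ p (∫ z, (gradKernel (h / 2) i z * (f (x - z) - f x)) • (u (x - z) - u x)) +
        inner ℝ p (u x) * ∫ z, gradKernel (h / 2) i z * (f (x - z) - f x) := by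
      simp_rw [smul_sub]
      rw [integral_sub i1 (hk.smul_const _), integral_smul_const, inner_sub_right, inner_smul_right,
        ← integral_inner i1]
      simp_rw [inner_smul_right]
      ring
    have b1 := hu.norm_integral_le_sqrt_defect hh x
      (Φ := fun z => (gradKernel (h / 2) i z * (f (x - z) - f x)) • (u (x - z) - u x)) (c := 3 * M)
      (by positivity) fun z => by
        rw [norm_smul, ← mul_assoc]
        gcongr
        exact bk z
    have b2 : |∫ z, gradKernel (h / 2) i z * (f (x - z) - f x)| ≤ 3 * M * weightConst := by
      have i4 := (integrable_weight_pow_mul_heatKernel hh (n := 1) (by norm_num)).const_mul (3 * M)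
      rw [← Real.norm_eq_abs]
      refine (norm_integral_le_of_norm_le i4 (Eventually.of_forall fun z => ?_)).trans ?_
      · rw [pow_one]; exact bk z
      · rw [integral_const_mul]
        gcongr
        exact integral_weight_pow_mul_heatKernel_le hh (by norm_num)
    have b3 := norm_kconv_gradKernel_half_le hu hh j x
    have b4 := abs_inner_kconv_gradKernel_half_le hu hh j x (l := l) (by linarith)
    rw [← hpdef] at b3 b4
    have hq := hu.defect_nonneg hh x
    have hqe := defect_le_errorDensity hu hh hl x
    have hr := Real.mul_self_sqrt hq
    have c1 : |inner ℝ p (∫ z, (gradKernel (h / 2) i z * (f (x - z) - f x)) • (u (x - z) - u x))| ≤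
        9 * M * weightConst ^ 2 / √h * errorDensity l h u x := by
      refine (abs_real_inner_le_norm _ _).trans ?_
      calc _ ≤ (3 / √h * weightConst * √(defect h u x)) * (3 * M * weightConst * √(defect h u x)) := by
            gcongr
        _ = 9 * M * weightConst ^ 2 / √h * (√(defect h u x) * √(defect h u x)) := by ring
        _ ≤ _ := by rw [hr]; gcongr
    have c2 : |inner ℝ p (u x) * ∫ z, gradKernel (h / 2) i z * (f (x - z) - f x)| ≤
        5 * M * weightConst ^ 2 / √h * errorDensity l h u x := by
      have hE : 0 ≤ errorDensity l h u x := hq.trans hqe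
      rw [abs_mul]
      calc _ ≤ (3 / 2 / √h * errorDensity l h u x) * (3 * M * weightConst) := by gcongr
        _ = 9 / 2 * M * weightConst ^ 1 / √h * errorDensity l h u x := by ring
        _ ≤ _ := by
            gcongr
            · norm_num
            · norm_num
    rw [e]
    refine (abs_add_le _ _).trans ((add_le_add c1 c2).trans (le_of_eq ?_))
    ring
  calc _ ≤ 2 * (14 * M * weightConst ^ 2 / √h * ∫ x in cell, errorDensity l h u x) := by gcongr
    _ = _ := by ring

/-- Left-hand side of the inner variation at a fixed time. -/
def innerLeft (h : ℝ) (u v : Space → Plane) (ξ : Space → Space) : ℝ :=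
  ∫ x in cell, inner ℝ (heatConv (h / 2) (fun y => h⁻¹ • (u y - v y)) x)
    (∑ k : Fin 3, ξ x k • pderiv k (heatConv (h / 2) u) x)

/-- Divergence part of the inner variation at a fixed time. -/
def innerDiv (h : ℝ) (u : Space → Plane) (ξ : Space → Space) : ℝ :=
  ∫ x in cell, divergence ξ x * (1 - inner ℝ (u x) (heatConv h u x))

/-- Stress part of the inner variation at a fixed time. -/
def innerStress (h : ℝ) (u : Space → Plane) (ξ : Space → Space) (i j : Fin 3) : ℝ :=
  ∫ x in cell, pderiv i ξ x j * inner ℝ (pderiv i (heatConv (h / 2) u) x) (pderiv j (heatConv (h / 2) u) x)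

lemma pderiv_coord {ξ : Space → Space} (hξ : Differentiable ℝ ξ) (i k : Fin 3) (x : Space) :
    pderiv i (fun y => ξ y k) x = pderiv i ξ x k := by
  unfold pderiv
  have : HasFDerivAt (fun y => ξ y k) ((EuclideanSpace.proj k : Space →L[ℝ] ℝ).comp (fderiv ℝ ξ x)) x :=
    (EuclideanSpace.proj k : Space →L[ℝ] ℝ).hasFDerivAt.comp x (hξ x).hasFDerivAt
  rw [this.fderiv]
  rfl

lemma norm_proj_le (k : Fin 3) : ‖(EuclideanSpace.proj k : Space →L[ℝ] ℝ)‖ ≤ 1 :=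
  ContinuousLinearMap.opNorm_le_bound _ zero_le_one fun z => by
    rw [one_mul]; exact norm_coord_le z k

lemma BddC11.coord {ξ : Space → Space} (hξ : BddC11 M ξ) (k : Fin 3) : BddC11 M fun x => ξ x k := by
  have hd : ∀ x, fderiv ℝ (fun x => ξ x k) x =
      (EuclideanSpace.proj k : Space →L[ℝ] ℝ).comp (fderiv ℝ ξ x) := fun x =>
    ((EuclideanSpace.proj k : Space →L[ℝ] ℝ).hasFDerivAt.comp x (hξ.diff x).hasFDerivAt).fderiv
  have hn : ∀ L : Space →L[ℝ] Space, ‖(EuclideanSpace.proj k : Space →L[ℝ] ℝ).comp L‖ ≤ ‖L‖ := fun L => by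
    refine (ContinuousLinearMap.opNorm_comp_le _ _).trans ?_
    have := norm_proj_le k
    nlinarith [norm_nonneg L]
  exact
  { per := hξ.per.comp fun y : Space => y k
    diff := fun x => ((EuclideanSpace.proj k : Space →L[ℝ] ℝ).hasFDerivAt.comp x
      (hξ.diff x).hasFDerivAt).differentiableAt
    bound := fun x => (norm_coord_le _ k).trans (hξ.bound x)
    bound_fderiv := fun x => by rw [hd]; exact (hn _).trans (hξ.bound_fderiv x)
    lip_fderiv := fun x y => by
      rw [hd, hd, ← ContinuousLinearMap.comp_sub]; exact (hn _).trans (hξ.lip_fderiv x y) }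

/-- The inner variation at a fixed time, given the Euler–Lagrange equation of the scheme. -/
lemma abs_inner_variation_le (hu : UnitMap u) (hv : UnitMap v) (hh : 0 < h) {ξ : Space → Space}
    (hξ : BddC11 M ξ) (hl : 1 ≤ l)
    (hEL : ∑ k, transport h u k (fun x => ξ x k) v = 0) :
    |2 * innerLeft h u v ξ - (1 / h * innerDiv h u ξ - 2 * ∑ i, ∑ j, innerStress h u ξ i j)| ≤
      36 * M * weightConst / h *
        (∫ x in cell, ‖heatConv (h / 2) (fun y => u y - v y) x‖ * √(defect h u x)) +
      254 * M * weightConst ^ 2 / √h * ∫ x in cell, errorDensity l h u x := by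
  have hM := hξ.nonneg
  have hs := Real.sqrt_pos.2 hh
  have hA := one_le_weightConst
  have h2 := half_pos hh
  have hur := hu.perBdd
  have hvr := hv.perBdd
  have hw : PerBdd fun x => u x - v x := hur.sub hvr
  have hφ := hw.heatConv h2
  have hX := hξ.coord
  set X : Fin 3 → Space → ℝ := fun k x => ξ x k with hXdef
  set Q := ∫ x in cell, errorDensity l h u x with hQ
  set P := ∫ x in cell, ‖heatConv (h / 2) (fun y => u y - v y) x‖ * √(defect h u x) with hP
  have hQ0 : 0 ≤ Q := integral_nonneg fun x => (hu.defect_nonneg hh x).trans (defect_le_errorDensity hu hh hl x)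
  have hpd : ∀ k, pderiv k (heatConv (h / 2) u) = kconv (gradKernel (h / 2) k) u := fun k =>
    funext fun x => pderiv_heatConv hur h2 k x
  have hpb : ∀ k, PerBdd (pderiv k (heatConv (h / 2) u)) := fun k => by
    rw [hpd]; exact hur.kconv (integrable_gradKernel h2 k)
  let J : Fin 3 → ℝ := fun k => ∫ x in cell, X k x *
    inner ℝ (heatConv (h / 2) (fun y => u y - v y) x) (pderiv k (heatConv (h / 2) u) x)
  have eL : innerLeft h u v ξ = h⁻¹ * ∑ k, J k := by
    have i1 : ∀ k ∈ Finset.univ, Integrable (fun x => X k x *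
        inner ℝ (heatConv (h / 2) (fun y => u y - v y) x) (pderiv k (heatConv (h / 2) u) x))
        (volume.restrict cell) := fun k _ => ((hX k).perBdd.mul (hφ.inner (hpb k))).integrable_cell
    rw [← integral_finsetSum _ i1, ← integral_const_mul]
    unfold innerLeft
    congr 1; ext x
    rw [heatConv_eq_kconv, kconv_const_smul, inner_smul_left, inner_sum]
    simp_rw [inner_smul_right]
    rfl
  have eD : innerDiv h u ξ = ∑ k, 1 / 2 * ∫ x in cell, pderiv k (X k) x * defect h u x := by
    simp_rw [← integral_const_mul]
    rw [← integral_finsetSum _ fun k _ =>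
      (((hX k).perBdd_pderiv k).mul (hu.perBdd_defect hh)).integrable_cell.const_mul _]
    unfold innerDiv divergence
    congr 1; ext x
    rw [Finset.sum_mul]
    refine Finset.sum_congr rfl fun k _ => ?_
    rw [pderiv_coord hξ.diff]
    unfold defect; ring
  have eS : ∀ i j, innerStress h u ξ i j = ∫ x in cell, pderiv i (X j) x *
      inner ℝ (pderiv i (heatConv (h / 2) u) x) (pderiv j (heatConv (h / 2) u) x) := fun i j => by
    unfold innerStress
    congr 1; ext x
    rw [hXdef, pderiv_coord hξ.diff]
  let H : Fin 3 → Fin 3 → ℝ := fun i k =>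
    dbl fun x z => hessKernel h i k z * (pderiv i (X k) x * ‖u (x - z) - u x‖ ^ 2)
  have bI : ∀ k, |transport h u k (X k) (fun x => u x - v x) + J k| ≤ 6 * M * weightConst * P := fun k => by
    rw [transport_add_eq_dbl_commKernel hur hw hh (hX k)]
    exact abs_dbl_commKernel_le hu hφ hh (hX k) k
  have bII : ∀ k, |transport h u k (X k) u - (-(1 / 4) * (∫ x in cell, pderiv k (X k) x * defect h u x) +
      h / 2 * ∑ i, H i k)| ≤ 1 / 4 * (M * √h) * Q := fun k =>
    abs_transport_self_sub_le hu hh (hX k) k (by linarith)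
  have bIII : ∀ i k, |H i k - 2 * innerStress h u ξ i k| ≤ 28 * M * weightConst ^ 2 / √h * Q := fun i k => by
    rw [eS]
    exact abs_dbl_hessKernel_sub_le hu hh ((hX k).perBdd_pderiv i) ((hX k).norm_pderiv_le i)
      ((hX k).norm_pderiv_sub_le i) i k hl
  have hEL' : ∑ k, transport h u k (X k) u = ∑ k, transport h u k (X k) (fun x => u x - v x) := by
    have : ∀ k, transport h u k (X k) (fun x => u x - v x) =
        transport h u k (X k) u - transport h u k (X k) v := fun k => transport_sub hur hur hvr hh (hX k) k
    simp_rw [this]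
    rw [Finset.sum_sub_distrib, hEL, sub_zero]
  -- The discrepancy is the sum of three errors: the commutator, the Taylor remainder, and the
  -- replacement of Hessian forms by stresses.
  have eT : 2 * innerLeft h u v ξ - (1 / h * innerDiv h u ξ - 2 * ∑ i, ∑ j, innerStress h u ξ i j) =
      ∑ k, (2 / h * (transport h u k (X k) (fun x => u x - v x) + J k) -
        2 / h * (transport h u k (X k) u - (-(1 / 4) * (∫ x in cell, pderiv k (X k) x * defect h u x) +
          h / 2 * ∑ i, H i k)) - ∑ i, (H i k - 2 * innerStress h u ξ i k)) := by
    rw [eL, eD, Finset.sum_comm]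
    simp only [Finset.sum_sub_distrib, mul_add, mul_sub, Finset.sum_add_distrib, ← Finset.mul_sum, hEL']
    field_simp
    ring
  rw [eT]
  have bk : ∀ k, |2 / h * (transport h u k (X k) (fun x => u x - v x) + J k) -
        2 / h * (transport h u k (X k) u - (-(1 / 4) * (∫ x in cell, pderiv k (X k) x * defect h u x) +
          h / 2 * ∑ i, H i k)) - ∑ i, (H i k - 2 * innerStress h u ξ i k)| ≤
      2 / h * (6 * M * weightConst * P) + 2 / h * (1 / 4 * (M * √h) * Q) +
        3 * (28 * M * weightConst ^ 2 / √h * Q) := fun k => by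
    refine (abs_sub _ _).trans (add_le_add ((abs_sub _ _).trans (add_le_add ?_ ?_)) ?_)
    · rw [abs_mul, abs_of_pos (show 0 < 2 / h by positivity)]
      exact mul_le_mul_of_nonneg_left (bI k) (by positivity)
    · rw [abs_mul, abs_of_pos (show 0 < 2 / h by positivity)]
      exact mul_le_mul_of_nonneg_left (bII k) (by positivity)
    · refine (Finset.abs_sum_le_sum_abs _ _).trans ((Finset.sum_le_sum fun i _ => bIII i k).trans ?_)
      simp
  refine (Finset.abs_sum_le_sum_abs _ _).trans ((Finset.sum_le_sum fun k _ => bk k).trans ?_)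
  have e5 : 2 / h * (1 / 4 * (M * √h) * Q) = 1 / 2 * M / √h * Q := by
    have := Real.mul_self_sqrt hh.le
    field_simp
    linear_combination 4 * M * Q * this
  have e6 : M / √h * Q ≤ M * weightConst ^ 2 / √h * Q := by
    have : M * 1 ≤ M * weightConst ^ 2 := by gcongr; nlinarith
    rw [mul_one] at this
    gcongr
  rw [e5]
  simp only [Finset.sum_const, Finset.card_univ, Fintype.card_fin, nsmul_eq_mul]
  have e7 : ((3 : ℕ) : ℝ) * (2 / h * (6 * M * weightConst * P) + 1 / 2 * M / √h * Q +
      3 * (28 * M * weightConst ^ 2 / √h * Q)) = 36 * M * weightConst / h * P +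
      (3 / 2 * (M / √h * Q) + 252 * (M * weightConst ^ 2 / √h * Q)) := by push_cast; ring
  have e8 : 254 * M * weightConst ^ 2 / √h * Q = 254 * (M * weightConst ^ 2 / √h * Q) := by ring
  have e9 : 0 ≤ M * weightConst ^ 2 / √h * Q := by positivity
  rw [e7, e8]
  linarith

end

/-! ### One thresholding step: Euler–Lagrange equation and energy dissipation. -/

section

variable {u v : Space → Plane} {h M : ℝ} {f : Space → ℝ}

/-- `u` is obtained from `v` by one thresholding step, at every point. -/
def IsStep (h : ℝ) (v u : Space → Plane) : Prop :=
  ∀ x, heatConv h v x ≠ 0 → u x = (‖heatConv h v x‖)⁻¹ • heatConv h v x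

lemma IsStep.inner_eq_norm (hs : IsStep h v u) (x : Space) :
    inner ℝ (u x) (heatConv h v x) = ‖heatConv h v x‖ := by
  by_cases h0 : heatConv h v x = 0
  · simp [h0]
  · rw [hs x h0, inner_smul_left, real_inner_self_eq_norm_sq]
    have := norm_ne_zero_iff.2 h0
    simp; field_simp

lemma IsStep.mul_eq_mul (hs : IsStep h v u) (x : Space) (i j : Fin 2) :
    u x j * heatConv h v x i = u x i * heatConv h v x j := by
  by_cases h0 : heatConv h v x = 0
  · rw [h0]; simp
  · rw [hs x h0]; simp; ring

/-- A zero of V minimises |V|, so the derivative of |V| vanishes there and V itself is o of the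
displacement. This covers the zeros of the heat flow, where the new map is arbitrary. -/
lemma hasFDerivAt_zero_of_norm {V : Space → Plane} {x : Space} (h0 : V x = 0)
    (hn : DifferentiableAt ℝ (fun y => ‖V y‖) x) : HasFDerivAt V (0 : Space →L[ℝ] Plane) x := by
  have hmin : IsLocalMin (fun y => ‖V y‖) x := Eventually.of_forall fun y => by
    simp [h0]
  have h1 := hn.hasFDerivAt
  rw [hmin.fderiv_eq_zero, hasFDerivAt_iff_isLittleO] at h1
  rw [hasFDerivAt_iff_isLittleO]
  simpa [h0] using h1

/-- The Euler–Lagrange equation of a thresholding step with respect to inner variations. -/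
lemma IsStep.transport_eq_zero (hs : IsStep h v u) (hv : PerBdd v) (hh : 0 < h) (hf : BddC11 M f)
    (hu : PerBdd u) (k : Fin 3) : transport h u k f v = 0 := by
  have hV := hv.heatConv hh
  obtain ⟨C, hC⟩ := hV.bdd
  obtain ⟨K, hK⟩ := lipschitzWith_heatConv hv hh
  have hM := hf.nonneg
  have hC0 : 0 ≤ C := (norm_nonneg _).trans (hC 0)
  have hn : LipschitzWith K fun x => ‖heatConv h v x‖ := by
    have := lipschitzWith_one_norm.comp hK
    rwa [one_mul] at this
  have hl : LipschitzWith (M * K + C * M).toNNReal fun x => f x * ‖heatConv h v x‖ :=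
    LipschitzWith.of_dist_le_mul fun x y => by
      rw [dist_eq_norm, dist_eq_norm, Real.coe_toNNReal _ (by positivity)]
      have e : f x * ‖heatConv h v x‖ - f y * ‖heatConv h v y‖ =
        f x * (‖heatConv h v x‖ - ‖heatConv h v y‖) + ‖heatConv h v y‖ * (f x - f y) := by ring
      have b1 : ‖f x * (‖heatConv h v x‖ - ‖heatConv h v y‖)‖ ≤ M * (K * ‖x - y‖) := by
        rw [norm_mul]
        gcongr
        · exact hf.bound x
        · simpa [dist_eq_norm] using hn.dist_le_mul x y
      have b2 : ‖‖heatConv h v y‖ * (f x - f y)‖ ≤ C * (M * ‖x - y‖) := by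
        rw [norm_mul, norm_norm]
        gcongr
        · exact hC y
        · exact hf.norm_sub_le x y
      rw [e]
      refine (norm_add_le _ _).trans ((add_le_add b1 b2).trans (le_of_eq ?_))
      ring
  have hper : PeriodicZ3 fun x => f x * ‖heatConv h v x‖ := hf.per.comp₂ hV.per fun a b => a * ‖b‖
  -- Since u·(G_h∗v) = |G_h∗v|, the integrand is almost everywhere the derivative of f|G_h∗v|, by
  -- Rademacher's theorem. No regularity of u is used.
  have key := hper.integral_lineDeriv_eq_zero hl (v := EuclideanSpace.single k 1)
    (f' := fun x => pderiv k f x * inner ℝ (u x) (heatConv h v x) +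
      f x * inner ℝ (u x) (pderiv k (heatConv h v) x)) (by
    filter_upwards [hn.ae_differentiableAt] with x hx
    have hVd := (hasFDerivAt_heatConv hv hh x).differentiableAt
    have h1 := ((hf.diff x).hasFDerivAt.mul hx.hasFDerivAt).hasLineDerivAt (EuclideanSpace.single k 1)
    refine h1.congr_deriv ?_
    rw [hs.inner_eq_norm]
    have h2 : fderiv ℝ (fun y => ‖heatConv h v y‖) x (EuclideanSpace.single k 1) =
        inner ℝ (u x) (pderiv k (heatConv h v) x) := by
      by_cases h0 : heatConv h v x = 0
      · have hmin : IsLocalMin (fun y => ‖heatConv h v y‖) x := Eventually.of_forall fun y => by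
          simp [h0]
        rw [hmin.fderiv_eq_zero]
        unfold pderiv
        rw [(hasFDerivAt_zero_of_norm h0 hx).fderiv]
        simp
      · have hp := norm_ne_zero_iff.2 h0
        have h3 : HasFDerivAt (fun y => ‖heatConv h v y‖ ^ 2)
            (2 • (innerSL ℝ (heatConv h v x)).comp (fderiv ℝ (heatConv h v) x)) x :=
          hVd.hasFDerivAt.norm_sq
        have h4 : HasFDerivAt (fun y => ‖heatConv h v y‖ ^ 2) _ x := hx.hasFDerivAt.pow 2
        have h5 := congrArg (fun L : Space →L[ℝ] ℝ => L (EuclideanSpace.single k 1)) (h3.unique h4)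
        rw [hs x h0, inner_smul_left]
        unfold pderiv
        simp at h5
        simp
        field_simp
        linarith
    simp only [add_apply, smul_apply, smul_eq_mul, h2]
    unfold pderiv
    ring)
  unfold transport
  rw [← integral_add, key]
  · exact ((hf.perBdd_pderiv k).mul (hu.inner hV)).integrable_cell
  · have : pderiv k (heatConv h v) = kconv (gradKernel h k) v := funext (pderiv_heatConv hv hh k)
    rw [this]
    exact (hf.perBdd.mul (hu.inner (hv.kconv (integrable_gradKernel hh k)))).integrable_cell

lemma integral_inner_heatConv_comm {a b : Space → Plane} (ha : PerBdd a) (hb : PerBdd b) (hh : 0 < h) :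
    ∫ x in cell, inner ℝ (a x) (heatConv h b x) = ∫ x in cell, inner ℝ (b x) (heatConv h a x) := by
  have hK := integrable_heatKernel hh
  have h1 := integral_mul_inner_kconv hK (fun _ => 1) a hb
  have h2 := integral_mul_inner_kconv hK (fun _ => 1) b ha
  have d1 : IsDominated fun x z => heatKernel h z * (1 * inner ℝ (a x) (b (x - z))) :=
    ((PerBdd.const 1).pair_fst.mul (ha.pair_fst.inner hb.pair_sub)).dominated hK
  simp only [one_mul] at h1 h2 d1
  rw [heatConv_eq_kconv, heatConv_eq_kconv, h1, h2, dbl_swap d1]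
  congr 1; ext x z
  rw [heatKernel_neg, sub_neg_eq_add, sub_add_cancel, real_inner_comm]

lemma integral_norm_sq_heatConv_half {w : Space → Plane} (hw : PerBdd w) (hh : 0 < h) :
    ∫ x in cell, ‖heatConv (h / 2) w x‖ ^ 2 = ∫ x in cell, inner ℝ (w x) (heatConv h w x) := by
  have h2 := half_pos hh
  simp_rw [← real_inner_self_eq_norm_sq]
  rw [integral_inner_heatConv_comm (hw.heatConv h2) hw h2]
  simp_rw [heatConv_heatConv_half hw hh]

/-- Energy dissipation in one thresholding step. -/
lemma IsStep.dissipation (hs : IsStep h v u) (hu : UnitMap u) (hv : UnitMap v) (hh : 0 < h) :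
    ∫ x in cell, ‖heatConv (h / 2) (fun y => u y - v y) x‖ ^ 2 ≤ h * (energy h v - energy h u) := by
  have hur := hu.perBdd
  have hvr := hv.perBdd
  have hgu := hur.heatConv hh
  have hgv := hvr.heatConv hh
  have i : ∀ {a b : Space → Plane}, PerBdd a → PerBdd b →
      Integrable (fun x => inner ℝ (a x) (b x)) (volume.restrict cell) := fun ha hb => (ha.inner hb).integrable_cell
  have i1 : Integrable (fun _ : Space => (1 : ℝ)) (volume.restrict cell) := integrable_const 1
  have e1 : h * (energy h v - energy h u) =
      (∫ x in cell, inner ℝ (u x) (heatConv h u x)) - ∫ x in cell, inner ℝ (v x) (heatConv h v x) := by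
    unfold energy
    rw [integral_sub i1 (i hur hgu), integral_sub i1 (i hvr hgv)]
    field_simp; ring
  have e2 : ∫ x in cell, inner ℝ (u x - v x) (heatConv h (fun y => u y - v y) x) =
      (∫ x in cell, inner ℝ (u x) (heatConv h u x)) - 2 * (∫ x in cell, inner ℝ (u x) (heatConv h v x)) +
        ∫ x in cell, inner ℝ (v x) (heatConv h v x) := by
    have h1 : ∀ x, inner ℝ (u x - v x) (heatConv h (fun y => u y - v y) x) =
        (inner ℝ (u x) (heatConv h u x) - inner ℝ (u x) (heatConv h v x)) -
        (inner ℝ (v x) (heatConv h u x) - inner ℝ (v x) (heatConv h v x)) := fun x => by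
      rw [heatConv_eq_kconv, kconv_sub hur hvr (integrable_heatKernel hh), inner_sub_left, inner_sub_right,
        inner_sub_right]
      rfl
    simp_rw [h1]
    have j1 : Integrable (fun x => inner ℝ (u x) (heatConv h u x) - inner ℝ (u x) (heatConv h v x))
        (volume.restrict cell) := (i hur hgu).sub (i hur hgv)
    have j2 : Integrable (fun x => inner ℝ (v x) (heatConv h u x) - inner ℝ (v x) (heatConv h v x))
        (volume.restrict cell) := (i hvr hgu).sub (i hvr hgv)
    rw [integral_sub j1 j2,
      integral_sub (i hur hgu) (i hur hgv), integral_sub (i hvr hgu) (i hvr hgv),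
      integral_inner_heatConv_comm hvr hur hh]
    ring
  -- Pointwise, u x maximises the product with G_h ∗ v over unit vectors.
  have e3 : ∫ x in cell, inner ℝ (v x) (heatConv h v x) ≤ ∫ x in cell, inner ℝ (u x) (heatConv h v x) := by
    refine integral_mono (i hvr hgv) (i hur hgv) fun x => ?_
    dsimp only
    rw [hs.inner_eq_norm]
    refine (real_inner_le_norm _ _).trans ?_
    rw [hv.unit, one_mul]
  rw [integral_norm_sq_heatConv_half (hur.sub hvr) hh, e1, e2]
  linarith

end

/-! ### Exact schemes, energy monotonicity and removal of null sets. -/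

/-- A thresholding scheme for which all conditions hold at every point. -/
structure IsExactScheme (h : ℝ) (u : ℕ → Space → Plane) : Prop where
  unitMap : ∀ n, UnitMap (u n)
  step : ∀ n, IsStep h (u n) (u (n + 1))

lemma IsExactScheme.energy_antitone {h : ℝ} {u : ℕ → Space → Plane} (hu : IsExactScheme h u) (hh : 0 < h) :
    Antitone fun n => energy h (u n) :=
  antitone_nat_of_succ_le fun n => by
    have h1 := (hu.step n).dissipation (hu.unitMap _) (hu.unitMap _) hh
    have h2 : 0 ≤ ∫ x in cell, ‖heatConv (h / 2) (fun y => u (n + 1) y - u n y) x‖ ^ 2 :=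
      integral_nonneg fun x => by positivity
    have := nonneg_of_mul_nonneg_right (h2.trans h1) hh
    linarith

lemma UnitMap.energy_nonneg {h : ℝ} {u : Space → Plane} (hu : UnitMap u) (hh : 0 < h) : 0 ≤ energy h u := by
  have h1 := UnitMap.integral_defect hh u
  have h2 : 0 ≤ ∫ x in cell, defect h u x := integral_nonneg fun x => hu.defect_nonneg hh x
  rw [h1] at h2
  exact nonneg_of_mul_nonneg_right h2 (by positivity)

lemma kconv_congr_ae {F : Type*} [NormedAddCommGroup F] [NormedSpace ℝ F] {f g : Space → F}
    (hfg : f =ᵐ[volume] g) (K : Space → ℝ) : kconv K f = kconv K g := by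
  ext x
  unfold kconv
  refine integral_congr_ae ?_
  filter_upwards [(quasiMeasurePreserving_sub_left_of_right_invariant volume x).ae hfg] with z hz
  rw [hz]

lemma heatConv_congr_ae {F : Type*} [NormedAddCommGroup F] [NormedSpace ℝ F] {f g : Space → F}
    (hfg : f =ᵐ[volume] g) (h : ℝ) : heatConv h f = heatConv h g := kconv_congr_ae hfg _

open Classical in
/-- A pointwise correction of a map to the circle. -/
def unitize (u : Space → Plane) (x : Space) : Plane :=
  if ‖u x‖ = 1 then u x else EuclideanSpace.single 0 1

lemma norm_unitize (u : Space → Plane) (x : Space) : ‖unitize u x‖ = 1 := by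
  unfold unitize; split_ifs with h
  · exact h
  · simp

lemma unitize_ae_eq {u : Space → Plane} (hu : ∀ᵐ x : Space, ‖u x‖ = 1) : u =ᵐ[volume] unitize u := by
  filter_upwards [hu] with x hx
  rw [unitize, if_pos hx]

open Classical in
/-- A thresholding step at every point, with `w` as the choice on the exceptional set. -/
def exactStep (h : ℝ) (v w : Space → Plane) (x : Space) : Plane :=
  if heatConv h v x ≠ 0 then (‖heatConv h v x‖)⁻¹ • heatConv h v x else unitize w x

/-- Convolution does not see null sets, so each corrected map can be built from the original
previous iterate and still satisfies the step relation relative to the corrected one; no recursion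
is needed. -/
lemma IsThresholdingScheme.exists_exact {h : ℝ} {u : ℕ → Space → Plane} (hu : IsThresholdingScheme h u) :
    ∃ w : ℕ → Space → Plane, IsExactScheme h w ∧ ∀ n, u n =ᵐ[volume] w n := by
  let w : ℕ → Space → Plane := fun n => n.casesOn (unitize (u 0)) fun m => exactStep h (u m) (u (m + 1))
  have hae : ∀ n, u n =ᵐ[volume] w n := fun n => by
    cases n with
    | zero => exact unitize_ae_eq (hu.unit 0)
    | succ m =>
      filter_upwards [hu.step m, hu.unit (m + 1)] with x h1 h2
      change _ = exactStep h (u m) (u (m + 1)) x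
      unfold exactStep unitize
      split_ifs with h3
      · exact h1 h3
      · rfl
  have hperU : ∀ n, PeriodicZ3 (unitize (u n)) := fun n k x => by
    unfold unitize; rw [hu.periodic n k x]
  refine ⟨w, ⟨fun n => ⟨?_, (hu.measurable n).congr (hae n), ?_⟩, fun n x hx => ?_⟩, hae⟩
  · cases n with
    | zero => exact hperU 0
    | succ m =>
      intro k x
      change exactStep h (u m) (u (m + 1)) _ = exactStep h (u m) (u (m + 1)) _
      have hper : heatConv h (u m) (x + EuclideanSpace.single k 1) = heatConv h (u m) x := by
        rw [heatConv_eq_kconv]; unfold kconv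
        congr 1; ext1 z; rw [add_sub_right_comm, hu.periodic m]
      unfold exactStep
      rw [hper, hperU]
  · cases n with
    | zero => exact norm_unitize _
    | succ m =>
      intro x
      change ‖exactStep h (u m) (u (m + 1)) x‖ = 1
      unfold exactStep
      split_ifs with h3
      · rw [norm_smul, norm_inv, norm_norm, inv_mul_cancel₀ (norm_ne_zero_iff.2 h3)]
      · exact norm_unitize _ _
  · rw [← heatConv_congr_ae (hae n)] at hx ⊢
    change exactStep h (u n) (u (n + 1)) x = _
    unfold exactStep
    rw [if_pos hx]

/-! ### Smooth test functions on the closed time interval. -/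

namespace IsSmoothOnTorus

variable {E : Type*} [NormedAddCommGroup E] [NormedSpace ℝ E] {T : ℝ} {f : ℝ → Space → E}

lemma exists_bound (hf : IsSmoothOnTorus T f) : ∃ M, ∀ t ∈ Set.Icc 0 T, ∀ x, ‖f t x‖ ≤ M := by
  have hc : IsCompact (Set.Icc 0 T ×ˢ Metric.closedBall (0 : Space) 3) :=
    isCompact_Icc.prod (isCompact_closedBall _ _)
  obtain ⟨M, hM⟩ := hc.exists_bound_of_continuousOn
    (hf.1.continuousOn.mono (Set.prod_mono_right (Set.subset_univ _)))
  refine ⟨M, fun t ht x => ?_⟩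
  obtain ⟨y, hy, h⟩ := (hf.2 t ht).exists_norm_le x
  rw [h]
  exact hM (t, y) ⟨ht, hy⟩

/-- Each time slice is all of space, so the derivative within the slab restricts to a genuine
spatial derivative, including at the times 0 and T. -/
lemma hasFDerivAt (hf : IsSmoothOnTorus T f) {t : ℝ} (ht : t ∈ Set.Icc 0 T) (x : Space) :
    HasFDerivAt (f t) ((fderivWithin ℝ (fun p : ℝ × Space => f p.1 p.2) (Set.Icc 0 T ×ˢ Set.univ) (t, x)).comp
      (ContinuousLinearMap.inr ℝ ℝ Space)) x := by
  have h1 := (hf.1.differentiableOn (by simp) (t, x) ⟨ht, trivial⟩).hasFDerivWithinAt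
  have h2 : HasFDerivAt (fun y : Space => ((t, y) : ℝ × Space)) (ContinuousLinearMap.inr ℝ ℝ Space) x :=
    hasFDerivAt_prodMk_right t x
  rw [← hasFDerivWithinAt_univ] at h2 ⊢
  exact h1.comp x h2 fun y _ => ⟨ht, trivial⟩

lemma continuousOn_time (hf : IsSmoothOnTorus T f) (x : Space) :
    ContinuousOn (fun t => f t x) (Set.Icc 0 T) :=
  hf.1.continuousOn.comp (f := fun t : ℝ => ((t, x) : ℝ × Space)) (by fun_prop) fun t ht => ⟨ht, trivial⟩

lemma fderiv (hT : 0 < T) (hf : IsSmoothOnTorus T f) : IsSmoothOnTorus T fun t => fderiv ℝ (f t) := by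
  constructor
  · have hu : UniqueDiffOn ℝ (Set.Icc 0 T ×ˢ (Set.univ : Set Space)) :=
      (uniqueDiffOn_Icc hT).prod uniqueDiffOn_univ
    have h1 : ContDiffOn ℝ ∞ (fderivWithin ℝ (fun p : ℝ × Space => f p.1 p.2) (Set.Icc 0 T ×ˢ Set.univ))
        (Set.Icc 0 T ×ˢ Set.univ) := hf.1.fderivWithin hu (by simp)
    refine (h1.clm_comp (contDiffOn_const (c := ContinuousLinearMap.inr ℝ ℝ Space))).congr fun p hp => ?_
    exact (hf.hasFDerivAt hp.1 p.2).fderiv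
  · intro t ht k x
    have : f t = fun y => f t (y + EuclideanSpace.single k 1) := funext fun y => (hf.2 t ht k y).symm
    change _root_.fderiv ℝ (f t) _ = _root_.fderiv ℝ (f t) x
    conv_rhs => rw [this]
    rw [fderiv_comp_add_right]

/-- By periodicity a compact set suffices to bound f and its first two spatial derivatives uniformly
in time; the second derivative gives the Lipschitz bound. -/
lemma exists_bddC11 (hT : 0 < T) (hf : IsSmoothOnTorus T f) :
    ∃ M, ∀ t ∈ Set.Icc 0 T, BddC11 M (f t) := by
  obtain ⟨M₀, h₀⟩ := hf.exists_bound
  obtain ⟨M₁, h₁⟩ := (hf.fderiv hT).exists_bound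
  obtain ⟨M₂, h₂⟩ := ((hf.fderiv hT).fderiv hT).exists_bound
  refine ⟨max M₀ (max M₁ M₂), fun t ht => ⟨hf.2 t ht, fun x => (hf.hasFDerivAt ht x).differentiableAt,
    fun x => (h₀ t ht x).trans (le_max_left _ _),
    fun x => (h₁ t ht x).trans ((le_max_left _ _).trans (le_max_right _ _)), fun x y => ?_⟩⟩
  refine (convex_univ.norm_image_sub_le_of_norm_fderiv_le (𝕜 := ℝ)
    (fun x _ => ((hf.fderiv hT).hasFDerivAt ht x).differentiableAt)
    (fun x _ => h₂ t ht x) trivial trivial).trans ?_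
  gcongr
  exact (le_max_right _ _).trans (le_max_right _ _)

lemma continuousOn_pderiv (hT : 0 < T) (hf : IsSmoothOnTorus T f) (k : Fin 3) (x : Space) :
    ContinuousOn (fun t => pderiv k (f t) x) (Set.Icc 0 T) :=
  ((hf.fderiv hT).continuousOn_time x).clm_apply continuousOn_const

end IsSmoothOnTorus

/-- Families of functions on the torus that are bounded and depend continuously on time. -/
structure BddFamily (T : ℝ) (F : ℝ → Space → ℝ) : Prop where
  meas : ∀ t ∈ Set.Icc 0 T, AEStronglyMeasurable (F t) volume
  bdd : ∃ M, ∀ t ∈ Set.Icc 0 T, ∀ x, |F t x| ≤ M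
  cont : ∀ x, ContinuousOn (fun t => F t x) (Set.Icc 0 T)

namespace BddFamily

variable {T : ℝ} {F H : ℝ → Space → ℝ}

lemma of_perBdd {a : Space → ℝ} (ha : PerBdd a) : BddFamily T fun _ => a :=
  ⟨fun _ _ => ha.meas, let ⟨M, hM⟩ := ha.bdd; ⟨M, fun _ _ x => hM x⟩, fun _ => continuousOn_const⟩

lemma mul (hF : BddFamily T F) (hH : BddFamily T H) : BddFamily T fun t x => F t x * H t x where
  meas t ht := (hF.meas t ht).mul (hH.meas t ht)
  bdd := by
    obtain ⟨M, hM⟩ := hF.bdd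
    obtain ⟨N, hN⟩ := hH.bdd
    refine ⟨M * N, fun t ht x => ?_⟩
    rw [abs_mul]
    exact mul_le_mul (hM t ht x) (hN t ht x) (abs_nonneg _) ((abs_nonneg _).trans (hM t ht x))
  cont x := (hF.cont x).mul (hH.cont x)

lemma sum {ι : Type*} [Fintype ι] {G : ι → ℝ → Space → ℝ} (hG : ∀ i, BddFamily T (G i)) :
    BddFamily T fun t x => ∑ i, G i t x where
  meas t ht := Finset.aestronglyMeasurable_fun_sum _ fun i _ => (hG i).meas t ht
  bdd := by
    choose M hM using fun i => (hG i).bdd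
    exact ⟨∑ i, M i, fun t ht x => (Finset.abs_sum_le_sum_abs _ _).trans
      (Finset.sum_le_sum fun i _ => hM i t ht x)⟩
  cont x := continuousOn_finsetSum _ fun i _ => (hG i).cont x

lemma continuousOn_integral (hF : BddFamily T F) :
    ContinuousOn (fun t => ∫ x in cell, F t x) (Set.Icc 0 T) := by
  obtain ⟨M, hM⟩ := hF.bdd
  exact continuousOn_of_dominated (bound := fun _ => M) (fun t ht => (hF.meas t ht).restrict)
    (fun t ht => Eventually.of_forall fun x => hM t ht x) (integrable_const _)
    (Eventually.of_forall hF.cont)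

end BddFamily

/-! ### Integrals in time of piecewise constant interpolations. -/

lemma mem_Ico_of_floor_eq {h t : ℝ} (hh : 0 < h) (ht : 0 ≤ t) {n : ℕ} :
    ⌊t / h⌋₊ = n ↔ t ∈ Set.Ico (n * h) ((n + 1) * h) := by
  rw [Nat.floor_eq_iff (by positivity), le_div_iff₀ hh, div_lt_iff₀ hh, Set.mem_Ico]

lemma sum_indicator_floor {h T t : ℝ} (hh : 0 < h) (ht : t ∈ Set.Icc 0 T) (Φ : ℕ → ℝ → ℝ) :
    ∑ n ∈ Finset.range (⌊T / h⌋₊ + 1), (Set.Ico (n * h) ((n + 1) * h)).indicator (Φ n) t =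
      Φ ⌊t / h⌋₊ t := by
  have hmem : ⌊t / h⌋₊ ∈ Finset.range (⌊T / h⌋₊ + 1) := by
    rw [Finset.mem_range, Nat.lt_succ_iff]
    exact Nat.floor_le_floor (by gcongr; exact ht.2)
  rw [Finset.sum_eq_single_of_mem _ hmem]
  · exact Set.indicator_of_mem ((mem_Ico_of_floor_eq hh ht.1).1 rfl) _
  · intro n _ hn
    refine Set.indicator_of_notMem (fun h' => hn ?_) _
    exact ((mem_Ico_of_floor_eq hh ht.1).2 h').symm

lemma intervalIntegrable_floor {h T : ℝ} (hh : 0 < h) (hT : 0 ≤ T) {Φ : ℕ → ℝ → ℝ}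
    (hΦ : ∀ n, ContinuousOn (Φ n) (Set.Icc 0 T)) :
    IntervalIntegrable (fun t => Φ ⌊t / h⌋₊ t) volume 0 T := by
  rw [intervalIntegrable_iff_integrableOn_Ioc_of_le hT]
  have h1 : IntegrableOn (fun t => ∑ n ∈ Finset.range (⌊T / h⌋₊ + 1),
      (Set.Ico (n * h) ((n + 1) * h)).indicator (Φ n) t) (Set.Ioc 0 T) :=
    integrable_finsetSum _ fun n _ =>
      (((hΦ n).integrableOn_compact isCompact_Icc).mono_set Set.Ioc_subset_Icc_self).indicator measurableSet_Ico
  refine h1.congr_fun (fun t ht => ?_) measurableSet_Ioc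
  exact sum_indicator_floor hh ⟨ht.1.le, ht.2⟩ Φ

/-- The majorant is a finite sum of indicators, so no measurability of S is required. The last
interval may extend beyond T, whence ⌊T/h⌋₊ + 1 full steps. -/
lemma abs_intervalIntegral_floor_le {h T : ℝ} (hh : 0 < h) (hT : 0 ≤ T) {S : ℝ → ℝ} {β : ℕ → ℝ}
    (hβ : ∀ n, 0 ≤ β n) (hS : ∀ t ∈ Set.Icc 0 T, |S t| ≤ β ⌊t / h⌋₊) :
    |∫ t in (0 : ℝ)..T, S t| ≤ h * ∑ n ∈ Finset.range (⌊T / h⌋₊ + 1), β n := by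
  rw [intervalIntegral.integral_of_le hT, ← Real.norm_eq_abs]
  have hi : ∀ n ∈ Finset.range (⌊T / h⌋₊ + 1), Integrable
      ((Set.Ico (n * h) ((n + 1) * h)).indicator fun _ : ℝ => β n) := fun n _ =>
    (integrable_indicator_iff measurableSet_Ico).2 (integrableOn_const (by simp))
  have h1 : IntegrableOn (fun t => ∑ n ∈ Finset.range (⌊T / h⌋₊ + 1),
      (Set.Ico (n * h) ((n + 1) * h)).indicator (fun _ => β n) t) (Set.Ioc 0 T) :=
    (integrable_finsetSum _ hi).integrableOn
  refine (norm_integral_le_of_norm_le h1 ?_).trans ?_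
  · refine (ae_restrict_iff' measurableSet_Ioc).2 (Eventually.of_forall fun t ht => ?_)
    rw [sum_indicator_floor hh ⟨ht.1.le, ht.2⟩ fun n _ => β n]
    exact hS t ⟨ht.1.le, ht.2⟩
  · refine (setIntegral_le_integral (integrable_finsetSum _ hi) (Eventually.of_forall fun t =>
      Finset.sum_nonneg fun n _ => Set.indicator_nonneg (fun _ _ => hβ n) _)).trans ?_
    rw [integral_finsetSum _ hi, Finset.mul_sum]
    refine Finset.sum_le_sum fun n _ => le_of_eq ?_
    rw [integral_indicator measurableSet_Ico, setIntegral_const, Real.volume_real_Ico_of_le (by nlinarith)]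
    simp; left; ring

/-- Truncated subtraction encodes the convention u^h = u⁰ for negative times: the predecessor of
step 0 is step 0. -/
lemma floor_sub_div {h : ℝ} (hh : 0 < h) (t : ℝ) : ⌊(t - h) / h⌋₊ = ⌊t / h⌋₊ - 1 := by
  rw [sub_div, div_self hh.ne', Nat.floor_sub_one]

lemma floor_add_div {h t : ℝ} (hh : 0 < h) (ht : 0 ≤ t) : ⌊(t + h) / h⌋₊ = ⌊t / h⌋₊ + 1 := by
  rw [add_div, div_self hh.ne', Nat.floor_add_one (by positivity)]

section

variable {T h : ℝ} {W W' : ℝ → Space → Plane}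

lemma diffQuot_congr_ae (hW : ∀ t, W t =ᵐ[volume] W' t) (τ t : ℝ) :
    diffQuot τ W t =ᵐ[volume] diffQuot τ W' t := by
  filter_upwards [hW t, hW (t - τ)] with x h1 h2
  unfold diffQuot
  rw [h1, h2]

lemma innerLHS_congr_ae (hW : ∀ t, W t =ᵐ[volume] W' t) (ξ : ℝ → Space → Space) :
    innerLHS T h W ξ = innerLHS T h W' ξ := by
  unfold innerLHS
  simp_rw [fun t => heatConv_congr_ae (hW t), fun t => heatConv_congr_ae (diffQuot_congr_ae hW h t)]

lemma innerRHS_congr_ae (hW : ∀ t, W t =ᵐ[volume] W' t) (ξ : ℝ → Space → Space) :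
    innerRHS T h W ξ = innerRHS T h W' ξ := by
  unfold innerRHS spaceTimeIntegral
  simp_rw [fun t => heatConv_congr_ae (hW t)]
  congr 3
  ext t
  refine integral_congr_ae ?_
  filter_upwards [ae_restrict_of_ae (hW t)] with x hx
  rw [hx]

lemma outerForm_congr_ae (hW : ∀ t, W t =ᵐ[volume] W' t) (τ : ℝ) (ζ : ℝ → Space → ℝ) (i j : Fin 2) :
    outerForm T h τ W ζ i j = outerForm T h τ W' ζ i j := by
  have hg : ∀ (m : Fin 2) (t : ℝ), heatConv h (fun y => W t y m) = heatConv h fun y => W' t y m :=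
    fun m t => heatConv_congr_ae ((hW t).mono fun x hx => by simp only [hx]) h
  unfold outerForm spaceTimeIntegral
  simp only [hg]
  congr 1
  ext t
  refine integral_congr_ae ?_
  filter_upwards [ae_restrict_of_ae (hW t)] with x hx
  rw [hx]

lemma energy_congr_ae {u v : Space → Plane} (huv : u =ᵐ[volume] v) : energy h u = energy h v := by
  unfold energy
  rw [heatConv_congr_ae huv]
  congr 1
  refine integral_congr_ae ?_
  filter_upwards [ae_restrict_of_ae huv] with x hx
  rw [hx]

end

/-! ### Error bounds in terms of energy and s = h^{1/4}. -/

section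

variable {u v : Space → Plane} {h s M : ℝ}

lemma sqrt_eq_sq_of_pow_four (hs : 0 < s) (hsh : s ^ 4 = h) : √h = s ^ 2 := by
  rw [← hsh, show s ^ 4 = (s ^ 2) ^ 2 by ring, Real.sqrt_sq (by positivity)]

lemma integral_errorDensity (hu : UnitMap u) (hh : 0 < h) (l : ℝ) :
    ∫ x in cell, errorDensity l h u x = l * (2 * h * energy h u) + 4 * weightConst / l ^ 3 := by
  unfold errorDensity
  rw [integral_add ((hu.integrable_defect hh).const_mul l) (integrable_const _), integral_const_mul,
    UnitMap.integral_defect hh]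
  simp

/-- Integrate √q ≤ q/√h + √h over the torus of measure one. -/
lemma UnitMap.integral_sqrt_defect_le (hu : UnitMap u) (hh : 0 < h) :
    ∫ x in cell, √(defect h u x) ≤ √h * (2 * energy h u + 1) := by
  have hs := Real.sqrt_pos.2 hh
  have h1 : ∫ x in cell, √(defect h u x) ≤ ∫ x in cell, ((√h)⁻¹ * defect h u x + √h) := by
    refine integral_mono (hu.integrable_sqrt_defect hh)
      (((hu.integrable_defect hh).const_mul _).add (integrable_const _)) fun x => ?_
    have hq := hu.defect_nonneg hh x
    dsimp only
    have := Real.sq_sqrt hq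
    rw [← sub_nonneg]
    have e : (√h)⁻¹ * defect h u x + √h - √(defect h u x) =
        (√h)⁻¹ * ((√(defect h u x) - √h / 2) ^ 2 + 3 / 4 * √h ^ 2) := by
      rw [← this, Real.sqrt_sq (Real.sqrt_nonneg _)]; field_simp; ring
    rw [e]; positivity
  refine h1.trans (le_of_eq ?_)
  rw [integral_add ((hu.integrable_defect hh).const_mul _) (integrable_const _), integral_const_mul,
    UnitMap.integral_defect hh]
  simp
  have := Real.sq_sqrt hh.le
  field_simp
  linear_combination (-(2 * energy h u)) * this

/-- The remainder of the inner variation after one step of the scheme. -/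
lemma IsStep.abs_inner_variation_le (hst : IsStep h v u) (hu : UnitMap u) (hv : UnitMap v) (hs : 0 < s)
    (hs1 : s ≤ 1) (hsh : s ^ 4 = h) {ξ : Space → Space} (hξ : BddC11 M ξ) :
    |2 * innerLeft h u v ξ - (1 / h * innerDiv h u ξ - 2 * ∑ i, ∑ j, innerStress h u ξ i j)| ≤
      1100 * M * weightConst ^ 3 * ((energy h v - energy h u) / s ^ 2 + s * (energy h u + 1)) := by
  have hh : 0 < h := hsh ▸ by positivity
  have hM := hξ.nonneg
  have hA := one_le_weightConst
  have hE := hu.energy_nonneg hh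
  have hr := sqrt_eq_sq_of_pow_four hs hsh
  have hdis := hst.dissipation hu hv hh
  have hφ : PerBdd (heatConv (h / 2) fun y => u y - v y) := (hu.perBdd.sub hv.perBdd).heatConv (half_pos hh)
  have hφ2 : Integrable (fun x => ‖heatConv (h / 2) (fun y => u y - v y) x‖ ^ 2) (volume.restrict cell) := by
    simp_rw [← real_inner_self_eq_norm_sq]
    exact (hφ.inner hφ).integrable_cell
  have hD : 0 ≤ energy h v - energy h u :=
    nonneg_of_mul_nonneg_right ((integral_nonneg fun x => by positivity).trans hdis) hh
  have hEL : ∑ k, transport h u k (fun x => ξ x k) v = 0 := Finset.sum_eq_zero fun k _ =>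
    hst.transport_eq_zero hv.perBdd hh (hξ.coord k) hu.perBdd k
  -- Young's inequality with weight s² = √h. The resulting D/s², with D the energy drop, is
  -- affordable because D telescopes over the steps.
  have h1 : ∫ x in cell, ‖heatConv (h / 2) (fun y => u y - v y) x‖ * √(defect h u x) ≤
      1 / 2 * (h * (energy h v - energy h u) / s ^ 2 + s ^ 2 * (2 * h * energy h u)) := by
    have i1 := (hφ2.const_mul (1 / (2 * s ^ 2))).add ((hu.integrable_defect hh).const_mul (s ^ 2 / 2))
    refine (integral_mono_of_nonneg (Eventually.of_forall fun x => by positivity) i1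
      (Eventually.of_forall fun x => ?_)).trans ?_
    · have hq := Real.sq_sqrt (hu.defect_nonneg hh x)
      simp only [Pi.add_apply]
      rw [← sub_nonneg]
      set a := ‖heatConv (h / 2) (fun y => u y - v y) x‖
      have e : 1 / (2 * s ^ 2) * a ^ 2 + s ^ 2 / 2 * defect h u x - a * √(defect h u x) =
          1 / (2 * s ^ 2) * (a - s ^ 2 * √(defect h u x)) ^ 2 := by
        rw [← hq, Real.sqrt_sq (Real.sqrt_nonneg _)]; field_simp; ring
      rw [e]; positivity
    · simp only [Pi.add_apply]
      rw [integral_add (hφ2.const_mul _) ((hu.integrable_defect hh).const_mul _), integral_const_mul,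
        integral_const_mul, UnitMap.integral_defect hh]
      calc _ ≤ 1 / (2 * s ^ 2) * (h * (energy h v - energy h u)) + s ^ 2 / 2 * (2 * h * energy h u) := by
            gcongr
        _ = _ := by field_simp
  -- The choice l = h^{-1/4} balances the two parts of the error density: after division by √h they
  -- are 2s times the energy and 4 `weightConst` s.
  have h2 := FilamentThresholding.abs_inner_variation_le hu hv hh hξ (l := 1 / s)
    (by rw [le_div_iff₀ hs]; linarith) hEL
  rw [integral_errorDensity hu hh, hr] at h2
  refine h2.trans ?_
  set A := weightConst
  set D := energy h v - energy h u
  set e := energy h u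
  calc _ ≤ 36 * M * A / h * (1 / 2 * (h * D / s ^ 2 + s ^ 2 * (2 * h * e))) +
        254 * M * A ^ 2 / s ^ 2 * (1 / s * (2 * h * e) + 4 * A / (1 / s) ^ 3) := by gcongr
    _ = M * (18 * A * (D / s ^ 2) + 36 * A * (s * s * e) + 508 * A ^ 2 * (s * e) + 1016 * A ^ 3 * s) := by
        rw [← hsh]; field_simp; ring
    _ ≤ M * (1100 * A ^ 3 * (D / s ^ 2) + 36 * A ^ 3 * (1 * s * e) + 508 * A ^ 3 * (s * e) +
        1016 * A ^ 3 * s) := by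
        have a1 : A ≤ A ^ 3 := le_self_pow₀ hA (by norm_num)
        have a2 : A ^ 2 ≤ A ^ 3 := pow_le_pow_right₀ hA (by norm_num)
        gcongr
        · norm_num
    _ ≤ _ := by
        have : 0 ≤ A ^ 3 * (s * e) := by positivity
        have : 0 ≤ A ^ 3 * s := by positivity
        have e' : 1100 * M * A ^ 3 * (D / s ^ 2 + s * (e + 1)) =
            M * (1100 * A ^ 3 * (D / s ^ 2) + 1100 * (A ^ 3 * (s * e)) + 1100 * (A ^ 3 * s)) := by ring
        rw [e', add_assoc, add_assoc, add_assoc]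
        gcongr M * (_ + ?_)
        linarith

/-- The terms of the inner variation without time derivative are bounded by the energy. -/
lemma UnitMap.abs_inner_variation_self_le (hu : UnitMap u) (hh : 0 < h) {ξ : Space → Space} (hξ : BddC11 M ξ) :
    |2 * innerLeft h u u ξ - (1 / h * innerDiv h u ξ - 2 * ∑ i, ∑ j, innerStress h u ξ i j)| ≤
      327 * M * weightConst ^ 2 * energy h u := by
  have hM := hξ.nonneg
  have hA := one_le_weightConst
  have hE := hu.energy_nonneg hh
  have hs := Real.sqrt_pos.2 hh
  have e0 : innerLeft h u u ξ = 0 := by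
    unfold innerLeft
    have : heatConv (h / 2) (fun y => h⁻¹ • (u y - u y)) = fun _ => 0 := by
      ext1 x
      rw [heatConv_eq_kconv]; unfold kconv; simp
    simp_rw [this]
    simp
  have hp : ∀ i j x, |pderiv i ξ x j| ≤ M := fun i j x =>
    (norm_coord_le _ j).trans (hξ.norm_pderiv_le i x)
  have e1 : |innerDiv h u ξ| ≤ 3 * M * (h * energy h u) := by
    have : 3 * M * (h * energy h u) = ∫ x in cell, 3 * M / 2 * defect h u x := by
      rw [integral_const_mul, UnitMap.integral_defect hh]; ring
    rw [this, ← Real.norm_eq_abs]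
    refine norm_integral_le_of_norm_le ((hu.integrable_defect hh).const_mul _)
      (Eventually.of_forall fun x => ?_)
    have hq : 1 - inner ℝ (u x) (heatConv h u x) = defect h u x / 2 := by unfold defect; ring
    have hd : |divergence ξ x| ≤ 3 * M := by
      refine (Finset.abs_sum_le_sum_abs _ _).trans ((Finset.sum_le_sum fun k _ => hp k k x).trans ?_)
      simp
    have hq0 := hu.defect_nonneg hh x
    rw [hq, norm_mul, Real.norm_eq_abs, Real.norm_eq_abs, abs_of_nonneg (by positivity : 0 ≤ defect h u x / 2)]
    calc _ ≤ 3 * M * (defect h u x / 2) := by gcongr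
      _ = _ := by ring
  have e2 : ∀ i j, |innerStress h u ξ i j| ≤ 18 * M * weightConst ^ 2 * energy h u := fun i j => by
    have : 18 * M * weightConst ^ 2 * energy h u =
        ∫ x in cell, 9 * M * weightConst ^ 2 / h * defect h u x := by
      rw [integral_const_mul, UnitMap.integral_defect hh]; field_simp; ring
    rw [this, ← Real.norm_eq_abs]
    refine norm_integral_le_of_norm_le ((hu.integrable_defect hh).const_mul _)
      (Eventually.of_forall fun x => ?_)
    have hg : ∀ k, ‖pderiv k (heatConv (h / 2) u) x‖ ≤ 3 / √h * weightConst * √(defect h u x) := fun k => by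
      rw [pderiv_heatConv hu.perBdd (half_pos hh)]
      exact norm_kconv_gradKernel_half_le hu hh k x
    rw [norm_mul]
    calc _ ≤ M * ((3 / √h * weightConst * √(defect h u x)) * (3 / √h * weightConst * √(defect h u x))) := by
          gcongr
          · exact hp i j x
          · refine (norm_inner_le_norm _ _).trans ?_
            gcongr
            · exact hg i
            · exact hg j
      _ = M * (9 / √h ^ 2 * weightConst ^ 2 * √(defect h u x) ^ 2) := by ring
      _ = _ := by rw [Real.sq_sqrt hh.le, Real.sq_sqrt (hu.defect_nonneg hh x)]; ring
  have e3 : |∑ i, ∑ j, innerStress h u ξ i j| ≤ 162 * M * weightConst ^ 2 * energy h u := by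
    refine (Finset.abs_sum_le_sum_abs _ _).trans ((Finset.sum_le_sum fun i _ =>
      (Finset.abs_sum_le_sum_abs _ _).trans (Finset.sum_le_sum fun j _ => e2 i j)).trans (le_of_eq ?_))
    simp; ring
  have e4 : |1 / h * innerDiv h u ξ| ≤ 3 * M * weightConst ^ 2 * energy h u := by
    rw [abs_mul, abs_of_pos (by positivity : 0 < 1 / h)]
    calc _ ≤ 1 / h * (3 * M * (h * energy h u)) := by gcongr
      _ = 3 * M * 1 * energy h u := by field_simp
      _ ≤ _ := by gcongr; exact one_le_pow₀ hA
  rw [e0, mul_zero, zero_sub, abs_neg]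
  refine (abs_sub _ _).trans ?_
  rw [abs_mul 2, abs_two]
  linarith

end

/-- Summation of the errors over the time steps. -/
lemma abs_intervalIntegral_le_of_energy {T h s K : ℝ} (hT : 0 ≤ T) (hs : 0 < s) (hs1 : s ≤ 1) (hsh : s ^ 4 = h)
    (hK : 0 ≤ K) {E : ℕ → ℝ} (hE : Antitone E) (hE0 : ∀ n, 0 ≤ E n) {S : ℝ → ℝ}
    (hS : ∀ t ∈ Set.Icc 0 T, |S t| ≤ K * ((E (⌊t / h⌋₊ - 1) - E ⌊t / h⌋₊) / s ^ 2 + s * (E 0 + 1) +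
      if ⌊t / h⌋₊ = 0 then E 0 + 1 else 0)) :
    |∫ t in (0 : ℝ)..T, S t| ≤ K * (T + 3) * (s * (E 0 + 1)) := by
  have hh : 0 < h := hsh ▸ by positivity
  have h0 := hE0 0
  refine (abs_intervalIntegral_floor_le hh hT (β := fun n => K * ((E (n - 1) - E n) / s ^ 2 + s * (E 0 + 1) +
    if n = 0 then E 0 + 1 else 0)) (fun n => ?_) hS).trans ?_
  · have := sub_nonneg.2 (hE (Nat.sub_le n 1))
    have : 0 ≤ if n = 0 then E 0 + 1 else 0 := by split_ifs <;> positivity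
    positivity
  · set N := ⌊T / h⌋₊
    have hN : (N : ℝ) * h ≤ T := by
      rw [← le_div_iff₀ hh]; exact Nat.floor_le (by positivity)
    have hh1 : h ≤ s := hsh ▸ pow_le_of_le_one hs.le hs1 (by norm_num)
    have hs2 : s ^ 2 ≤ s := pow_le_of_le_one hs.le hs1 (by norm_num)
    -- The n = 0 term is zero because 0 - 1 = 0 in ℕ; the others telescope.
    have hsum : ∑ n ∈ Finset.range (N + 1), (E (n - 1) - E n) = E 0 - E N := by
      rw [Finset.sum_range_succ']
      simp only [Nat.add_sub_cancel, Finset.sum_range_sub', Nat.zero_sub, sub_self, add_zero]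
    have hite : ∑ n ∈ Finset.range (N + 1), (if n = 0 then E 0 + 1 else 0) = E 0 + 1 := by simp
    rw [← Finset.mul_sum, Finset.sum_add_distrib, Finset.sum_add_distrib, ← Finset.sum_div, hsum, hite]
    simp only [Finset.sum_const, Finset.card_range, nsmul_eq_mul]
    push_cast
    -- The time step h = s⁴ outweighs the factor 1/s² on the dissipation, and the initial interval
    -- costs only h times its bound.
    calc _ = K * (s ^ 2 * (E 0 - E N) + (N * h + h) * (s * (E 0 + 1)) + h * (E 0 + 1)) := by
          rw [← hsh]; field_simp
      _ ≤ K * (s * (E 0 - 0) + (T + 1) * (s * (E 0 + 1)) + s * (E 0 + 1)) := by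
          have : 0 ≤ E 0 - E N := sub_nonneg.2 (hE (Nat.zero_le N))
          gcongr
          · exact hE0 N
          · linarith
      _ ≤ _ := by
          rw [mul_assoc]
          gcongr
          nlinarith

/-! ### Continuity in time of the fixed-step functionals. -/

namespace IsSmoothOnTorus

variable {T : ℝ}

lemma bddFamily_coord {ξ : ℝ → Space → Space} (hT : 0 < T) (hξ : IsSmoothOnTorus T ξ) (k : Fin 3) :
    BddFamily T fun t x => ξ t x k := by
  obtain ⟨M, hM⟩ := hξ.exists_bddC11 hT
  exact ⟨fun t ht => ((hM t ht).coord k).perBdd.meas, ⟨M, fun t ht x => ((hM t ht).coord k).bound x⟩,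
    fun x => (EuclideanSpace.proj k : Space →L[ℝ] ℝ).continuous.comp_continuousOn (hξ.continuousOn_time x)⟩

lemma bddFamily_pderiv_coord {ξ : ℝ → Space → Space} (hT : 0 < T) (hξ : IsSmoothOnTorus T ξ) (i k : Fin 3) :
    BddFamily T fun t x => pderiv i (ξ t) x k := by
  obtain ⟨M, hM⟩ := hξ.exists_bddC11 hT
  refine ⟨fun t ht => ?_, ⟨M, fun t ht x => (norm_coord_le _ k).trans ((hM t ht).norm_pderiv_le i x)⟩,
    fun x => (EuclideanSpace.proj k : Space →L[ℝ] ℝ).continuous.comp_continuousOn (hξ.continuousOn_pderiv hT i x)⟩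
  simp_rw [← pderiv_coord (hM t ht).diff]
  exact (((hM t ht).coord k).perBdd_pderiv i).meas

end IsSmoothOnTorus

section

variable {T h : ℝ} {u v : Space → Plane} {ξ : ℝ → Space → Space}

lemma UnitMap.perBdd_pderiv_heatConv (hu : UnitMap u) (hh : 0 < h) (k : Fin 3) :
    PerBdd (pderiv k (heatConv h u)) := by
  rw [funext (pderiv_heatConv hu.perBdd hh k)]
  exact hu.perBdd.kconv (integrable_gradKernel hh k)

lemma continuousOn_innerLeft (hT : 0 < T) (hξ : IsSmoothOnTorus T ξ) (hu : UnitMap u) (hv : UnitMap v)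
    (hh : 0 < h) : ContinuousOn (fun t => innerLeft h u v (ξ t)) (Set.Icc 0 T) := by
  unfold innerLeft
  simp_rw [inner_sum, inner_smul_right]
  exact (BddFamily.sum fun k => (hξ.bddFamily_coord hT k).mul (.of_perBdd
    ((((PerBdd.const h⁻¹).smul (hu.perBdd.sub hv.perBdd)).heatConv (half_pos hh)).inner
      (hu.perBdd_pderiv_heatConv (half_pos hh) k)))).continuousOn_integral

lemma continuousOn_innerDiv (hT : 0 < T) (hξ : IsSmoothOnTorus T ξ) (hu : UnitMap u) (hh : 0 < h) :
    ContinuousOn (fun t => innerDiv h u (ξ t)) (Set.Icc 0 T) :=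
  ((BddFamily.sum fun k => hξ.bddFamily_pderiv_coord hT k k).mul (.of_perBdd
    ((PerBdd.const 1).sub (hu.perBdd.inner (hu.perBdd.heatConv hh))))).continuousOn_integral

lemma continuousOn_innerStress (hT : 0 < T) (hξ : IsSmoothOnTorus T ξ) (hu : UnitMap u) (hh : 0 < h)
    (i j : Fin 3) : ContinuousOn (fun t => innerStress h u (ξ t) i j) (Set.Icc 0 T) :=
  ((hξ.bddFamily_pderiv_coord hT i j).mul (.of_perBdd ((hu.perBdd_pderiv_heatConv (half_pos hh) i).inner
    (hu.perBdd_pderiv_heatConv (half_pos hh) j)))).continuousOn_integral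

end

/-! ### Space-time estimates for an exact scheme. -/

section

variable {T h s M : ℝ} {w : ℕ → Space → Plane}

lemma interpolation_sub (hh : 0 < h) (t : ℝ) : interpolation h w (t - h) = w (⌊t / h⌋₊ - 1) := by
  ext1 x; rw [interpolation, floor_sub_div hh]

lemma interpolation_add (hh : 0 < h) {t : ℝ} (ht : 0 ≤ t) :
    interpolation h w (t - -h) = w (⌊t / h⌋₊ + 1) := by
  ext1 x; rw [interpolation, sub_neg_eq_add, floor_add_div hh ht]

/-- Merging the separate space-time integrals into one requires integrability in time; it holds
because for each fixed step the integrand is continuous in t. -/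
lemma IsExactScheme.innerLHS_sub_innerRHS_eq (hw : IsExactScheme h w) (hT : 0 < T) (hh : 0 < h)
    {ξ : ℝ → Space → Space} (hξ : IsSmoothOnTorus T ξ) :
    innerLHS T h (interpolation h w) ξ - innerRHS T h (interpolation h w) ξ =
      ∫ t in (0 : ℝ)..T, (2 * innerLeft h (w ⌊t / h⌋₊) (w (⌊t / h⌋₊ - 1)) (ξ t) -
        (1 / h * innerDiv h (w ⌊t / h⌋₊) (ξ t) - 2 * ∑ i, ∑ j, innerStress h (w ⌊t / h⌋₊) (ξ t) i j)) := by
  have iL := intervalIntegrable_floor hh hT.le (Φ := fun n t => innerLeft h (w n) (w (n - 1)) (ξ t))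
    fun n => continuousOn_innerLeft hT hξ (hw.unitMap _) (hw.unitMap _) hh
  have iD := intervalIntegrable_floor hh hT.le (Φ := fun n t => innerDiv h (w n) (ξ t))
    fun n => continuousOn_innerDiv hT hξ (hw.unitMap _) hh
  have iS := fun i j => intervalIntegrable_floor hh hT.le (Φ := fun n t => innerStress h (w n) (ξ t) i j)
    fun n => continuousOn_innerStress hT hξ (hw.unitMap _) hh i j
  have iS' : ∀ i, IntervalIntegrable (fun t => ∑ j, innerStress h (w ⌊t / h⌋₊) (ξ t) i j) volume 0 T := fun i =>
    by simpa only [Finset.sum_fn] using IntervalIntegrable.sum Finset.univ fun j _ => iS i j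
  have iS'' : IntervalIntegrable (fun t => ∑ i, ∑ j, innerStress h (w ⌊t / h⌋₊) (ξ t) i j) volume 0 T :=
    by simpa only [Finset.sum_fn] using IntervalIntegrable.sum Finset.univ fun i _ => iS' i
  rw [intervalIntegral.integral_sub (iL.const_mul 2) ((iD.const_mul _).sub (iS''.const_mul 2)),
    intervalIntegral.integral_sub (iD.const_mul _) (iS''.const_mul 2),
    intervalIntegral.integral_const_mul, intervalIntegral.integral_const_mul,
    intervalIntegral.integral_const_mul, intervalIntegral.integral_finsetSum fun i _ => iS' i]
  simp_rw [fun i => intervalIntegral.integral_finsetSum (s := Finset.univ) fun j _ => iS i j]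
  unfold innerLHS innerRHS spaceTimeIntegral
  congr 2
  refine intervalIntegral.integral_congr fun t _ => ?_
  have : diffQuot h (interpolation h w) t = fun y => h⁻¹ • (w ⌊t / h⌋₊ y - w (⌊t / h⌋₊ - 1) y) := by
    ext1 y; rw [diffQuot, interpolation_sub hh]; rfl
  simp only [this]
  rfl

lemma IsExactScheme.abs_inner_le (hw : IsExactScheme h w) (hT : 0 < T) (hs : 0 < s) (hs1 : s ≤ 1)
    (hsh : s ^ 4 = h) {ξ : ℝ → Space → Space} (hξ : IsSmoothOnTorus T ξ)
    (hM : ∀ t ∈ Set.Icc 0 T, BddC11 M (ξ t)) :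
    |innerLHS T h (interpolation h w) ξ - innerRHS T h (interpolation h w) ξ| ≤
      1100 * M * weightConst ^ 3 * (T + 3) * (s * (energy h (w 0) + 1)) := by
  have hh : 0 < h := hsh ▸ by positivity
  have hM0 := (hM 0 (Set.left_mem_Icc.2 hT.le)).nonneg
  have hA := one_le_weightConst
  have hE : ∀ n, 0 ≤ energy h (w n) := fun n => (hw.unitMap n).energy_nonneg hh
  rw [hw.innerLHS_sub_innerRHS_eq hT hh hξ]
  refine abs_intervalIntegral_le_of_energy (E := fun n => energy h (w n)) hT.le hs hs1 hsh (by positivity)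
    (hw.energy_antitone hh) hE fun t ht => ?_
  generalize ⌊t / h⌋₊ = n
  have h0 := hE 0
  cases n with
  -- On [0,h) no step relation is available. The time quotient vanishes, and a bound by the energy
  -- is enough on an interval of length h.
  | zero =>
    refine ((hw.unitMap 0).abs_inner_variation_self_le hh (hM t ht)).trans ?_
    calc _ ≤ 1100 * M * weightConst ^ 3 * energy h (w 0) := by gcongr <;> norm_num
      _ ≤ _ := by
        simp only [Nat.zero_sub, sub_self, zero_div, zero_add, if_true]
        gcongr
        nlinarith
  | succ m =>
    refine ((hw.step m).abs_inner_variation_le (hw.unitMap _) (hw.unitMap _) hs hs1 hsh (hM t ht)).trans ?_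
    simp only [Nat.add_sub_cancel, Nat.succ_ne_zero, if_false, add_zero]
    gcongr
    exact hw.energy_antitone hh (Nat.zero_le _)

lemma IsExactScheme.abs_outerForm_backward_le (hw : IsExactScheme h w) (hT : 0 < T) (hs : 0 < s) (hs1 : s ≤ 1)
    (hsh : s ^ 4 = h) {ζ : ℝ → Space → ℝ} (hM : ∀ t ∈ Set.Icc 0 T, BddC11 M (ζ t)) (i j : Fin 2) :
    |outerForm T h h (interpolation h w) ζ i j| ≤
      12 * M * weightConst * (T + 3) * (s * (energy h (w 0) + 1)) := by
  have hh : 0 < h := hsh ▸ by positivity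
  have hM0 := (hM 0 (Set.left_mem_Icc.2 hT.le)).nonneg
  have hA := one_le_weightConst
  have hE : ∀ n, 0 ≤ energy h (w n) := fun n => (hw.unitMap n).energy_nonneg hh
  have hr := sqrt_eq_sq_of_pow_four hs hsh
  have hs2 : s ^ 2 ≤ s := pow_le_of_le_one hs.le hs1 (by norm_num)
  have h0 := hE 0
  refine abs_intervalIntegral_le_of_energy (E := fun n => energy h (w n)) hT.le hs hs1 hsh (by positivity)
    (hw.energy_antitone hh) hE fun t ht => ?_
  have e : (fun m x => diffQuot h (fun t => heatConv h fun y => interpolation h w t y m) t x) =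
      fun (m : Fin 2) x => h⁻¹ • (heatConv h (fun y => w ⌊t / h⌋₊ y m) x -
        heatConv h (fun y => w (⌊t / h⌋₊ - 1) y m) x) := by
    ext m x; rw [diffQuot, interpolation_sub hh]; rfl
  change |∫ x in cell, outerIntegrand h (w ⌊t / h⌋₊)
    (fun m x => diffQuot h (fun t => heatConv h fun y => interpolation h w t y m) t x) (ζ t) i j x| ≤ _
  rw [e]
  dsimp only
  generalize ⌊t / h⌋₊ = n
  have hq := (hw.unitMap n).integral_sqrt_defect_le hh
  have hn := hw.energy_antitone hh (Nat.zero_le n)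
  rw [hr] at hq
  cases n with
  -- The quotient is zero and the bare gradient part is only bounded by the energy, not small; again
  -- the length h of the interval compensates.
  | zero =>
    simp only [Nat.zero_sub, sub_self, smul_zero, zero_div, zero_add, if_true]
    refine (abs_integral_outerIntegrand_zero_le (hw.unitMap 0) hh (hM t ht) i j).trans ?_
    rw [hr]
    calc _ ≤ 6 * M / s ^ 2 * weightConst * (s ^ 2 * (2 * energy h (w 0) + 1)) := by gcongr
      _ = 6 * M * weightConst * (2 * energy h (w 0) + 1) := by field_simp
      _ ≤ 6 * M * weightConst * (2 * (s * (energy h (w 0) + 1) + (energy h (w 0) + 1))) := by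
        gcongr
        nlinarith
      _ = _ := by ring
  | succ m =>
    refine (abs_integral_outerIntegrand_backward_le (hw.unitMap _) (hw.unitMap _) hh (hM t ht) i j
      fun x => (hw.step m).mul_eq_mul x i j).trans ?_
    have hd : 0 ≤ (energy h (w (m + 1 - 1)) - energy h (w (m + 1))) / s ^ 2 :=
      div_nonneg (sub_nonneg.2 (hw.energy_antitone hh (Nat.sub_le _ _))) (by positivity)
    simp only [Nat.succ_ne_zero, if_false, add_zero]
    calc _ ≤ M * weightConst * (s * (2 * energy h (w 0) + 1)) := by
          gcongr
          refine hq.trans ?_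
          have := hE (m + 1)
          gcongr
      _ ≤ M * weightConst * (12 * ((energy h (w (m + 1 - 1)) - energy h (w (m + 1))) / s ^ 2 +
            s * (energy h (w 0) + 1))) := by
          refine mul_le_mul_of_nonneg_left ?_ (by positivity)
          nlinarith [mul_nonneg hs.le h0]
      _ = _ := by ring

/-- The forward quotient compares a map with its successor, so the step relation applies from n = 0
on and there is no initial layer to treat separately. -/
lemma IsExactScheme.abs_outerForm_forward_le (hw : IsExactScheme h w) (hT : 0 < T) (hs : 0 < s) (hs1 : s ≤ 1)
    (hsh : s ^ 4 = h) {ζ : ℝ → Space → ℝ} (hM : ∀ t ∈ Set.Icc 0 T, BddC11 M (ζ t)) (i j : Fin 2) :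
    |outerForm T h (-h) (interpolation h w) ζ i j| ≤
      20 * M * weightConst ^ 2 * (T + 3) * (s * (energy h (w 0) + 1)) := by
  have hh : 0 < h := hsh ▸ by positivity
  have hM0 := (hM 0 (Set.left_mem_Icc.2 hT.le)).nonneg
  have hA := one_le_weightConst
  have hE : ∀ n, 0 ≤ energy h (w n) := fun n => (hw.unitMap n).energy_nonneg hh
  have hr := sqrt_eq_sq_of_pow_four hs hsh
  have hs2 : s ^ 2 ≤ s := pow_le_of_le_one hs.le hs1 (by norm_num)
  have h0 := hE 0
  refine abs_intervalIntegral_le_of_energy (E := fun n => energy h (w n)) hT.le hs hs1 hsh (by positivity)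
    (hw.energy_antitone hh) hE fun t ht => ?_
  have e : (fun m x => diffQuot (-h) (fun t => heatConv h fun y => interpolation h w t y m) t x) =
      fun (m : Fin 2) x => (-h)⁻¹ • (heatConv h (fun y => w ⌊t / h⌋₊ y m) x -
        heatConv h (fun y => w (⌊t / h⌋₊ + 1) y m) x) := by
    ext m x; rw [diffQuot, interpolation_add hh ht.1]; rfl
  change |∫ x in cell, outerIntegrand h (w ⌊t / h⌋₊)
    (fun m x => diffQuot (-h) (fun t => heatConv h fun y => interpolation h w t y m) t x) (ζ t) i j x| ≤ _
  rw [e]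
  dsimp only
  generalize ⌊t / h⌋₊ = n
  have hq := (hw.unitMap n).integral_sqrt_defect_le hh
  have hn := hw.energy_antitone hh (Nat.zero_le n)
  have hd : 0 ≤ (energy h (w (n - 1)) - energy h (w n)) / s ^ 2 :=
    div_nonneg (sub_nonneg.2 (hw.energy_antitone hh (Nat.sub_le _ _))) (by positivity)
  have hi : 0 ≤ if n = 0 then energy h (w 0) + 1 else 0 := by split_ifs <;> positivity
  refine (abs_integral_outerIntegrand_forward_le (hw.unitMap n) (hw.unitMap (n + 1)) hh (hM t ht) i j
    (hw.step n)).trans ?_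
  rw [integral_add ((hw.unitMap n).integrable_sqrt_defect hh) (((hw.unitMap n).integrable_defect hh).div_const _),
    integral_div, UnitMap.integral_defect hh]
  have hnE := hE n
  calc _ ≤ 5 * M * weightConst ^ 2 * (s * (2 * energy h (w 0) + 1) + 2 * s * energy h (w 0)) := by
        rw [hr] at hq ⊢
        have e1 : 2 * h * energy h (w n) / s ^ 2 = 2 * s ^ 2 * energy h (w n) := by
          nth_rw 1 [← hsh]; field_simp
        rw [e1]
        gcongr 5 * M * weightConst ^ 2 * (?_ + 2 * ?_ * ?_)
        refine hq.trans ?_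
        gcongr
    _ ≤ 5 * M * weightConst ^ 2 * (4 * ((energy h (w (n - 1)) - energy h (w n)) / s ^ 2 +
          s * (energy h (w 0) + 1) + if n = 0 then energy h (w 0) + 1 else 0)) := by
        gcongr
        nlinarith [mul_nonneg hs.le h0]
    _ = _ := by ring

end

/-! ### Passage to the limit. -/

lemma tendsto_rpow_mul_abs_log (C : ℝ) :
    Tendsto (fun h : ℝ => h ^ (1 / 4 : ℝ) * (C * |Real.log h| + 1)) (𝓝[>] 0) (𝓝 0) := by
  have h1 := (tendsto_log_mul_rpow_nhdsGT_zero (r := 1 / 4) (by norm_num)).abs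
  have h2 : Tendsto (fun h : ℝ => h ^ (1 / 4 : ℝ)) (𝓝[>] 0) (𝓝 0) := by
    have := (Real.continuousAt_rpow_const 0 (1 / 4) (Or.inr (by norm_num))).tendsto
    rw [Real.zero_rpow (by norm_num)] at this
    exact this.mono_left nhdsWithin_le_nhds
  have h3 := (h1.const_mul C).add h2
  rw [abs_zero, mul_zero, add_zero] at h3
  refine h3.congr' ?_
  filter_upwards [self_mem_nhdsWithin] with h hh
  rw [abs_mul, abs_of_pos (Real.rpow_pos_of_pos hh _)]
  ring

/-- With s = h^{1/4}, the logarithmic growth of the initial energy is beaten by the factor s. -/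
lemma tendsto_zero_of_energy_bound {e X : ℝ → ℝ} {C K : ℝ} (hK : 0 ≤ K)
    (hE : ∀ᶠ h : ℝ in 𝓝[>] 0, e h ≤ C * |Real.log h|)
    (hX : ∀ h s : ℝ, 0 < s → s ≤ 1 → s ^ 4 = h → |X h| ≤ K * (s * (e h + 1))) :
    Tendsto X (𝓝[>] 0) (𝓝 0) := by
  have h1 := (tendsto_rpow_mul_abs_log C).const_mul K
  rw [mul_zero] at h1
  refine squeeze_zero_norm' ?_ h1
  filter_upwards [hE, Ioo_mem_nhdsGT zero_lt_one] with h he hh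
  have hs : 0 < h ^ (1 / 4 : ℝ) := Real.rpow_pos_of_pos hh.1 _
  refine (hX h _ hs (Real.rpow_le_one hh.1.le hh.2.le (by norm_num)) ?_).trans ?_
  · rw [← Real.rpow_natCast, ← Real.rpow_mul hh.1.le]; norm_num
  · gcongr

end
end FilamentThresholding
open FilamentThresholding
theorem lemma2p8
    (T : ℝ) (hT : 0 < T)
    (u : ℝ → ℕ → Space → Plane)
    (hu : ∀ h : ℝ, 0 < h → IsThresholdingScheme h (u h))
    (C : ℝ)
    (hE : ∀ᶠ h : ℝ in 𝓝[>] 0, energy h (u h 0) ≤ C * |Real.log h|) :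
    (∀ ξ : ℝ → Space → Space, IsSmoothOnTorus T ξ →
      Tendsto (fun h : ℝ => innerLHS T h (interpolation h (u h)) ξ -
        innerRHS T h (interpolation h (u h)) ξ) (𝓝[>] 0) (𝓝 0)) ∧
    (∀ ζ : ℝ → Space → ℝ, IsSmoothOnTorus T ζ → ∀ i j : Fin 2,
      Tendsto (fun h : ℝ => outerForm T h h (interpolation h (u h)) ζ i j) (𝓝[>] 0) (𝓝 0) ∧
      Tendsto (fun h : ℝ => outerForm T h (-h) (interpolation h (u h)) ζ i j)
        (𝓝[>] 0) (𝓝 0)) := by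
  have hA := one_le_weightConst
  have hpos : ∀ {h s : ℝ}, 0 < s → s ^ 4 = h → 0 < h := fun hs hsh => hsh ▸ by positivity
  have hae : ∀ {h : ℝ} {w : ℕ → Space → Plane}, (∀ n, u h n =ᵐ[volume] w n) → ∀ t,
      interpolation h (u h) t =ᵐ[volume] interpolation h w t := fun hw t => hw _
  refine ⟨fun ξ hξ => ?_, fun ζ hζ i j => ?_⟩
  · obtain ⟨M, hM⟩ := hξ.exists_bddC11 hT
    have hM0 := (hM 0 (Set.left_mem_Icc.2 hT.le)).nonneg
    refine tendsto_zero_of_energy_bound (K := 1100 * M * weightConst ^ 3 * (T + 3)) (by positivity) hE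
      fun h s hs hs1 hsh => ?_
    -- Both sides and the energy are unchanged by modification on null sets, so an exact scheme may
    -- be used.
    obtain ⟨w, hw, huw⟩ := (hu h (hpos hs hsh)).exists_exact
    rw [innerLHS_congr_ae (hae huw), innerRHS_congr_ae (hae huw), energy_congr_ae (huw 0)]
    exact hw.abs_inner_le hT hs hs1 hsh hξ hM
  · obtain ⟨M, hM⟩ := hζ.exists_bddC11 hT
    have hM0 := (hM 0 (Set.left_mem_Icc.2 hT.le)).nonneg
    constructor
    · refine tendsto_zero_of_energy_bound (K := 12 * M * weightConst * (T + 3)) (by positivity) hE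
        fun h s hs hs1 hsh => ?_
      obtain ⟨w, hw, huw⟩ := (hu h (hpos hs hsh)).exists_exact
      rw [outerForm_congr_ae (hae huw), energy_congr_ae (huw 0)]
      exact hw.abs_outerForm_backward_le hT hs hs1 hsh hM i j
    · refine tendsto_zero_of_energy_bound (K := 20 * M * weightConst ^ 2 * (T + 3)) (by positivity) hE
        fun h s hs hs1 hsh => ?_
      obtain ⟨w, hw, huw⟩ := (hu h (hpos hs hsh)).exists_exact
      rw [outerForm_congr_ae (hae huw), energy_congr_ae (huw 0)]
      exact hw.abs_outerForm_forward_le hT hs hs1 hsh hM i j
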